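/- **Setting.** Let $(X,d)$ be a compact metric space and let $\theta>0$ be such that the algebra of real $\theta$-Hölder functions on $X$ is normal: any two disjoint compact subsets of $X$ are separated by a $\theta$-Hölder function $X\to[0,1]$ equal to $0$ on one and $1$ on the other. Let $\pi:\mathbb{E}\to X$ be a real vector bundle of rank $d$ that is $\theta$-Hölder, i.e. its coordinate transformations are locally $\theta$-Hölder. A *Finsler norm* is a continuous function $\|\cdot\|$ on $\mathbb{E}$ restricting to a norm on each fiber; it is *Riemannian* if each of these norms comes from an inner product. Linear maps between fibers are given the operator norm. Let $T:X\to X$ be a homeomorphism. Let $$W^u_\epsilon(x)=\{y: d(T^{-n}y,T^{-n}x)\le\epsilon\ \ \forall n\ge0\},\qquad W^s_\epsilon(x)=\{y: d(T^{n}y,T^{n}x)\le\epsilon\ \ \forall n\ge0\},$$ and let $W^u(x)$, $W^s(x)$ be the sets of $y$ with $d(T^{-n}y,T^{-n}x)\to0$, respectively $d(T^{n}y,T^{n}x)\to0$, as $n\to+\infty$. Assume that $T$ is *hyperbolic*: $T$ and $T^{-1}$ are Lipschitz; there are $\epsilon_0>0$ and continuous functions $\lambda_u,\lambda_s:X\to(0,\infty)$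 such that $d(T^{-1}x',T^{-1}x'')\le e^{-\lambda_u(x)}d(x',x'')$ for $x',x''\in W^u_{\epsilon_0}(x)$ and $d(Ty',Ty'')\le e^{-\lambda_s(y)}d(y',y'')$ for $y',y''\in W^s_{\epsilon_0}(y)$; and there are $\epsilon_1\in(0,\epsilon_0)$ and $C>0$ such that, whenever $d(x,y)\le2\epsilon_1$, the set $W^u_{\epsilon_0}(x)\cap W^s_{\epsilon_0}(y)$ consists of exactly one point $[x,y]$, which depends continuously on $(x,y)$ and satisfies $\max\{d([x,y],x),d([x,y],y)\}\le C\,d(x,y)$. Let $\Phi$ be an automorphism of $\mathbb{E}$ covering $T$, given by linear isomorphisms $\Phi_x:\mathbb{E}_x\to\mathbb{E}_{Tx}$; write $\Phi^n_x=\Phi_{T^{n-1}x}\circ\cdots\circ\Phi_x$. Assume that $\Phi$ is *$\theta$-Hölder* ($x\mapsto\Phi_x$ is locally $\theta$-Hölder in bundle coordinates) and *fiber-bunched*: for some Riemannian norm, $$\log\big(\|\Phi_x\|\,\|\Phi_x^{-1}\|\big)<\min\{\theta\lambda_u(x),\theta\lambda_s(x)\}\qquad\text{for all }x\in X.$$ Let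 $I_{y\leftarrow x}:\mathbb{E}_x\to\mathbb{E}_y$ be a family of *transport maps*: linear maps, locally $\theta$-Hölder in $(x,y)$ in bundle coordinates, with $I_{x\leftarrow x}=\mathrm{id}$. The *stable holonomies* are $$H^s_{y\leftarrow x}=\lim_{n\to+\infty}(\Phi^n_y)^{-1}\circ I_{T^ny\leftarrow T^nx}\circ\Phi^n_x\qquad(y\in W^s(x)),$$ and the *unstable holonomies* $H^u_{y\leftarrow x}$, $y\in W^u(x)$, are given by the same formula with $n\to-\infty$. (Transport maps exist, and the limits exist and do not depend on the choice of transport maps.) $\Phi$ is *spannable* if for all $x,y\in X$ and every nonzero $u\in\mathbb{E}_x$ there are points $x_1,\dots,x_d\in W^u(x)$ and integers $n_1,\dots,n_d\ge0$ such that the points $y_i=T^{n_i}x_i$ all belong to $W^s(y)$ and the vectors $$v_i=H^s_{y\leftarrow y_i}\circ\Phi^{n_i}_{x_i}\circ H^u_{x_i\leftarrow x}(u),\qquad i=1,\dots,d,$$ form a basis of $\mathbb{E}_y$. The *maximal Lyapunov exponent* is $\beta(\Phi)=\sup_\mu\int\chi_1(\Phi,x)\,d\mu(x)$, where $\mu$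 ranges over the $T$-invariant Borel probability measures and $\chi_1(\Phi,x)=\lim_{n\to\infty}\frac1n\log\|\Phi^n_x\|$, a limit that exists for $\mu$-almost every $x$. **Proposition.** Every spannable automorphism $\Phi$ is relatively product bounded: for every Finsler norm on $\mathbb{E}$, $$\sup_{n\ge0}\,e^{-n\beta(\Phi)}\sup_{x\in X}\|\Phi^n_x\|<\infty.$$ -/

import Mathlib

open Bundle Set Filter Topology MeasureTheory
open scoped NNReal

noncomputable section

namespace SpannableCocycle

/-! ### Hölder regularity -/

/-- `f` is locally `θ`-Hölder on the set `s`. -/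
def LocallyHolderOn {A B : Type*} [PseudoEMetricSpace A] [PseudoEMetricSpace B]
    (θ : ℝ≥0) (f : A → B) (s : Set A) : Prop :=
  ∀ a ∈ s, ∃ C : ℝ≥0, ∃ t ∈ 𝓝[s] a, HolderOnWith C θ f t

/-- The algebra of real-valued `θ`-Hölder functions on `X` is normal: disjoint compact sets are
separated by a `θ`-Hölder function with values in `[0,1]`. -/
def NormalHolderAlgebra (X : Type*) [PseudoEMetricSpace X] (θ : ℝ≥0) : Prop :=
  ∀ K₀ K₁ : Set X, IsCompact K₀ → IsCompact K₁ → Disjoint K₀ K₁ →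
    ∃ f : X → ℝ, (∃ C : ℝ≥0, HolderWith C θ f) ∧ (∀ x, f x ∈ Icc (0 : ℝ) 1) ∧
      (∀ x ∈ K₀, f x = 0) ∧ (∀ x ∈ K₁, f x = 1)

/-! ### Hyperbolic homeomorphisms -/

section Base

variable {X : Type*} [MetricSpace X]

/-- Local stable set `W^s_ε(x)`. -/
def localStable (T : X ≃ₜ X) (ε : ℝ) (x : X) : Set X :=
  {y | ∀ n : ℕ, dist (T^[n] y) (T^[n] x) ≤ ε}

/-- Local unstable set `W^u_ε(x)`. -/
def localUnstable (T : X ≃ₜ X) (ε : ℝ) (x : X) : Set X :=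
  {y | ∀ n : ℕ, dist (T.symm^[n] y) (T.symm^[n] x) ≤ ε}

/-- Stable set `W^s(x)`. -/
def stableSet (T : X ≃ₜ X) (x : X) : Set X :=
  {y | Tendsto (fun n : ℕ => dist (T^[n] y) (T^[n] x)) atTop (𝓝 0)}

/-- Unstable set `W^u(x)`. -/
def unstableSet (T : X ≃ₜ X) (x : X) : Set X :=
  {y | Tendsto (fun n : ℕ => dist (T.symm^[n] y) (T.symm^[n] x)) atTop (𝓝 0)}

/-- `T` is a hyperbolic homeomorphism, with constant `ε₀` and with hyperbolicity exponents
`lamU` and `lamS`. -/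
structure IsHyperbolic (T : X ≃ₜ X) (ε₀ : ℝ) (lamU lamS : X → ℝ) : Prop where
  lipschitz : ∃ L : ℝ≥0, LipschitzWith L T
  lipschitz_symm : ∃ L : ℝ≥0, LipschitzWith L T.symm
  eps_pos : 0 < ε₀
  continuous_lamU : Continuous lamU
  continuous_lamS : Continuous lamS
  lamU_pos : ∀ x, 0 < lamU x
  lamS_pos : ∀ x, 0 < lamS x
  contract_unstable : ∀ x, ∀ x' ∈ localUnstable T ε₀ x, ∀ x'' ∈ localUnstable T ε₀ x,
    dist (T.symm x') (T.symm x'') ≤ Real.exp (-lamU x) * dist x' x''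
  contract_stable : ∀ y, ∀ y' ∈ localStable T ε₀ y, ∀ y'' ∈ localStable T ε₀ y,
    dist (T y') (T y'') ≤ Real.exp (-lamS y) * dist y' y''
  /-- Existence, uniqueness and continuity of the bracket, and the bound on its position. -/
  bracket : ∃ ε₁ : ℝ, 0 < ε₁ ∧ ε₁ < ε₀ ∧ ∃ b : X → X → X,
    (∀ x y, dist x y ≤ 2 * ε₁ → localUnstable T ε₀ x ∩ localStable T ε₀ y = {b x y}) ∧
    ContinuousOn (fun p : X × X => b p.1 p.2) {p | dist p.1 p.2 ≤ 2 * ε₁} ∧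
    ∃ C : ℝ, 0 < C ∧ ∀ x y, dist x y ≤ 2 * ε₁ →
      max (dist (b x y) x) (dist (b x y) y) ≤ C * dist x y

end Base

/-! ### Hölder bundles, transport maps, Finsler norms -/

section VectorBundle

variable {X : Type*} [MetricSpace X] (F : Type*) [NormedAddCommGroup F] [NormedSpace ℝ F]
  (E : X → Type*) [∀ x, AddCommGroup (E x)] [∀ x, Module ℝ (E x)]
  [∀ x, TopologicalSpace (E x)] [TopologicalSpace (TotalSpace F E)]
  [FiberBundle F E] [VectorBundle ℝ F E]

/-- `E` is a `θ`-Hölder vector bundle: the coordinate transformations between the trivializations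
of its atlas are locally `θ`-Hölder. -/
def IsHolderBundle (θ : ℝ≥0) : Prop :=
  ∀ (e e' : Trivialization F (π F E)) [MemTrivializationAtlas e] [MemTrivializationAtlas e'],
    LocallyHolderOn θ (fun x => (Trivialization.coordChangeL ℝ e e' x : F →L[ℝ] F))
      (e.baseSet ∩ e'.baseSet)

variable {E}

/-- `I x y : E x → E y` is a family of transport maps: it is the identity on the diagonal, and it
is `θ`-Hölder when it is read in the coordinates of the bundle. -/
def IsTransport (θ : ℝ≥0) (I : ∀ x y : X, E x →L[ℝ] E y) : Prop :=
  (∀ x, I x x = ContinuousLinearMap.id ℝ (E x)) ∧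
  ∀ (e e' : Trivialization F (π F E)) [MemTrivializationAtlas e] [MemTrivializationAtlas e'],
    LocallyHolderOn θ
      (fun p : X × X =>
        (e'.continuousLinearMapAt ℝ p.2) ∘L (I p.1 p.2) ∘L (e.symmL ℝ p.1))
      (e.baseSet ×ˢ e'.baseSet)

variable (E)

/-- A choice of transport maps of the bundle. The holonomies defined below do not depend on it. -/
def transport (θ : ℝ≥0) : ∀ x y : X, E x →L[ℝ] E y :=
  Classical.epsilon (IsTransport F θ)

/-- A Finsler norm: a continuous function on the total space that is a norm on each fiber. -/
structure FinslerNorm where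
  toFun : ∀ x : X, E x → ℝ
  continuous' : Continuous fun v : TotalSpace F E => toFun v.proj v.snd
  add_le' : ∀ x (u v : E x), toFun x (u + v) ≤ toFun x u + toFun x v
  smul' : ∀ x (c : ℝ) (u : E x), toFun x (c • u) = |c| * toFun x u
  eq_zero' : ∀ x (u : E x), toFun x u = 0 → u = 0

variable {F E}

/-- The Finsler norm comes from an inner product on each fiber. -/
def FinslerNorm.IsRiemannian (N : FinslerNorm F E) : Prop :=
  ∀ x, ∃ B : LinearMap.BilinForm ℝ (E x), (∀ u v, B u v = B v u) ∧ ∀ u, B u u = N.toFun x u ^ 2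

/-- Operator norm `sup_{u ≠ 0} ‖L u‖ / ‖u‖` of a linear map between two fibers. -/
def FinslerNorm.opNorm (N : FinslerNorm F E) {x y : X} (L : E x →L[ℝ] E y) : ℝ :=
  ⨆ u : {u : E x // u ≠ 0}, N.toFun y (L u) / N.toFun x u

/-- Bolicity `‖L‖ ‖L⁻¹‖` of an isomorphism between two fibers. -/
def FinslerNorm.bol (N : FinslerNorm F E) {x y : X} (L : E x ≃L[ℝ] E y) : ℝ :=
  N.opNorm (L : E x →L[ℝ] E y) * N.opNorm (L.symm : E y →L[ℝ] E x)

end VectorBundle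

/-! ### Automorphisms -/

section Automorphism

variable {X : Type*} [MetricSpace X]
  {E : X → Type*} [∀ x, AddCommGroup (E x)] [∀ x, Module ℝ (E x)] [∀ x, TopologicalSpace (E x)]

/-- A fiberwise linear isomorphism covering `T`. -/
abbrev Aut (E : X → Type*) [∀ x, AddCommGroup (E x)] [∀ x, Module ℝ (E x)]
    [∀ x, TopologicalSpace (E x)] (T : X ≃ₜ X) :=
  ∀ x, E x ≃L[ℝ] E (T x)

/-- Identification of the fibers over two equal points. -/
def castFiber {x y : X} (h : x = y) : E x ≃L[ℝ] E y :=
  h ▸ ContinuousLinearEquiv.refl ℝ (E x)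

/-- The inverse automorphism `Φ⁻¹`, which covers `T⁻¹`. -/
def Aut.inv {T : X ≃ₜ X} (Φ : Aut E T) : Aut E T.symm := fun x =>
  (castFiber (T.apply_symm_apply x).symm).trans (Φ (T.symm x)).symm

/-- The iterate `Φⁿ_x : E_x → E_{Tⁿ x}`. -/
def Aut.iter {T : X ≃ₜ X} (Φ : Aut E T) : ∀ (n : ℕ) (x : X), E x ≃L[ℝ] E (T^[n] x)
  | 0, x => ContinuousLinearEquiv.refl ℝ (E x)
  | n + 1, x => (Φ x).trans (Aut.iter Φ n (T x))

variable (F : Type*) [NormedAddCommGroup F] [NormedSpace ℝ F]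
  [TopologicalSpace (TotalSpace F E)] [FiberBundle F E] [VectorBundle ℝ F E]

/-- `Φ` is `θ`-Hölder: `T` is Lipschitz and `Φ` is `θ`-Hölder when it is read in the coordinates
of the bundle. -/
def Aut.IsHolder {T : X ≃ₜ X} (Φ : Aut E T) (θ : ℝ≥0) : Prop :=
  (∃ L : ℝ≥0, LipschitzWith L T) ∧
  ∀ (e e' : Trivialization F (π F E)) [MemTrivializationAtlas e] [MemTrivializationAtlas e'],
    LocallyHolderOn θ
      (fun x =>
        (e'.continuousLinearMapAt ℝ (T x)) ∘L (Φ x : E x →L[ℝ] E (T x)) ∘L (e.symmL ℝ x))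
      (e.baseSet ∩ T ⁻¹' e'.baseSet)

/-- `Φ` is fiber-bunched with respect to the exponents `lamU`, `lamS`. -/
def Aut.IsFiberBunched {T : X ≃ₜ X} (Φ : Aut E T) (θ : ℝ≥0) (lamU lamS : X → ℝ) : Prop :=
  ∃ N : FinslerNorm F E, N.IsRiemannian ∧
    ∀ x, Real.log (N.bol (Φ x)) < min (θ * lamU x) (θ * lamS x)

/-- The stable holonomy `H^s_{y ← x} = lim_{n → ∞} (Φⁿ_y)⁻¹ ∘ I_{Tⁿ y ← Tⁿ x} ∘ Φⁿ_x`, as a map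
from `E x` to `E y`; it is meaningful when `y` belongs to the stable set of `x`. -/
def Aut.stableHolonomy {T : X ≃ₜ X} (Φ : Aut E T) (θ : ℝ≥0) (x y : X) (u : E x) : E y :=
  limUnder atTop fun n : ℕ =>
    (Φ.iter n y).symm (transport F E θ (T^[n] x) (T^[n] y) (Φ.iter n x u))

/-- The unstable holonomy `H^u_{y ← x}`: the same limit for `n → -∞`, that is, the stable holonomy
of `Φ⁻¹`. -/
def Aut.unstableHolonomy {T : X ≃ₜ X} (Φ : Aut E T) (θ : ℝ≥0) (x y : X) (u : E x) : E y :=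
  Aut.stableHolonomy F (Aut.inv Φ) θ x y u

/-- `Φ` is a spannable automorphism of the `d`-dimensional bundle `E`: it is `θ`-Hölder and
fiber-bunched, and for all `x`, `y` and all nonzero `u` in `E x` there are points
`p₁, …, p_d` in `W^u(x)` and times `n₁, …, n_d ≥ 0` such that the points `q_i = T^{n_i} p_i` lie in
`W^s(y)` and the vectors `H^s_{y ← q_i} Φ^{n_i} H^u_{p_i ← x} u` form a basis of `E y`. -/
structure Aut.IsSpannable {T : X ≃ₜ X} (Φ : Aut E T) (d : ℕ) (θ : ℝ≥0) (lamU lamS : X → ℝ) :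
    Prop where
  isHolder : Φ.IsHolder F θ
  isFiberBunched : Φ.IsFiberBunched F θ lamU lamS
  spanning : ∀ (x y : X) (u : E x), u ≠ 0 →
    ∃ (p : Fin d → X) (n : Fin d → ℕ),
      (∀ i, p i ∈ unstableSet T x) ∧
      (∀ i, T^[n i] (p i) ∈ stableSet T y) ∧
      ∃ v : Fin d → E y,
        (∀ i, v i = Φ.stableHolonomy F θ (T^[n i] (p i)) y
          (Φ.iter (n i) (p i) (Φ.unstableHolonomy F θ x (p i) u))) ∧
        LinearIndependent ℝ v ∧ Submodule.span ℝ (range v) = ⊤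

variable {F}

/-- The first Lyapunov exponent `lim (1/n) log ‖Φⁿ_x‖` at the point `x`. The limit exists at almost
every point for every invariant probability measure; the upper limit extends it to all points. -/
def Aut.lyapunov {T : X ≃ₜ X} (Φ : Aut E T) (N : FinslerNorm F E) (x : X) : ℝ :=
  limsup (fun n : ℕ => (1 / (n : ℝ)) * Real.log (N.opNorm (Φ.iter n x : E x →L[ℝ] E (T^[n] x))))
    atTop

/-- The maximal Lyapunov exponent `β(Φ)`: the supremum over the `T`-invariant Borel probability
measures `μ` of the integral of the first Lyapunov exponent. -/
def Aut.beta [MeasurableSpace X] {T : X ≃ₜ X} (Φ : Aut E T) (N : FinslerNorm F E) : ℝ :=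
  sSup {c : ℝ | ∃ μ : Measure X, IsProbabilityMeasure μ ∧ MeasurePreserving T μ μ ∧
    c = ∫ x, Φ.lyapunov N x ∂μ}

/-- `Φ` is relatively product bounded, with respect to the Finsler norm `N`:
`sup_{n ≥ 0} e^{-β(Φ) n} sup_x ‖Φⁿ_x‖ < ∞`. -/
def Aut.IsRelativelyProductBounded [MeasurableSpace X] {T : X ≃ₜ X} (Φ : Aut E T)
    (N : FinslerNorm F E) : Prop :=
  ∃ C : ℝ, ∀ (n : ℕ) (x : X),
    Real.exp (-(Φ.beta N) * n) * N.opNorm (Φ.iter n x : E x →L[ℝ] E (T^[n] x)) ≤ C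

end Automorphism

end SpannableCocycle

end

/-! Let s_n be the maximum over x of log ‖Φ^n_x‖. Submultiplicativity of the norm makes s_n
subadditive. The heart of the matter is the reverse inequality up to a constant: ‖Φ^m_y‖ ‖Φ^n_x‖ ≤ C
sup_z ‖Φ^{m+n}_z‖ for all x and y (`IsHyperbolic.exists_quasimultiplicative`). Then log C - s_n is
subadditive as well, and Fekete's lemma applied to both sequences gives n b ≤ s_n ≤ n b + log C with
b = lim s_n / n (`exists_growth_rate`). It remains to see that b ≤ β(Φ). A weak limit of empirical
measures on orbit segments of maximal growth is an invariant measure μ with m b ≤ ∫ log ‖Φ^m‖ dμ for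
every m, and the reverse Fatou lemma bounds b by the μ-integral of the first exponent.

The reverse inequality is where spannability enters. Let u be a unit vector in the direction of
Φ^n_x e. Orbits from W^u(T^n x) to W^s(y) provide maps W_1, ..., W_d, compositions of holonomies and
iterates, such that the vectors W_i u form a basis over y; hence ‖Φ^m_y‖ is controlled by the norms
‖Φ^m_y W_i u‖. Since holonomies commute with the dynamics, Φ^m_y W_i Φ^n_x is a genuine iterate of m
+ n steps along one connecting orbit, multiplied by boundedly many further iterates and by uniformly
bounded holonomies (`IsHyperbolic.exists_connecting_map`). For the constants to be uniform, the
connecting orbits are deformed continuously with their endpoints by means of the bracket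
(`IsHyperbolic.exists_connecting`); compactness of the set of triples (x, y, u) does the rest.

To avoid working in varying fibers, the bundle is embedded by Hölder bump functions into a trivial
bundle with fiber V. A map between fibers becomes an endomorphism of V that factors through
projections `P x` onto the embedded fibers, and `LinearSystem` records the algebra. Fiber-bunching
makes the holonomies converge geometrically, uniformly over pairs of points whose orbits stay
δ-close (`IsHyperbolic.exists_holonomySystem`), so that they are continuous and bounded on such
pairs. -/

noncomputable section

namespace SpannableCocycle

/-! ### Cocycles of endomorphisms that are invertible between ranges of projections. -/

section LinearSystem

variable {X V : Type*} [MetricSpace X] [NormedAddCommGroup V] [NormedSpace ℝ V]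

/-- The products `A (Tⁿ⁻¹ x) ⋯ A (T x) A x`, with value `P x` for `n = 0`. -/
def cocycle (T : X → X) (P A : X → V →L[ℝ] V) : ℕ → X → V →L[ℝ] V
  | 0, x => P x
  | n + 1, x => cocycle T P A n (T x) * A x

/-- `A x` is an isomorphism from the range of the projection `P x` onto the range of `P (T x)`,
with inverse `B (T x)`. -/
structure LinearSystem (T : X ≃ₜ X) (P A B : X → V →L[ℝ] V) : Prop where
  continuous_proj : Continuous P
  continuous_fwd : Continuous A
  continuous_bwd : Continuous B
  proj_proj : ∀ x, P x * P x = P x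
  fwd_proj : ∀ x, A x * P x = A x
  proj_fwd : ∀ x, P (T x) * A x = A x
  bwd_proj : ∀ x, B x * P x = B x
  proj_bwd : ∀ x, P (T.symm x) * B x = B x
  bwd_fwd : ∀ x, B (T x) * A x = P x
  fwd_bwd : ∀ x, A (T.symm x) * B x = P x

theorem iterate_apply_symm_iterate (T : X ≃ₜ X) (n : ℕ) (x : X) : T^[n] (T.symm^[n] x) = x :=
  (Function.RightInverse.iterate T.apply_symm_apply n) x

theorem iterate_symm_apply_iterate (T : X ≃ₜ X) (n : ℕ) (x : X) : T.symm^[n] (T^[n] x) = x :=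
  (Function.LeftInverse.iterate T.symm_apply_apply n) x

namespace LinearSystem

variable {T : X ≃ₜ X} {P A B : X → V →L[ℝ] V}

protected theorem symm (h : LinearSystem T P A B) : LinearSystem T.symm P B A where
  continuous_proj := h.continuous_proj
  continuous_fwd := h.continuous_bwd
  continuous_bwd := h.continuous_fwd
  proj_proj := h.proj_proj
  fwd_proj := h.bwd_proj
  proj_fwd := h.proj_bwd
  bwd_proj := h.fwd_proj
  proj_bwd := h.proj_fwd
  bwd_fwd := h.fwd_bwd
  fwd_bwd := h.bwd_fwd

variable (h : LinearSystem T P A B)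
include h

theorem cocycle_proj (n : ℕ) (x : X) : cocycle T P A n x * P x = cocycle T P A n x := by
  cases n with
  | zero => exact h.proj_proj x
  | succ n => simp only [cocycle, mul_assoc, h.fwd_proj]

theorem proj_cocycle (n : ℕ) (x : X) :
    P (T^[n] x) * cocycle T P A n x = cocycle T P A n x := by
  induction n generalizing x with
  | zero => exact h.proj_proj x
  | succ n ih => rw [cocycle, ← mul_assoc, Function.iterate_succ_apply, ih]

theorem cocycle_add (m n : ℕ) (x : X) :
    cocycle T P A (m + n) x = cocycle T P A m (T^[n] x) * cocycle T P A n x := by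
  induction n generalizing x with
  | zero => exact (h.cocycle_proj m x).symm
  | succ n ih => rw [← add_assoc, cocycle, ih, cocycle, mul_assoc, Function.iterate_succ_apply]

theorem cocycle_one (x : X) : cocycle T P A 1 x = A x := h.proj_fwd x

theorem cocycle_succ' (n : ℕ) (x : X) :
    cocycle T P A (n + 1) x = A (T^[n] x) * cocycle T P A n x := by
  rw [add_comm, h.cocycle_add, h.cocycle_one]

theorem cocycle_symm_mul_cocycle (n : ℕ) (x : X) :
    cocycle T.symm P B n (T^[n] x) * cocycle T P A n x = P x := by
  induction n generalizing x with
  | zero => exact h.proj_proj x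
  | succ n ih =>
    rw [h.symm.cocycle_succ', cocycle, Function.iterate_succ_apply, iterate_symm_apply_iterate,
      mul_assoc, ← mul_assoc _ _ (A x), ih, h.proj_fwd, h.bwd_fwd]

theorem cocycle_mul_cocycle_symm (n : ℕ) (x : X) :
    cocycle T P A n (T.symm^[n] x) * cocycle T.symm P B n x = P x :=
  h.symm.cocycle_symm_mul_cocycle n x

theorem continuous_cocycle (n : ℕ) : Continuous (cocycle T P A n) := by
  induction n with
  | zero => exact h.continuous_proj
  | succ n ih => exact (ih.comp T.continuous).mul h.continuous_fwd

theorem exists_norm_cocycle_le [CompactSpace X] (n : ℕ) :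
    ∃ K, 0 < K ∧ ∀ x, ‖cocycle T P A n x‖ ≤ K := by
  obtain ⟨K, hK⟩ := isCompact_univ.exists_bound_of_continuousOn (h.continuous_cocycle n).continuousOn
  exact ⟨max K 1, by positivity, fun x => (hK x (mem_univ x)).trans (le_max_left _ _)⟩

end LinearSystem

/-! ### Holonomies: convergence, equivariance, continuity and uniform bounds. -/

/-- Pairs of points whose forward orbits stay at distance at most `δ`. -/
def shadowing (T : X ≃ₜ X) (δ : ℝ) : Set (X × X) :=
  {p | ∀ n : ℕ, dist (T^[n] p.1) (T^[n] p.2) ≤ δ}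

theorem shadowing_iterate {T : X ≃ₜ X} {δ : ℝ} {x y : X} (h : (x, y) ∈ shadowing T δ) (n : ℕ) :
    (T^[n] x, T^[n] y) ∈ shadowing T δ := fun k => by
  simpa only [← Function.iterate_add_apply] using h (k + n)

theorem isClosed_shadowing (T : X ≃ₜ X) (δ : ℝ) : IsClosed (shadowing T δ) := by
  simp only [shadowing, ofPred_forall]
  refine isClosed_iInter fun n => isClosed_le ?_ continuous_const
  have hT := T.continuous.iterate n
  fun_prop

/-- The approximations of the holonomy. -/
def holStage (T : X ≃ₜ X) (P A B : X → V →L[ℝ] V) (J : X → X → V →L[ℝ] V) (n : ℕ) (x y : X) :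
    V →L[ℝ] V :=
  cocycle T.symm P B n (T^[n] y) * J (T^[n] x) (T^[n] y) * cocycle T P A n x

/-- The stable holonomy, from the fiber over `x` to the fiber over `y`. -/
def hol (T : X ≃ₜ X) (P A B : X → V →L[ℝ] V) (J : X → X → V →L[ℝ] V) (x y : X) : V →L[ℝ] V :=
  limUnder atTop fun n => holStage T P A B J n x y

/-- A linear system with transport maps `J`, for which the approximations of the holonomy converge
uniformly on pairs of `δ`-shadowing points. -/
structure HolonomySystem (T : X ≃ₜ X) (P A B : X → V →L[ℝ] V) (J : X → X → V →L[ℝ] V) (δ : ℝ) :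
    Prop extends LinearSystem T P A B where
  continuous_transport : Continuous fun p : X × X => J p.1 p.2
  transport_self : ∀ x, J x x = P x
  proj_transport : ∀ x y, P y * J x y = J x y
  delta_pos : 0 < δ
  geometric : ∃ K r : ℝ, 0 ≤ r ∧ r < 1 ∧ ∀ x y, (x, y) ∈ shadowing T δ → ∀ n,
    ‖holStage T P A B J (n + 1) x y - holStage T P A B J n x y‖ ≤ K * r ^ n

namespace HolonomySystem

variable {T : X ≃ₜ X} {P A B : X → V →L[ℝ] V} {J : X → X → V →L[ℝ] V} {δ : ℝ}

/-- The last n of the n + k steps only see the orbits from time k on, so a stage at (x, y) is a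
conjugate of a stage at (T^k x, T^k y). Convergence and equivariance are both pulled back from the
tails of the orbits in this way. -/
theorem holStage_add (h : LinearSystem T P A B) (n k : ℕ) (x y : X) :
    holStage T P A B J (n + k) x y =
      cocycle T.symm P B k (T^[k] y) * holStage T P A B J n (T^[k] x) (T^[k] y) *
        cocycle T P A k x := by
  have e : T.symm^[n] (T^[n + k] y) = T^[k] y := by
    rw [Function.iterate_add_apply, iterate_symm_apply_iterate]
  simp only [holStage, h.cocycle_add]
  rw [add_comm n k, h.symm.cocycle_add, add_comm k n, e]
  simp only [Function.iterate_add_apply, mul_assoc]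

variable [CompleteSpace V] (h : HolonomySystem T P A B J δ)
include h

theorem tendsto_of_shadowing {x y : X} (hxy : (x, y) ∈ shadowing T δ) :
    Tendsto (fun n => holStage T P A B J n x y) atTop (𝓝 (hol T P A B J x y)) := by
  obtain ⟨K, r, -, hr1, hK⟩ := h.geometric
  refine CauchySeq.tendsto_limUnder (cauchySeq_of_le_geometric r K hr1 fun n => ?_)
  rw [dist_comm, dist_eq_norm]
  exact hK x y hxy n

/-- Asymptotic orbits are δ-close from some time k on, and there the uniform estimate applies. -/
theorem tendsto {x y : X} (hxy : x ∈ stableSet T y) :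
    Tendsto (fun n => holStage T P A B J n x y) atTop (𝓝 (hol T P A B J x y)) := by
  obtain ⟨k, hk⟩ := eventually_atTop.1 (hxy.eventually (ge_mem_nhds h.delta_pos))
  have hs : (T^[k] x, T^[k] y) ∈ shadowing T δ := fun n => by
    simpa only [← Function.iterate_add_apply] using hk (n + k) (Nat.le_add_left _ _)
  have := ((h.tendsto_of_shadowing hs).const_mul (cocycle T.symm P B k (T^[k] y))).mul_const
    (cocycle T P A k x)
  simp only [← holStage_add h.toLinearSystem] at this
  exact tendsto_nhds_limUnder ⟨_, (tendsto_add_atTop_iff_nat k).1 this⟩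

theorem hol_eq {x y : X} (hxy : Tendsto (fun n => holStage T P A B J n x y) atTop
    (𝓝 (hol T P A B J x y))) {k : ℕ} (hk : (T^[k] x, T^[k] y) ∈ shadowing T δ) :
    hol T P A B J x y = cocycle T.symm P B k (T^[k] y) * hol T P A B J (T^[k] x) (T^[k] y) *
      cocycle T P A k x := by
  have := ((h.tendsto_of_shadowing hk).const_mul (cocycle T.symm P B k (T^[k] y))).mul_const
    (cocycle T P A k x)
  simp only [← holStage_add h.toLinearSystem] at this
  exact tendsto_nhds_unique ((tendsto_add_atTop_iff_nat k).2 hxy) this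

theorem proj_hol {x y : X} (hxy : (x, y) ∈ shadowing T δ) :
    P y * hol T P A B J x y = hol T P A B J x y := by
  refine tendsto_nhds_unique ((h.tendsto_of_shadowing hxy).const_mul (P y)) ?_
  refine (h.tendsto_of_shadowing hxy).congr fun n => ?_
  have := h.symm.proj_cocycle n (T^[n] y)
  rw [iterate_symm_apply_iterate] at this
  rw [holStage, ← mul_assoc, ← mul_assoc, this]

theorem hol_proj {x y : X} (hxy : (x, y) ∈ shadowing T δ) :
    hol T P A B J x y * P x = hol T P A B J x y := by
  refine tendsto_nhds_unique ((h.tendsto_of_shadowing hxy).mul_const (P x)) ?_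
  refine (h.tendsto_of_shadowing hxy).congr fun n => ?_
  rw [holStage, mul_assoc _ _ (P x), h.cocycle_proj]

/-- Equivariance of the holonomy: the backward cocycle in `hol_eq` is cancelled by the forward one,
up to a projection that the holonomy absorbs. -/
theorem cocycle_mul_hol {x y : X} (hxy : (x, y) ∈ shadowing T δ) (k : ℕ) :
    cocycle T P A k y * hol T P A B J x y = hol T P A B J (T^[k] x) (T^[k] y) *
      cocycle T P A k x := by
  have hk := shadowing_iterate hxy k
  have e := h.cocycle_mul_cocycle_symm k (T^[k] y)
  rw [iterate_symm_apply_iterate] at e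
  rw [h.hol_eq (h.tendsto_of_shadowing hxy) hk, mul_assoc, ← mul_assoc (cocycle T P A k y), e,
    ← mul_assoc, h.proj_hol hk]

theorem exists_norm_sub_le : ∃ K r : ℝ, 0 ≤ r ∧ r < 1 ∧ ∀ x y, (x, y) ∈ shadowing T δ → ∀ n,
    dist (holStage T P A B J n x y) (hol T P A B J x y) ≤ K * r ^ n := by
  obtain ⟨K, r, hr0, hr1, hK⟩ := h.geometric
  refine ⟨K / (1 - r), r, hr0, hr1, fun x y hxy n => ?_⟩
  have := dist_le_of_le_geometric_of_tendsto r K hr1 (fun n => ?_) (h.tendsto_of_shadowing hxy) n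
  · rwa [mul_div_right_comm] at this
  · rw [dist_comm, dist_eq_norm]
    exact hK x y hxy n

omit [CompleteSpace V] in
theorem continuous_holStage (n : ℕ) :
    Continuous fun p : X × X => holStage T P A B J n p.1 p.2 := by
  have hT := T.continuous.iterate n
  have h1 := h.continuous_cocycle n
  have h2 := h.symm.continuous_cocycle n
  have h3 : Continuous fun p : X × X => J (T^[n] p.1) (T^[n] p.2) :=
    h.continuous_transport.comp (by fun_prop : Continuous fun p : X × X => (T^[n] p.1, T^[n] p.2))
  exact ((h2.comp (hT.comp continuous_snd)).mul h3).mul (h1.comp continuous_fst)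

/-- A uniform limit of continuous stages; uniformity comes from the tail of the geometric series. -/
theorem continuousOn_hol :
    ContinuousOn (fun p : X × X => hol T P A B J p.1 p.2) (shadowing T δ) := by
  obtain ⟨K, r, hr0, hr1, hK⟩ := h.exists_norm_sub_le
  refine TendstoUniformlyOn.continuousOn (p := atTop)
    (F := fun n (p : X × X) => holStage T P A B J n p.1 p.2) ?_
    (Frequently.of_forall fun n => (h.continuous_holStage n).continuousOn)
  rw [Metric.tendstoUniformlyOn_iff]
  intro ε hε
  have : Tendsto (fun n : ℕ => K * r ^ n) atTop (𝓝 0) := by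
    simpa using (tendsto_pow_atTop_nhds_zero_of_lt_one hr0 hr1).const_mul K
  filter_upwards [this.eventually_lt_const hε] with n hn p hp
  rw [dist_comm]
  exact (hK p.1 p.2 hp n).trans_lt hn

theorem exists_norm_hol_le [CompactSpace X] :
    ∃ K, 0 < K ∧ ∀ x y, (x, y) ∈ shadowing T δ → ‖hol T P A B J x y‖ ≤ K := by
  obtain ⟨K, hK⟩ := (isClosed_shadowing T δ).isCompact.exists_bound_of_continuousOn h.continuousOn_hol
  exact ⟨max K 1, by positivity, fun x y hxy => (hK (x, y) hxy).trans (le_max_left _ _)⟩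

end HolonomySystem

end LinearSystem

/-! ### Connecting orbits and their continuous deformation by the bracket. -/

section Connecting

theorem _root_.ContinuousOn.continuousAt_comp_of_eventually {A B C : Type*} [TopologicalSpace A]
    [TopologicalSpace B] [TopologicalSpace C] {f : B → C} {s : Set B} {g : A → B} {a : A}
    (hf : ContinuousOn f s) (hg : ContinuousAt g a) (hs : ∀ᶠ x in 𝓝 a, g x ∈ s) :
    ContinuousAt (fun x => f (g x)) a :=
  (hf _ hs.self_of_nhds).tendsto.comp (tendsto_nhdsWithin_iff.2 ⟨hg, hs⟩)

variable {X : Type*} [MetricSpace X]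

/-- The local stable relation is inherited by the iterates, and each step contracts because `exp
(-lam) ≤ 1`. Applied to `T.symm`, the same statement covers local unstable sets. -/
theorem dist_iterate_le_of_mem_localStable {T : X ≃ₜ X} {ε₀ : ℝ} {lam : X → ℝ}
    (hε : 0 ≤ ε₀) (hlam : ∀ x, 0 < lam x)
    (hc : ∀ y, ∀ y' ∈ localStable T ε₀ y, ∀ y'' ∈ localStable T ε₀ y,
      dist (T y') (T y'') ≤ Real.exp (-lam y) * dist y' y'')
    {x y : X} (hx : x ∈ localStable T ε₀ y) (n : ℕ) :
    dist (T^[n] x) (T^[n] y) ≤ dist x y := by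
  induction n with
  | zero => exact le_rfl
  | succ n ih =>
    rw [Function.iterate_succ_apply', Function.iterate_succ_apply']
    refine le_trans (hc (T^[n] y) _ (fun k => ?_) _ (fun k => ?_)) (le_trans ?_ ih)
    · simpa only [← Function.iterate_add_apply] using hx (k + n)
    · simpa using hε
    · exact mul_le_of_le_one_left dist_nonneg (Real.exp_le_one_iff.2 (neg_nonpos.2 (hlam _).le))

/-- The orbit of p goes from near T^{-N} x₀ to near T^N y₀ in L steps. When the endpoints move to x
and y, a first bracket puts the start on the unstable set of T^{-N} x while keeping the future of
the old orbit; a second bracket, taken L steps later, puts the end on the stable set of T^N y while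
keeping the past of the new one. -/
theorem IsHyperbolic.exists_connecting {T : X ≃ₜ X} {ε₀ : ℝ} {lamU lamS : X → ℝ}
    (hT : IsHyperbolic T ε₀ lamU lamS) {δ : ℝ} (hδ : 0 < δ) {x₀ y₀ p : X} {n : ℕ}
    (hp : p ∈ unstableSet T x₀) (hq : T^[n] p ∈ stableSet T y₀) :
    ∃ (N : ℕ) (z : X × X → X), ContinuousAt z (x₀, y₀) ∧ z (x₀, y₀) = T.symm^[N] p ∧
      ∀ᶠ q in 𝓝 (x₀, y₀), (T.symm^[N] q.1, z q) ∈ shadowing T.symm δ ∧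
        (T^[N + n + N] (z q), T^[N] q.2) ∈ shadowing T δ := by
  obtain ⟨ε₁, hε₁, hε₁₀, b, hb, hbc, -⟩ := hT.bracket
  have hε₀ := hT.eps_pos
  -- The past of `z` deviates from the past of x by two errors below η, one for each bracket, hence
  -- the share of δ. The bound by ε₁ keeps all pairs in the domain of the bracket and within ε₀.
  set η := min (δ / 3) ε₁ with hη
  have hη0 : 0 < η := lt_min (by positivity) hε₁
  have hηδ : η ≤ δ / 3 := min_le_left _ _
  have hηε : η ≤ ε₁ := min_le_right _ _
  obtain ⟨N, hN⟩ := eventually_atTop.1 ((hp.eventually_lt_const hη0).and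
    (hq.eventually_lt_const hη0))
  refine ⟨N, ?_⟩
  set r₀ := T.symm^[N] p with hr₀
  obtain ⟨L, hL⟩ : ∃ L, L = N + n + N := ⟨_, rfl⟩
  rw [← hL]
  have hLr : T^[L] r₀ = T^[N] (T^[n] p) := by
    rw [hL, Function.iterate_add_apply, hr₀, iterate_apply_symm_iterate,
      Function.iterate_add_apply]
  have hopen : ∀ a c : X, dist a c < η → ContinuousAt (fun p : X × X => b p.1 p.2) (a, c) := by
    intro a c hac
    refine hbc.continuousAt (mem_of_superset ((isOpen_lt continuous_dist continuous_const).mem_nhds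
      (show dist a c < 2 * ε₁ by linarith)) fun p hp => ?_)
    exact (show dist p.1 p.2 < 2 * ε₁ from hp).le
  have hTs : Continuous (T.symm^[N]) := T.symm.continuous.iterate N
  have hTN : Continuous (T^[N]) := T.continuous.iterate N
  have hTL : Continuous (T^[L]) := T.continuous.iterate L
  have hTLs : Continuous (T.symm^[L]) := T.symm.continuous.iterate L
  have hd1 : dist (T.symm^[N] x₀) r₀ < η := by rw [dist_comm]; exact (hN N le_rfl).1
  have hd2 : dist (T^[L] r₀) (T^[N] y₀) < η := by rw [hLr]; exact (hN N le_rfl).2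
  -- the two brackets
  set s₁ : X × X → X := fun q => b (T.symm^[N] q.1) r₀ with hs₁
  have hs₁c : ContinuousAt s₁ (x₀, y₀) := by
    refine ContinuousAt.comp (f := fun q : X × X => (T.symm^[N] q.1, r₀))
      (g := fun p : X × X => b p.1 p.2) (hopen _ _ hd1) ?_
    exact Continuous.continuousAt (by fun_prop)
  -- At the base point nothing is deformed: r₀ already lies in both local sets, and their
  -- intersection is a single point. The same reason applies to `s₂`.
  have hs₁0 : s₁ (x₀, y₀) = r₀ := by
    have : r₀ ∈ localUnstable T ε₀ (T.symm^[N] x₀) ∩ localStable T ε₀ r₀ := by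
      refine ⟨fun k => ?_, fun k => by simpa using hε₀.le⟩
      rw [hr₀, ← Function.iterate_add_apply, ← Function.iterate_add_apply]
      linarith [(hN (k + N) (Nat.le_add_left _ _)).1]
    rw [hb _ _ (by linarith)] at this
    exact this.symm
  set s₂ : X × X → X := fun q => b (T^[L] (s₁ q)) (T^[N] q.2) with hs₂
  have hs₂c : ContinuousAt s₂ (x₀, y₀) := by
    refine ContinuousAt.comp (f := fun q : X × X => (T^[L] (s₁ q), T^[N] q.2))
      (g := fun p : X × X => b p.1 p.2) (hopen _ _ ?_) ?_
    · simpa only [hs₁0] using hd2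
    · exact (hTL.continuousAt.comp hs₁c).prodMk (hTN.comp continuous_snd).continuousAt
  have hs₂0 : s₂ (x₀, y₀) = T^[L] r₀ := by
    have : T^[L] r₀ ∈ localUnstable T ε₀ (T^[L] r₀) ∩ localStable T ε₀ (T^[N] y₀) := by
      refine ⟨fun k => by simpa using hε₀.le, fun k => ?_⟩
      rw [hLr, ← Function.iterate_add_apply, ← Function.iterate_add_apply _ k]
      linarith [(hN (k + N) (Nat.le_add_left _ _)).2]
    rw [hb _ _ (by linarith)] at this
    simpa only [hs₂, hs₁0] using this.symm
  refine ⟨fun q => T.symm^[L] (s₂ q), hTLs.continuousAt.comp hs₂c, ?_, ?_⟩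
  · simp only [hs₂0, iterate_symm_apply_iterate, hr₀]
  have hx : ContinuousAt (fun q : X × X => T.symm^[N] q.1) (x₀, y₀) :=
    (hTs.comp continuous_fst).continuousAt
  have hy : ContinuousAt (fun q : X × X => T^[N] q.2) (x₀, y₀) :=
    (hTN.comp continuous_snd).continuousAt
  have hs₁L : ContinuousAt (fun q => T^[L] (s₁ q)) (x₀, y₀) := hTL.continuousAt.comp hs₁c
  have e1 : ∀ᶠ q in 𝓝 (x₀, y₀), dist (T.symm^[N] q.1) r₀ < η :=
    (hx.dist continuousAt_const).eventually_lt continuousAt_const hd1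
  have e2 : ∀ᶠ q in 𝓝 (x₀, y₀), dist (s₁ q) (T.symm^[N] q.1) < η :=
    (hs₁c.dist hx).eventually_lt continuousAt_const (by rw [hs₁0, dist_comm]; exact hd1)
  have e3 : ∀ᶠ q in 𝓝 (x₀, y₀), dist (T^[L] (s₁ q)) (T^[N] q.2) < η :=
    (hs₁L.dist hy).eventually_lt continuousAt_const (by simpa only [hs₁0] using hd2)
  have e4 : ∀ᶠ q in 𝓝 (x₀, y₀), dist (s₂ q) (T^[N] q.2) < η :=
    (hs₂c.dist hy).eventually_lt continuousAt_const (by rw [hs₂0]; exact hd2)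
  have e5 : ∀ᶠ q in 𝓝 (x₀, y₀), dist (s₂ q) (T^[L] (s₁ q)) < η :=
    (hs₂c.dist hs₁L).eventually_lt continuousAt_const (by simpa [hs₂0, hs₁0] using hη0)
  filter_upwards [e1, e2, e3, e4, e5] with q h1 h2 h3 h4 h5
  have m1 : s₁ q ∈ localUnstable T ε₀ (T.symm^[N] q.1) ∩ localStable T ε₀ r₀ := by
    rw [hb _ _ (by linarith)]; rfl
  have m2 : s₂ q ∈ localUnstable T ε₀ (T^[L] (s₁ q)) ∩ localStable T ε₀ (T^[N] q.2) := by
    rw [hb _ _ (by linarith)]; rfl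
  constructor
  · intro k
    -- Backward in time, `s₁` follows T^{-N} x, and T^{-L} `s₂` follows `s₁`; the triangle
    -- inequality adds the two errors.
    have u1 := dist_iterate_le_of_mem_localStable (T := T.symm) hε₀.le hT.lamU_pos
      hT.contract_unstable m1.1 k
    have u2 := dist_iterate_le_of_mem_localStable (T := T.symm) hε₀.le hT.lamU_pos
      hT.contract_unstable m2.1 (k + L)
    rw [Function.iterate_add_apply, Function.iterate_add_apply, iterate_symm_apply_iterate] at u2
    have := dist_triangle (T.symm^[k] (T.symm^[N] q.1)) (T.symm^[k] (s₁ q))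
      (T.symm^[k] (T.symm^[L] (s₂ q)))
    rw [dist_comm _ (T.symm^[k] (s₁ q)), dist_comm (T.symm^[k] (s₁ q)) (T.symm^[k] (T.symm^[L] _))]
      at this
    show dist (T.symm^[k] (T.symm^[N] q.1)) (T.symm^[k] (T.symm^[L] (s₂ q))) ≤ δ
    linarith
  · intro k
    show dist (T^[k] (T^[L] (T.symm^[L] (s₂ q)))) (T^[k] (T^[N] q.2)) ≤ δ
    rw [iterate_apply_symm_iterate]
    have u1 := dist_iterate_le_of_mem_localStable hε₀.le hT.lamS_pos hT.contract_stable m2.2 k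
    linarith

end Connecting

/-! ### Transition maps along connecting orbits, and their interplay with iteration. -/

section Connecting

variable {X V : Type*} [MetricSpace X] [NormedAddCommGroup V] [NormedSpace ℝ V]
  {T : X ≃ₜ X} {P A B : X → V →L[ℝ] V} {J : X → X → V →L[ℝ] V} {δ : ℝ}

/-- Both sides are the transport from T^N y to T^m y along one orbit, taken in two orders. -/
theorem LinearSystem.cocycle_mul_cocycle_symm_comm (h : LinearSystem T P A B) (m N : ℕ) (y : X) :
    cocycle T P A m y * cocycle T.symm P B N (T^[N] y) =
      cocycle T.symm P B N (T^[N] (T^[m] y)) * cocycle T P A m (T^[N] y) := by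
  have e1 := h.cocycle_add m N y
  have e2 := h.cocycle_add N m y
  have e3 := h.cocycle_symm_mul_cocycle N (T^[m] y)
  have e4 := h.cocycle_mul_cocycle_symm N (T^[N] y)
  rw [iterate_symm_apply_iterate] at e4
  have e5 := h.proj_cocycle m y
  calc cocycle T P A m y * cocycle T.symm P B N (T^[N] y)
      = cocycle T.symm P B N (T^[N] (T^[m] y)) * (cocycle T P A (N + m) y) *
          cocycle T.symm P B N (T^[N] y) := by
        rw [e2, ← mul_assoc, e3, e5]
    _ = _ := by rw [add_comm N m, e1, mul_assoc, mul_assoc, e4, h.cocycle_proj]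

variable [CompleteSpace V]

/-- The equivariance of the holonomy of the inverse system, multiplied on both sides by forward
cocycles. It moves an unstable holonomy past iterates that are applied before it. -/
theorem HolonomySystem.hol_symm_mul_cocycle (h : HolonomySystem T.symm P B A J δ) {x z : X}
    {k : ℕ} (hxz : (T^[k] x, z) ∈ shadowing T.symm δ) :
    hol T.symm P B A J (T^[k] x) z * cocycle T P A k x =
      cocycle T P A k (T.symm^[k] z) * hol T.symm P B A J x (T.symm^[k] z) := by
  have hk := shadowing_iterate hxz k
  have e1 := h.cocycle_mul_hol hxz k
  have e2 := h.symm.cocycle_mul_cocycle_symm k z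
  have e3 := h.symm.cocycle_symm_mul_cocycle k x
  simp only [Homeomorph.symm_symm] at e2 e3
  rw [iterate_symm_apply_iterate] at e1 hk
  calc hol T.symm P B A J (T^[k] x) z * cocycle T P A k x
      = cocycle T P A k (T.symm^[k] z) * (cocycle T.symm P B k z *
          hol T.symm P B A J (T^[k] x) z) * cocycle T P A k x := by
        rw [← mul_assoc (cocycle T P A k (T.symm^[k] z)), e2, h.proj_hol hxz]
    _ = _ := by rw [e1, mul_assoc, mul_assoc, e3, h.hol_proj hk]

variable [CompactSpace X] {ε₀ : ℝ} {lamU lamS : X → ℝ}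

/-- The map goes from x back N steps, across by an unstable holonomy, forward L steps along the
deformed orbit, across by a stable holonomy, and back N steps to y. The m iterates on the left and
the k iterates on the right can be pushed through the holonomies onto the deformed orbit, where they
merge into m + k iterates; every other factor is bounded independently of m and k. The constant
still depends on the base point through N and L. -/
theorem IsHyperbolic.exists_connecting_map (hT : IsHyperbolic T ε₀ lamU lamS)
    (hs : HolonomySystem T P A B J δ) (hu : HolonomySystem T.symm P B A J δ)
    {x₀ y₀ p : X} {n : ℕ} (hp : p ∈ unstableSet T x₀) (hq : T^[n] p ∈ stableSet T y₀) :
    ∃ W : X × X → V →L[ℝ] V, ContinuousAt W (x₀, y₀) ∧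
      W (x₀, y₀) = hol T P A B J (T^[n] p) y₀ * cocycle T P A n p * hol T.symm P B A J x₀ p ∧
      ∃ C, 0 < C ∧ ∀ᶠ q in 𝓝 (x₀, y₀), ∀ (m k : ℕ) (x : X), T^[k] x = q.1 →
        ∀ S, (∀ z, ‖cocycle T P A (m + k) z‖ ≤ S) → ‖cocycle T P A m q.2 * W q * cocycle T P A k x‖ ≤ C * S := by
  obtain ⟨N, z, hzc, hz0, hz⟩ := hT.exists_connecting hs.delta_pos hp hq
  obtain ⟨L, hL⟩ : ∃ L, L = N + n + N := ⟨_, rfl⟩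
  rw [← hL] at hz
  have hz' := hz.self_of_nhds
  have hLz : T^[L] (T.symm^[N] p) = T^[N] (T^[n] p) := by
    rw [hL, Function.iterate_add_apply, iterate_apply_symm_iterate, Function.iterate_add_apply]
  simp only [hz0, hLz] at hz'
  have hTs : Continuous (T.symm^[N]) := T.symm.continuous.iterate N
  have hTN : Continuous (T^[N]) := T.continuous.iterate N
  have hTL : Continuous (T^[L]) := T.continuous.iterate L
  refine ⟨fun q => cocycle T.symm P B N (T^[N] q.2) * hol T P A B J (T^[L] (z q)) (T^[N] q.2) *
    cocycle T P A L (z q) * hol T.symm P B A J (T.symm^[N] q.1) (z q) *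
    cocycle T.symm P B N q.1, ?_, ?_, ?_⟩
  · have c1 : ContinuousAt (fun q : X × X => (T^[L] (z q), T^[N] q.2)) (x₀, y₀) :=
      (hTL.continuousAt.comp hzc).prodMk (hTN.comp continuous_snd).continuousAt
    have c2 : ContinuousAt (fun q : X × X => (T.symm^[N] q.1, z q)) (x₀, y₀) :=
      (hTs.comp continuous_fst).continuousAt.prodMk hzc
    have c3 := hs.continuousOn_hol.continuousAt_comp_of_eventually c1 (hz.mono fun q hq => hq.2)
    have c4 := hu.continuousOn_hol.continuousAt_comp_of_eventually c2 (hz.mono fun q hq => hq.1)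
    have c5 : Continuous (fun q : X × X => cocycle T.symm P B N (T^[N] q.2)) :=
      (hs.symm.continuous_cocycle N).comp (hTN.comp continuous_snd)
    have c6 : Continuous (fun q : X × X => cocycle T.symm P B N q.1) :=
      (hs.symm.continuous_cocycle N).comp continuous_fst
    have c7 : ContinuousAt (fun q => cocycle T P A L (z q)) (x₀, y₀) :=
      (hs.continuous_cocycle L).continuousAt.comp hzc
    exact (((c5.continuousAt.mul c3).mul c7).mul c4).mul c6.continuousAt
  · have e1 := hs.hol_eq (hs.tendsto hq) hz'.2
    have e2 := hu.hol_eq (hu.tendsto (x := x₀) (y := p) ?_) hz'.1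
    · rw [Homeomorph.symm_symm] at e2
      simp only [hz0, hLz]
      rw [e1, e2, hL, hs.cocycle_add, hs.cocycle_add, iterate_apply_symm_iterate]
      simp only [mul_assoc]
    · have : Tendsto _ _ _ := hp
      simpa only [stableSet, mem_ofPred_eq, dist_comm] using this
  · obtain ⟨KB, hKB, hB⟩ := hs.symm.exists_norm_cocycle_le N
    obtain ⟨KL, hKL, hA⟩ := hs.exists_norm_cocycle_le L
    obtain ⟨Ks, hKs, hHs⟩ := hs.exists_norm_hol_le
    obtain ⟨Ku, hKu, hHu⟩ := hu.exists_norm_hol_le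
    refine ⟨KB * Ks * KL * Ku * KB, by positivity, hz.mono ?_⟩
    rintro ⟨x', y⟩ ⟨h1, h2⟩
    rintro m k x rfl S hS
    simp only at h1 h2 ⊢
    set w := z (T^[k] x, y)
    have hk : T.symm^[N] (T^[k] x) = T^[k] (T.symm^[N] x) := by
      have : Function.Commute T.symm T := fun x => by simp
      exact (this.iterate_iterate N k) x
    rw [hk] at h1 ⊢
    have e1 := hs.cocycle_mul_cocycle_symm_comm m N y
    have e2 := hs.cocycle_mul_hol h2 m
    have e3 := hu.hol_symm_mul_cocycle h1
    have e4 := hs.cocycle_mul_cocycle_symm_comm k N (T.symm^[N] x)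
    rw [← hk, iterate_apply_symm_iterate, iterate_apply_symm_iterate] at e4
    -- Regrouping m + L + k steps as L steps after m + k steps leaves a block bounded by `KL` and
    -- one bounded by S.
    have e5 : cocycle T P A m (T^[L] w) * cocycle T P A L w * cocycle T P A k (T.symm^[k] w) =
        cocycle T P A L (T^[m + k] (T.symm^[k] w)) * cocycle T P A (m + k) (T.symm^[k] w) := by
      have e := hs.cocycle_add (m + L) k (T.symm^[k] w)
      rw [iterate_apply_symm_iterate, hs.cocycle_add m L] at e
      rw [← e, ← hs.cocycle_add L (m + k), show L + (m + k) = m + L + k by ring]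
    have key : cocycle T P A m y * (cocycle T.symm P B N (T^[N] y) *
        hol T P A B J (T^[L] w) (T^[N] y) * cocycle T P A L w *
        hol T.symm P B A J (T^[k] (T.symm^[N] x)) w * cocycle T.symm P B N (T^[k] x)) *
        cocycle T P A k x =
        cocycle T.symm P B N (T^[N] (T^[m] y)) *
        hol T P A B J (T^[m] (T^[L] w)) (T^[m] (T^[N] y)) *
        (cocycle T P A L (T^[m + k] (T.symm^[k] w)) * cocycle T P A (m + k) (T.symm^[k] w)) *
        hol T.symm P B A J (T.symm^[N] x) (T.symm^[k] w) * cocycle T.symm P B N x := by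
      calc _ = (cocycle T P A m y * cocycle T.symm P B N (T^[N] y)) *
              hol T P A B J (T^[L] w) (T^[N] y) * cocycle T P A L w *
              hol T.symm P B A J (T^[k] (T.symm^[N] x)) w *
              (cocycle T.symm P B N (T^[k] x) * cocycle T P A k x) := by simp only [mul_assoc]
        _ = cocycle T.symm P B N (T^[N] (T^[m] y)) *
              (cocycle T P A m (T^[N] y) * hol T P A B J (T^[L] w) (T^[N] y)) *
              cocycle T P A L w *
              (hol T.symm P B A J (T^[k] (T.symm^[N] x)) w * cocycle T P A k (T.symm^[N] x)) *
              cocycle T.symm P B N x := by rw [e1, ← e4]; simp only [mul_assoc]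
        _ = _ := by rw [e2, e3, ← e5]; simp only [mul_assoc]
    rw [key]
    have h1' := shadowing_iterate h1 k
    rw [iterate_symm_apply_iterate] at h1'
    have hS0 : 0 ≤ S := (norm_nonneg _).trans (hS x)
    calc _ ≤ KB * Ks * (KL * S) * Ku * KB := by
          refine (norm_mul_le _ _).trans (mul_le_mul ?_ (hB _) (norm_nonneg _) (by positivity))
          refine (norm_mul_le _ _).trans (mul_le_mul ?_ (hHu _ _ h1') (norm_nonneg _)
            (by positivity))
          refine (norm_mul_le _ _).trans (mul_le_mul ?_ ?_ (norm_nonneg _) (by positivity))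
          · exact (norm_mul_le _ _).trans (mul_le_mul (hB _) (hHs _ _ (shadowing_iterate h2 m))
              (norm_nonneg _) (by positivity))
          · exact (norm_mul_le _ _).trans (mul_le_mul (hA _) (hS _) (norm_nonneg _)
              (by positivity))
      _ = _ := by ring

end Connecting

/-! ### Quasi-multiplicativity from spanning and compactness. -/

section QuasiMultiplicative

variable {X V : Type*} [MetricSpace X] [CompactSpace X] [NormedAddCommGroup V] [NormedSpace ℝ V]
  [FiniteDimensional ℝ V]
  {T : X ≃ₜ X} {P A B : X → V →L[ℝ] V} {J : X → X → V →L[ℝ] V} {δ ε₀ : ℝ} {lamU lamS : X → ℝ}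

/-- The spanning property of a linear system: the images of `u` under suitable holonomies span
the range of `P y`. -/
def Spanning (T : X ≃ₜ X) (P A B : X → V →L[ℝ] V) (J : X → X → V →L[ℝ] V) (d : ℕ) : Prop :=
  ∀ (x y : X) (u : V), P x u = u → u ≠ 0 → ∃ (p : Fin d → X) (n : Fin d → ℕ),
    (∀ i, p i ∈ unstableSet T x) ∧ (∀ i, T^[n i] (p i) ∈ stableSet T y) ∧
    ∃ f : Fin d → V →L[ℝ] ℝ, P y = ∑ i, (f i).smulRight
      ((hol T P A B J (T^[n i] (p i)) y * cocycle T P A (n i) (p i) *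
        hol T.symm P B A J x (p i)) u)

/-- At the base point the rank-one maps f_i ⊗ W_i u₀ add up to `P y₀`, so nearby their sum differs
from `P y` by an error `R` of norm below 1/2. After composition with the m-step cocycle, which
absorbs `P y`, the error term is swallowed by the left-hand side at the price of a factor 2. The
remaining terms, evaluated at t u in the image of the k-step cocycle, are controlled by the
connecting maps. -/
theorem IsHyperbolic.eventually_norm_cocycle_mul_le (hT : IsHyperbolic T ε₀ lamU lamS)
    (hs : HolonomySystem T P A B J δ) (hu : HolonomySystem T.symm P B A J δ) {d : ℕ}
    (hsp : Spanning T P A B J d) {x₀ y₀ : X} {u₀ : V} (hu₀ : P x₀ u₀ = u₀) (hu₀' : u₀ ≠ 0) :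
    ∃ C, 0 ≤ C ∧ ∀ᶠ q in 𝓝 ((x₀, y₀), u₀), ∀ (m k : ℕ) (x : X), T^[k] x = q.1.1 →
      ∀ S, (∀ z, ‖cocycle T P A (m + k) z‖ ≤ S) → ∀ (e : V) (t : ℝ),
        cocycle T P A k x e = t • q.2 → ‖cocycle T P A m q.1.2‖ * |t| ≤ C * S * ‖e‖ := by
  obtain ⟨p, n, hp, hq, f, hf⟩ := hsp x₀ y₀ u₀ hu₀ hu₀'
  choose W hWc hW0 C hC hW using fun i => hT.exists_connecting_map hs hu (hp i) (hq i)
  refine ⟨2 * ∑ i, ‖f i‖ * C i,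
    mul_nonneg zero_le_two (Finset.sum_nonneg fun i _ => mul_nonneg (norm_nonneg _) (hC i).le), ?_⟩
  set R : (X × X) × V → V →L[ℝ] V := fun q =>
    ∑ i, (f i).smulRight (W i q.1 q.2) - P q.1.2 with hR
  have hfst : ContinuousAt (fun q : (X × X) × V => q.1) ((x₀, y₀), u₀) := continuousAt_fst
  have hWc' : ∀ i, ContinuousAt (fun q : (X × X) × V => W i q.1) ((x₀, y₀), u₀) := fun i =>
    ContinuousAt.comp (f := fun q : (X × X) × V => q.1) (g := W i) (hWc i) hfst
  have hRc : ContinuousAt R ((x₀, y₀), u₀) := by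
    refine ContinuousAt.sub (tendsto_finsetSum _ fun i _ => ?_) ?_
    · have h1 : ContinuousAt (fun q : (X × X) × V => W i q.1 q.2) ((x₀, y₀), u₀) :=
        (hWc' i).clm_apply continuousAt_snd
      exact ((ContinuousLinearMap.smulRightL ℝ V V (f i)).continuous.continuousAt.comp h1 :)
    · exact (hs.continuous_proj.comp (continuous_snd.comp continuous_fst)).continuousAt
  have hR0 : R ((x₀, y₀), u₀) = 0 := by
    simp only [hR, hW0]
    rw [← hf, sub_self]
  have hRe : ∀ᶠ q in 𝓝 ((x₀, y₀), u₀), ‖R q‖ < 1 / 2 :=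
    hRc.norm.eventually_lt continuousAt_const (by rw [hR0]; norm_num)
  have hWe : ∀ᶠ q : (X × X) × V in 𝓝 ((x₀, y₀), u₀), ∀ i, ∀ (m k : ℕ) (x : X), T^[k] x = q.1.1 →
      ∀ S, (∀ z, ‖cocycle T P A (m + k) z‖ ≤ S) →
        ‖cocycle T P A m q.1.2 * W i q.1 * cocycle T P A k x‖ ≤ C i * S :=
    eventually_all.2 fun i => hfst.eventually (hW i)
  filter_upwards [hRe, hWe] with q hRq hWq m k x hx S hS e t het
  have e1 : cocycle T P A m q.1.2 = ∑ i, (f i).smulRight (cocycle T P A m q.1.2 (W i q.1 q.2)) -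
      cocycle T P A m q.1.2 * R q := by
    conv_lhs => rw [← hs.cocycle_proj]
    ext w
    simp [hR, map_sum]
  have e2 : ‖cocycle T P A m q.1.2‖ ≤
      2 * ∑ i, ‖f i‖ * ‖cocycle T P A m q.1.2 (W i q.1 q.2)‖ := by
    have h1 := congrArg norm e1
    have h2 := (h1.le.trans (norm_sub_le _ _))
    have h3 := norm_sum_le Finset.univ
      (fun i => (f i).smulRight (cocycle T P A m q.1.2 (W i q.1 q.2)))
    simp only [ContinuousLinearMap.norm_smulRight_apply] at h3
    have h4 := norm_mul_le (cocycle T P A m q.1.2) (R q)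
    have h5 := mul_le_mul_of_nonneg_left hRq.le (norm_nonneg (cocycle T P A m q.1.2))
    linarith
  calc ‖cocycle T P A m q.1.2‖ * |t|
      ≤ (2 * ∑ i, ‖f i‖ * ‖cocycle T P A m q.1.2 (W i q.1 q.2)‖) * |t| :=
        mul_le_mul_of_nonneg_right e2 (abs_nonneg t)
    _ = 2 * ∑ i, ‖f i‖ * ‖(cocycle T P A m q.1.2 * W i q.1 * cocycle T P A k x) e‖ := by
        rw [mul_assoc, Finset.sum_mul]
        congr 1
        refine Finset.sum_congr rfl fun i _ => ?_
        rw [mul_assoc]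
        simp only [mul_apply_eq_comp, het, map_smul, norm_smul, Real.norm_eq_abs]
        ring
    _ ≤ 2 * ∑ i, ‖f i‖ * (C i * S * ‖e‖) := by
        gcongr with i
        exact ContinuousLinearMap.le_of_opNorm_le _ (hWq i m k x hx S hS) e
    _ = (2 * ∑ i, ‖f i‖ * C i) * S * ‖e‖ := by
        rw [mul_assoc, mul_assoc, Finset.sum_mul]
        congr 1
        exact Finset.sum_congr rfl fun i _ => by ring

/-- Finitely many of the local estimates cover all pairs of points and unit vectors u. For given x
and e, the estimate is applied to the direction u of the image of e. -/
theorem IsHyperbolic.exists_quasimultiplicative (hT : IsHyperbolic T ε₀ lamU lamS)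
    (hs : HolonomySystem T P A B J δ) (hu : HolonomySystem T.symm P B A J δ) {d : ℕ}
    (hsp : Spanning T P A B J d) :
    ∃ C, 0 < C ∧ ∀ (m n : ℕ) (x y : X) (S : ℝ), (∀ z, ‖cocycle T P A (m + n) z‖ ≤ S) →
      ‖cocycle T P A m y‖ * ‖cocycle T P A n x‖ ≤ C * S := by
  set K : Set ((X × X) × V) := {q | ‖q.2‖ = 1 ∧ P q.1.1 q.2 = q.2} with hK
  have hKc : IsCompact K := by
    refine (isCompact_univ.prod (isCompact_sphere (0 : V) 1)).of_isClosed_subset ?_ ?_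
    · have h1 : Continuous fun q : (X × X) × V => P q.1.1 q.2 :=
        (hs.continuous_proj.comp (continuous_fst.comp continuous_fst)).clm_apply continuous_snd
      exact (isClosed_eq continuous_snd.norm continuous_const).inter
        (isClosed_eq h1 continuous_snd)
    · exact fun q hq => ⟨mem_univ _, by simpa using hq.1⟩
  have main : ∃ C, 0 ≤ C ∧ ∀ q ∈ K, ∀ (m k : ℕ) (x : X), T^[k] x = q.1.1 →
      ∀ S, (∀ z, ‖cocycle T P A (m + k) z‖ ≤ S) → ∀ (e : V) (t : ℝ),
        cocycle T P A k x e = t • q.2 → ‖cocycle T P A m q.1.2‖ * |t| ≤ C * S * ‖e‖ := by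
    refine hKc.induction_on (p := fun s => ∃ C, 0 ≤ C ∧ ∀ q ∈ s, ∀ (m k : ℕ) (x : X),
      T^[k] x = q.1.1 → ∀ S, (∀ z, ‖cocycle T P A (m + k) z‖ ≤ S) → ∀ (e : V) (t : ℝ),
        cocycle T P A k x e = t • q.2 → ‖cocycle T P A m q.1.2‖ * |t| ≤ C * S * ‖e‖)
      ⟨0, le_rfl, by simp⟩ ?_ ?_ ?_
    · rintro s t hst ⟨C, hC, h⟩
      exact ⟨C, hC, fun q hq => h q (hst hq)⟩
    · rintro s t ⟨C, hC, h⟩ ⟨C', hC', h'⟩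
      refine ⟨C + C', by positivity, fun q hq m k x hx S hS e t het => ?_⟩
      have hS0 : 0 ≤ S := (norm_nonneg _).trans (hS x)
      rcases hq with hq | hq
      · refine (h q hq m k x hx S hS e t het).trans ?_
        gcongr
        linarith
      · refine (h' q hq m k x hx S hS e t het).trans ?_
        gcongr
        linarith
    · rintro ⟨⟨x, y⟩, u⟩ ⟨hq1, hq2⟩
      obtain ⟨C, hC, h⟩ := hT.eventually_norm_cocycle_mul_le hs hu hsp (y₀ := y) hq2
        (by rintro rfl; simp at hq1)
      exact ⟨_, mem_nhdsWithin_of_mem_nhds h, C, hC, fun q hq => hq⟩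
  obtain ⟨C, hC, h⟩ := main
  -- The covering argument only yields `0 ≤ C`; positivity is needed later for the logarithm.
  refine ⟨C + 1, by positivity, fun m n x y S hS => ?_⟩
  have hS0 : 0 ≤ S := (norm_nonneg _).trans (hS x)
  suffices ‖cocycle T P A m y‖ * ‖cocycle T P A n x‖ ≤ C * S by linarith
  rcases (norm_nonneg (cocycle T P A m y)).eq_or_lt with h0 | h0
  · rw [← h0, zero_mul]; positivity
  rw [mul_comm, ← le_div_iff₀ h0]
  refine ContinuousLinearMap.opNorm_le_bound _ (by positivity) fun e => ?_
  rw [div_mul_eq_mul_div, le_div_iff₀ h0, mul_comm]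
  set w := cocycle T P A n x e with hw
  rcases eq_or_ne w 0 with hw0 | hw0
  · rw [hw0, norm_zero, mul_zero]; positivity
  have hwn : ‖w‖ ≠ 0 := norm_ne_zero_iff.2 hw0
  have hPw : P (T^[n] x) w = w := by
    rw [hw, ← mul_apply_eq_comp, hs.proj_cocycle]
  have := h ((T^[n] x, y), ‖w‖⁻¹ • w) ⟨?_, ?_⟩ m n x rfl S hS e ‖w‖ ?_
  · rwa [abs_norm] at this
  · simp [norm_smul, hwn]
  · simp [hPw]
  · rw [smul_smul, mul_inv_cancel₀ hwn, one_smul]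

end QuasiMultiplicative

/-! ### Invariant measures that realize the growth of a subadditive sequence. -/

section Variational

/-- The reverse Fatou lemma, for functions shifted by C to make them nonnegative. -/
theorem le_integral_limsup {Ω : Type*} [MeasurableSpace Ω] {μ : Measure Ω} [IsProbabilityMeasure μ]
    {f : ℕ → Ω → ℝ} (hf : ∀ n, Measurable (f n)) {C b : ℝ} (hC : ∀ n x, |f n x| ≤ C)
    (hb : ∀ᶠ n in atTop, b ≤ ∫ x, f n x ∂μ) :
    b ≤ ∫ x, limsup (fun n => f n x) atTop ∂μ := by
  have hbd : ∀ x, IsBoundedUnder (· ≤ ·) atTop fun n => f n x := fun x =>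
    isBoundedUnder_of ⟨C, fun n => (abs_le.1 (hC n x)).2⟩
  have hbd' : ∀ x, IsBoundedUnder (· ≥ ·) atTop fun n => f n x := fun x =>
    isBoundedUnder_of ⟨-C, fun n => (abs_le.1 (hC n x)).1⟩
  set g : Ω → ℝ := fun x => limsup (fun n => f n x) atTop with hg
  have hgm : Measurable g := Measurable.limsup hf
  have hgu : ∀ x, g x ≤ C := fun x =>
    limsup_le_of_le (hbd' x).isCoboundedUnder_flip (Eventually.of_forall fun n => (abs_le.1 (hC n x)).2)
  have hgl : ∀ x, -C ≤ g x := fun x =>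
    le_limsup_of_frequently_le (Frequently.of_forall fun n => (abs_le.1 (hC n x)).1) (hbd x)
  have hint : ∀ h : Ω → ℝ, Measurable h → (∀ x, |h x| ≤ C) → Integrable h μ := fun h hm hh =>
    (integrable_const C).mono' hm.aestronglyMeasurable (Eventually.of_forall hh)
  have hgi : Integrable g μ := hint g hgm fun x => abs_le.2 ⟨hgl x, hgu x⟩
  have key : ∀ h : Ω → ℝ, Measurable h → (∀ x, |h x| ≤ C) →
      ∫⁻ x, ENNReal.ofReal (C + h x) ∂μ = ENNReal.ofReal (C + ∫ x, h x ∂μ) := by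
    intro h hm hh
    have hi : Integrable (fun x => C + h x) μ := (integrable_const C).add (hint h hm hh)
    rw [← ofReal_integral_eq_lintegral_ofReal hi
      (Eventually.of_forall fun x => show 0 ≤ C + h x by linarith [(abs_le.1 (hh x)).1]),
      integral_add (integrable_const C) (hint h hm hh)]
    simp
  have hmono : Monotone fun t : ℝ => ENNReal.ofReal (C + t) := fun s t hst =>
    ENNReal.ofReal_le_ofReal (by linarith)
  have hcont : Continuous fun t : ℝ => ENNReal.ofReal (C + t) :=
    ENNReal.continuous_ofReal.comp (by fun_prop)
  have hlim : ∀ x, limsup (fun n => ENNReal.ofReal (C + f n x)) atTop =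
      ENNReal.ofReal (C + g x) := fun x =>
    (hmono.map_limsup_of_continuousAt (fun n => f n x) hcont.continuousAt (hbd x)
      (hbd' x).isCoboundedUnder_flip).symm
  have h1 := limsup_lintegral_le (μ := μ) (f := fun n x => ENNReal.ofReal (C + f n x))
    (fun _ => ENNReal.ofReal (C + C)) (fun n => by have := hf n; fun_prop)
    (fun n => Eventually.of_forall fun x => hmono (abs_le.1 (hC n x)).2) (by simp)
  simp only [hlim] at h1
  rw [key g hgm fun x => abs_le.2 ⟨hgl x, hgu x⟩] at h1
  have h2 : ENNReal.ofReal (C + b) ≤ limsup (fun n => ∫⁻ x, ENNReal.ofReal (C + f n x) ∂μ) atTop :=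
    le_limsup_of_frequently_le (hb.mono fun n hn => by
      rw [key (f n) (hf n) (hC n)]; exact hmono hn).frequently
  have h3 := h2.trans h1
  have hlow : -C ≤ ∫ x, g x ∂μ := by
    have := integral_mono (μ := μ) (integrable_const (-C)) hgi hgl
    simpa using this
  have := (ENNReal.ofReal_le_ofReal_iff (by linarith)).1 h3
  linarith

variable {X : Type*} [MetricSpace X] [CompactSpace X] [MeasurableSpace X] [BorelSpace X]

/-- The uniform measure on an orbit segment of length `n + 1`. -/
def empirical (T : X → X) (n : ℕ) (x : X) : Measure X :=
  ((n + 1 : ℕ) : ENNReal)⁻¹ • ∑ i ∈ Finset.range (n + 1), Measure.dirac (T^[i] x)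

instance (T : X → X) (n : ℕ) (x : X) : IsProbabilityMeasure (empirical T n x) := by
  constructor
  rw [empirical, Measure.smul_apply, Measure.finsetSum_apply]
  simp only [measure_univ, Finset.sum_const, Finset.card_range, nsmul_eq_mul, mul_one, smul_eq_mul]
  exact ENNReal.inv_mul_cancel (by simp) (ENNReal.natCast_ne_top _)

theorem integral_empirical (T : X → X) (n : ℕ) (x : X) (f : X → ℝ) :
    ∫ y, f y ∂(empirical T n x) = ((n : ℝ) + 1)⁻¹ * ∑ i ∈ Finset.range (n + 1), f (T^[i] x) := by
  rw [empirical, integral_smul_measure, integral_finsetSum_measure]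
  · simp only [integral_dirac, smul_eq_mul, ENNReal.toReal_inv, ENNReal.toReal_natCast]
    push_cast
    rfl
  · exact fun i _ => integrable_dirac (by simp)

-- By subadditivity φ_m(T^i x) ≥ φ_{m+i}(x) - φ_i(x). Summed over i < n, the right side equals the
-- sum over j < m of φ_{j+n}(x) - φ_j(x), and each φ_{j+n}(x) is at least φ_n(x) - jK. For fixed m
-- the Birkhoff sum of φ_m is therefore at least m φ_n(x) - O(1).
omit [MetricSpace X] [CompactSpace X] [MeasurableSpace X] [BorelSpace X] in
theorem sum_orbit_ge {T : X → X} {φ : ℕ → X → ℝ}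
    (hsub : ∀ m n x, φ (m + n) x ≤ φ m (T^[n] x) + φ n x) {K : ℝ}
    (hK : ∀ n x, φ n x ≤ φ (n + 1) x + K) (m n : ℕ) (x : X) :
    m * φ n x - ∑ j ∈ Finset.range m, (j * K + φ j x) ≤ ∑ i ∈ Finset.range n, φ m (T^[i] x) := by
  have h1 : ∑ i ∈ Finset.range n, (φ (m + i) x - φ i x) ≤ ∑ i ∈ Finset.range n, φ m (T^[i] x) :=
    Finset.sum_le_sum fun i _ => by linarith [hsub m i x]
  refine le_trans ?_ h1
  clear h1
  have h2 : ∀ j, φ n x ≤ φ (j + n) x + j * K := by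
    intro j
    induction j with
    | zero => simp
    | succ j ih =>
      have := hK (j + n) x
      rw [show j + 1 + n = j + n + 1 by ring]
      push_cast
      linarith
  induction m with
  | zero => simp
  | succ m ih =>
    have e : ∑ i ∈ Finset.range n, (φ (m + 1 + i) x - φ i x) =
        ∑ i ∈ Finset.range n, (φ (m + i) x - φ i x) + (φ (m + n) x - φ m x) := by
      have := Finset.sum_range_sub (fun i => φ (m + i) x) n
      rw [add_zero] at this
      rw [← this, ← Finset.sum_add_distrib]
      refine Finset.sum_congr rfl fun i _ => ?_
      rw [show m + 1 + i = m + (i + 1) by ring]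
      ring
    rw [e, Finset.sum_range_succ]
    have := h2 m
    push_cast
    linarith

/-- Take empirical measures along orbit segments on which φ_n is at least n b. Any limit is
invariant, because the defect telescopes to a boundary term divided by the length, and
`sum_orbit_ge` gives the lower bound for all m at once. -/
theorem exists_invariant_measure_integral_ge {T : X ≃ₜ X} {φ : ℕ → X → ℝ}
    (hφ : ∀ n, Continuous (φ n)) (hsub : ∀ m n x, φ (m + n) x ≤ φ m (T^[n] x) + φ n x) {K b : ℝ}
    (hK : ∀ n x, φ n x ≤ φ (n + 1) x + K) (hb : ∀ n : ℕ, ∃ x, n * b ≤ φ n x) :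
    ∃ μ : Measure X, IsProbabilityMeasure μ ∧ MeasurePreserving T μ μ ∧
      ∀ m : ℕ, m * b ≤ ∫ x, φ m x ∂μ := by
  choose x hx using fun n : ℕ => hb (n + 1)
  let μs : ℕ → ProbabilityMeasure X := fun n => ⟨empirical T n (x n), inferInstance⟩
  obtain ⟨μ, -, hμ⟩ := isCompact_univ.exists_mapClusterPt (f := atTop) (u := μs) (by simp)
  -- A limit along an ultrafilter finer than `atTop` replaces the choice of a convergent
  -- subsequence.
  obtain ⟨𝒰, h𝒰, hlim⟩ := mapClusterPt_iff_ultrafilter.1 hμ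
  have hint : ∀ f : X → ℝ, Continuous f → Tendsto (fun n : ℕ => ((n : ℝ) + 1)⁻¹ *
      ∑ i ∈ Finset.range (n + 1), f (T^[i] (x n))) 𝒰 (𝓝 (∫ y, f y ∂(μ : Measure X))) := by
    intro f hf
    have := ProbabilityMeasure.tendsto_iff_forall_integral_tendsto.1 hlim
      (BoundedContinuousFunction.mkOfCompact ⟨f, hf⟩)
    simpa only [μs, ProbabilityMeasure.coe_mk, BoundedContinuousFunction.mkOfCompact_apply,
      ContinuousMap.coe_mk, integral_empirical] using this
  have hzero : ∀ c : ℝ, Tendsto (fun n : ℕ => ((n : ℝ) + 1)⁻¹ * c) 𝒰 (𝓝 0) := by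
    intro c
    have := (tendsto_one_div_add_atTop_nhds_zero_nat (𝕜 := ℝ)).mul_const c
    simp only [one_div, zero_mul] at this
    exact this.mono_left h𝒰
  refine ⟨μ, inferInstance, ⟨T.continuous.measurable, ?_⟩, fun m => ?_⟩
  · have : IsProbabilityMeasure (Measure.map T (μ : Measure X)) :=
      Measure.isProbabilityMeasure_map T.continuous.measurable.aemeasurable
    refine ext_of_forall_integral_eq_of_IsFiniteMeasure fun f => ?_
    rw [integral_map T.continuous.measurable.aemeasurable
      f.continuous.measurable.aestronglyMeasurable]
    have h1 := hint (fun y => f (T y)) (f.continuous.comp T.continuous)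
    have h2 := hint f f.continuous
    have h3 := h1.sub h2
    rw [← sub_eq_zero]
    refine tendsto_nhds_unique h3 (squeeze_zero_norm (fun n => ?_) (hzero (2 * ‖f‖)))
    rw [← mul_sub, ← Finset.sum_sub_distrib]
    simp only [← Function.iterate_succ_apply' T]
    rw [Finset.sum_range_sub (fun i => f (T^[i] (x n))), norm_mul, norm_inv, Real.norm_eq_abs,
      abs_of_pos (by positivity : (0 : ℝ) < n + 1)]
    gcongr
    refine (norm_sub_le _ _).trans ?_
    linarith [f.norm_coe_le_norm (T^[n + 1] (x n)), f.norm_coe_le_norm (T^[0] (x n))]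
  · have hD : ∃ D, ∀ y, ∑ j ∈ Finset.range m, (j * K + φ j y) ≤ D := by
      obtain ⟨D, hD⟩ := isCompact_univ.exists_bound_of_continuousOn
        (f := fun y => ∑ j ∈ Finset.range m, (j * K + φ j y)) (by fun_prop)
      exact ⟨D, fun y => (le_abs_self _).trans (hD y (mem_univ y))⟩
    obtain ⟨D, hD⟩ := hD
    have h1 : Tendsto (fun n : ℕ => m * b - ((n : ℝ) + 1)⁻¹ * D) 𝒰 (𝓝 (m * b)) := by
      simpa using (hzero D).const_sub (m * b)
    refine le_of_tendsto_of_tendsto' h1 (hint (φ m) (hφ m)) fun n => ?_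
    have h2 := sum_orbit_ge (T := T) hsub hK m (n + 1) (x n)
    have h3 := hD (x n)
    have h4 := hx n
    push_cast at h4
    have h5 : m * (((n : ℝ) + 1) * b) - D ≤ ∑ i ∈ Finset.range (n + 1), φ m (T^[i] (x n)) := by
      have := mul_le_mul_of_nonneg_left h4 (Nat.cast_nonneg (α := ℝ) m)
      linarith
    calc m * b - ((n : ℝ) + 1)⁻¹ * D = ((n : ℝ) + 1)⁻¹ * (m * (((n : ℝ) + 1) * b) - D) := by
          field_simp
      _ ≤ _ := by gcongr

end Variational

/-! ### Calculus of locally Hölder maps. -/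

section Holder

variable {A A' W W₁ W₂ W₃ : Type*} [PseudoMetricSpace A] [PseudoMetricSpace A']
  [NormedAddCommGroup W] [NormedAddCommGroup W₁] [NormedAddCommGroup W₂] [NormedAddCommGroup W₃]
  {θ : ℝ≥0} {a : A}

/-- `f` is `θ`-Hölder on a neighborhood of `a`. -/
def HolderAt (θ : ℝ≥0) (f : A → W) (a : A) : Prop :=
  ∃ C : ℝ, 0 ≤ C ∧ ∃ t ∈ 𝓝 a, ∀ x ∈ t, ∀ y ∈ t, ‖f x - f y‖ ≤ C * dist x y ^ (θ : ℝ)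

theorem HolderWith.holderAt {f : A → W} {C : ℝ≥0} (hf : HolderWith C θ f) (a : A) :
    HolderAt θ f a :=
  ⟨C, C.2, univ, univ_mem, fun x _ y _ => by rw [← dist_eq_norm]; exact hf.dist_le x y⟩

theorem LocallyHolderOn.holderAt {f : A → W} {s : Set A} (hf : LocallyHolderOn θ f s)
    (hs : s ∈ 𝓝 a) : HolderAt θ f a := by
  obtain ⟨C, t, ht, h⟩ := hf a (mem_of_mem_nhds hs)
  rw [nhdsWithin_eq_nhds.2 hs] at ht
  exact ⟨C, C.2, t, ht, fun x hx y hy => by rw [← dist_eq_norm]; exact h.dist_le hx hy⟩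

theorem locallyHolderOn_of_holderAt {f : A → W} {s : Set A} (hf : ∀ a ∈ s, HolderAt θ f a) :
    LocallyHolderOn θ f s := by
  intro a ha
  obtain ⟨C, hC, t, ht, h⟩ := hf a ha
  refine ⟨C.toNNReal, t, mem_nhdsWithin_of_mem_nhds ht, fun x hx y hy => ?_⟩
  rw [edist_dist, edist_dist, dist_eq_norm,
    ENNReal.ofReal_rpow_of_nonneg dist_nonneg (NNReal.coe_nonneg θ),
    ← ENNReal.ofReal.eq_1 C, ← ENNReal.ofReal_mul hC]
  exact ENNReal.ofReal_le_ofReal (h x hx y hy)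

namespace HolderAt

theorem congr {f g : A → W} (hf : HolderAt θ f a) (hfg : f =ᶠ[𝓝 a] g) : HolderAt θ g a := by
  obtain ⟨C, hC, t, ht, h⟩ := hf
  refine ⟨C, hC, t ∩ {x | f x = g x}, inter_mem ht hfg, fun x hx y hy => ?_⟩
  rw [← show f x = g x from hx.2, ← show f y = g y from hy.2]
  exact h x hx.1 y hy.1

theorem const (w : W) : HolderAt θ (fun _ : A => w) a :=
  ⟨0, le_rfl, univ, univ_mem, fun x _ y _ => by simp⟩

protected theorem continuousAt (hθ : 0 < θ) {f : A → W} (hf : HolderAt θ f a) :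
    ContinuousAt f a := by
  obtain ⟨C, hC, t, ht, h⟩ := hf
  rw [ContinuousAt, tendsto_iff_norm_sub_tendsto_zero]
  have hlim : Tendsto (fun x => C * dist x a ^ (θ : ℝ)) (𝓝 a) (𝓝 0) := by
    have h1 : Tendsto (fun x => dist x a) (𝓝 a) (𝓝 0) := by
      simpa using (continuous_id.dist continuous_const : Continuous fun x => dist x a).tendsto a
    have h2 := (h1.rpow_const (p := (θ : ℝ)) (Or.inr θ.2)).const_mul C
    rwa [Real.zero_rpow (by exact_mod_cast hθ.ne'), mul_zero] at h2
  refine squeeze_zero' (Eventually.of_forall fun x => norm_nonneg _) ?_ hlim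
  filter_upwards [ht] with x hx using h x hx a (mem_of_mem_nhds ht)

theorem comp_lipschitz {f : A → W} {g : A' → A} {b : A'} (hf : HolderAt θ f (g b)) {K : ℝ≥0}
    (hg : LipschitzWith K g) : HolderAt θ (fun x => f (g x)) b := by
  obtain ⟨C, hC, t, ht, h⟩ := hf
  refine ⟨C * (K : ℝ) ^ (θ : ℝ), by positivity, g ⁻¹' t, hg.continuous.continuousAt ht,
    fun x hx y hy => (h _ hx _ hy).trans ?_⟩
  rw [mul_assoc, ← Real.mul_rpow (NNReal.coe_nonneg K) dist_nonneg]
  gcongr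
  exact hg.dist_le_mul x y

theorem add {f g : A → W} (hf : HolderAt θ f a) (hg : HolderAt θ g a) :
    HolderAt θ (fun x => f x + g x) a := by
  obtain ⟨C, hC, t, ht, h⟩ := hf
  obtain ⟨C', hC', t', ht', h'⟩ := hg
  refine ⟨C + C', by positivity, t ∩ t', inter_mem ht ht', fun x hx y hy => ?_⟩
  rw [add_sub_add_comm, add_mul]
  exact (norm_add_le _ _).trans (add_le_add (h x hx.1 y hy.1) (h' x hx.2 y hy.2))

theorem sum {ι : Type*} {s : Finset ι} {f : ι → A → W} (hf : ∀ i ∈ s, HolderAt θ (f i) a) :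
    HolderAt θ (fun x => ∑ i ∈ s, f i x) a := by
  classical
  induction s using Finset.induction_on with
  | empty => simpa using const 0
  | insert i s hi ih =>
    simp only [Finset.sum_insert hi]
    exact (hf i (Finset.mem_insert_self i s)).add
      (ih fun j hj => hf j (Finset.mem_insert_of_mem hj))

variable [NormedSpace ℝ W₁] [NormedSpace ℝ W₂] [NormedSpace ℝ W₃]

theorem bilinear (hθ : 0 < θ) (B : W₁ →L[ℝ] W₂ →L[ℝ] W₃) {f : A → W₁} {g : A → W₂}
    (hf : HolderAt θ f a) (hg : HolderAt θ g a) : HolderAt θ (fun x => B (f x) (g x)) a := by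
  have e1 := (hf.continuousAt hθ).norm.eventually_lt (continuousAt_const (y := ‖f a‖ + 1))
    (lt_add_one _)
  have e2 := (hg.continuousAt hθ).norm.eventually_lt (continuousAt_const (y := ‖g a‖ + 1))
    (lt_add_one _)
  obtain ⟨C, hC, t, ht, h⟩ := hf
  obtain ⟨C', hC', t', ht', h'⟩ := hg
  refine ⟨‖B‖ * C * (‖g a‖ + 1) + ‖B‖ * (‖f a‖ + 1) * C', by positivity,
    t ∩ t' ∩ ({x | ‖f x‖ < ‖f a‖ + 1} ∩ {x | ‖g x‖ < ‖g a‖ + 1}),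
    inter_mem (inter_mem ht ht') (inter_mem e1 e2), fun x hx y hy => ?_⟩
  have hfy : ‖f y‖ < ‖f a‖ + 1 := hy.2.1
  have hgx : ‖g x‖ < ‖g a‖ + 1 := hx.2.2
  have e : B (f x) (g x) - B (f y) (g y) = B (f x - f y) (g x) + B (f y) (g x - g y) := by
    simp
  rw [e]
  calc _ ≤ ‖B‖ * ‖f x - f y‖ * ‖g x‖ + ‖B‖ * ‖f y‖ * ‖g x - g y‖ :=
        (norm_add_le _ _).trans (add_le_add (B.le_opNorm₂ _ _) (B.le_opNorm₂ _ _))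
    _ ≤ ‖B‖ * (C * dist x y ^ (θ : ℝ)) * (‖g a‖ + 1) +
          ‖B‖ * (‖f a‖ + 1) * (C' * dist x y ^ (θ : ℝ)) := by
        gcongr
        · exact h x hx.1.1 y hy.1.1
        · exact h' x hx.1.2 y hy.1.2
    _ = _ := by ring

theorem clm_comp (hθ : 0 < θ) {f : A → W₂ →L[ℝ] W₃} {g : A → W₁ →L[ℝ] W₂}
    (hf : HolderAt θ f a) (hg : HolderAt θ g a) : HolderAt θ (fun x => f x ∘L g x) a :=
  bilinear hθ (ContinuousLinearMap.compL ℝ W₁ W₂ W₃) hf hg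

theorem smul (hθ : 0 < θ) {f : A → ℝ} {g : A → W₁} (hf : HolderAt θ f a) (hg : HolderAt θ g a) :
    HolderAt θ (fun x => f x • g x) a :=
  bilinear hθ (ContinuousLinearMap.lsmul ℝ ℝ) hf hg

theorem sub {f g : A → W} (hf : HolderAt θ f a) (hg : HolderAt θ g a) :
    HolderAt θ (fun x => f x - g x) a := by
  obtain ⟨C, hC, t, ht, h⟩ := hg
  simp only [sub_eq_add_neg]
  refine hf.add ⟨C, hC, t, ht, fun x hx y hy => ?_⟩
  rw [neg_sub_neg, norm_sub_rev]
  exact h x hx y hy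

theorem inv (hθ : 0 < θ) {f : A → ℝ} (hf : HolderAt θ f a) (h0 : f a ≠ 0) :
    HolderAt θ (fun x => (f x)⁻¹) a := by
  have hpos : 0 < |f a| / 2 := by positivity
  have e1 : ∀ᶠ x in 𝓝 a, |f a| / 2 < |f x| :=
    (continuousAt_const (y := |f a| / 2)).eventually_lt (hf.continuousAt hθ).abs
      (by linarith [abs_pos.2 h0])
  obtain ⟨C, hC, t, ht, h⟩ := hf
  refine ⟨C / (|f a| / 2 * (|f a| / 2)), by positivity, t ∩ {x | |f a| / 2 < |f x|},
    inter_mem ht e1, fun x hx y hy => ?_⟩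
  have hx2 : |f a| / 2 < |f x| := hx.2
  have hy2 : |f a| / 2 < |f y| := hy.2
  have hx0 : f x ≠ 0 := abs_pos.1 (hpos.trans hx2)
  have hy0 : f y ≠ 0 := abs_pos.1 (hpos.trans hy2)
  rw [inv_sub_inv hx0 hy0, norm_div, norm_mul, Real.norm_eq_abs (f x), Real.norm_eq_abs (f y),
    norm_sub_rev, div_mul_eq_mul_div]
  exact div_le_div₀ (by positivity) (h x hx.1 y hy.1) (by positivity)
    (mul_le_mul hx2.le hy2.le hpos.le (abs_nonneg _))

end HolderAt

/-- Near the diagonal, (x, y) is compared with (x, x), where `G` vanishes. Away from it, the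
distance is bounded below and `G` is locally bounded. Compactness gives one constant. -/
theorem exists_norm_le_dist_rpow {X : Type*} [MetricSpace X] [CompactSpace X] (hθ : 0 < θ)
    {G : X × X → W} (hG : ∀ p, HolderAt θ G p) (h0 : ∀ x, G (x, x) = 0) :
    ∃ C, 0 ≤ C ∧ ∀ x y, ‖G (x, y)‖ ≤ C * dist x y ^ (θ : ℝ) := by
  suffices ∃ C, 0 ≤ C ∧ ∀ p ∈ (univ : Set (X × X)), ‖G p‖ ≤ C * dist p.1 p.2 ^ (θ : ℝ) by
    obtain ⟨C, hC, h⟩ := this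
    exact ⟨C, hC, fun x y => h (x, y) (mem_univ _)⟩
  refine isCompact_univ.induction_on
    (p := fun s => ∃ C, 0 ≤ C ∧ ∀ p ∈ s, ‖G p‖ ≤ C * dist p.1 p.2 ^ (θ : ℝ))
    ⟨0, le_rfl, by simp⟩ ?_ ?_ ?_
  · rintro s t hst ⟨C, hC, h⟩
    exact ⟨C, hC, fun q hq => h q (hst hq)⟩
  · rintro s t ⟨C, hC, h⟩ ⟨C', hC', h'⟩
    refine ⟨C + C', by positivity, fun p hp => ?_⟩
    have : 0 ≤ dist p.1 p.2 ^ (θ : ℝ) := by positivity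
    rcases hp with hp | hp
    · nlinarith [h p hp]
    · nlinarith [h' p hp]
  · rintro ⟨x, y⟩ -
    rcases eq_or_ne x y with rfl | hxy
    · obtain ⟨C, hC, t, ht, h⟩ := hG (x, x)
      have hdiag : ∀ᶠ p : X × X in 𝓝 (x, x), (p.1, p.1) ∈ t :=
        (continuous_fst.prodMk continuous_fst).continuousAt ht
      refine ⟨t ∩ {p | (p.1, p.1) ∈ t}, mem_nhdsWithin_of_mem_nhds (inter_mem ht hdiag), C, hC,
        ?_⟩
      rintro ⟨u, v⟩ ⟨hp, hp'⟩
      have := h _ hp _ hp'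
      rw [h0, sub_zero, Prod.dist_eq] at this
      simpa [dist_comm u v] using this
    · have hd : 0 < dist x y := dist_pos.2 hxy
      have e1 := ((hG (x, y)).continuousAt hθ).norm.eventually_lt
        (continuousAt_const (y := ‖G (x, y)‖ + 1)) (lt_add_one _)
      have e2 : ∀ᶠ p : X × X in 𝓝 (x, y), dist x y / 2 < dist p.1 p.2 :=
        (continuousAt_const (y := dist x y / 2)).eventually_lt continuous_dist.continuousAt
          (by simpa using hd)
      have hpos : 0 < (dist x y / 2) ^ (θ : ℝ) := by positivity
      refine ⟨_, mem_nhdsWithin_of_mem_nhds (inter_mem e1 e2),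
        (‖G (x, y)‖ + 1) / (dist x y / 2) ^ (θ : ℝ), by positivity, fun p hp => ?_⟩
      have h1 : ‖G p‖ < ‖G (x, y)‖ + 1 := hp.1
      have h2 : dist x y / 2 < dist p.1 p.2 := hp.2
      refine h1.le.trans ?_
      rw [div_mul_eq_mul_div, le_div_iff₀ hpos]
      gcongr

end Holder

/-! ### Embedding of the bundle into a trivial bundle by Hölder bump functions. -/

section Embedding

set_option linter.unusedSectionVars false

variable {X : Type*} [MetricSpace X] (F : Type*) [NormedAddCommGroup F] [NormedSpace ℝ F]
  (E : X → Type*) [∀ x, AddCommGroup (E x)] [∀ x, Module ℝ (E x)]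
  [∀ x, TopologicalSpace (E x)] [TopologicalSpace (TotalSpace F E)]
  [FiberBundle F E] [VectorBundle ℝ F E]

/-- A finite family of Hölder functions without common zero, each of which vanishes outside the
domain of a trivialization. -/
structure BumpCover (θ : ℝ≥0) where
  centers : Finset X
  bump : X → X → ℝ
  holder : ∀ c, ∃ C : ℝ≥0, HolderWith C θ (bump c)
  vanish : ∀ c x, x ∉ (trivializationAt F E c).baseSet → ∀ᶠ y in 𝓝 x, bump c y = 0
  cover : ∀ x, ∃ c : centers, bump c x ≠ 0

theorem NormalHolderAlgebra.nonempty_bumpCover [CompactSpace X] {θ : ℝ≥0}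
    (h : NormalHolderAlgebra X θ) : Nonempty (BumpCover F E θ) := by
  have hr : ∀ c, ∃ r > 0, Metric.ball c r ⊆ (trivializationAt F E c).baseSet := fun c =>
    Metric.mem_nhds_iff.1 ((trivializationAt F E c).open_baseSet.mem_nhds
      (FiberBundle.mem_baseSet_trivializationAt F E c))
  choose r hr hrb using hr
  have hf : ∀ c, ∃ f : X → ℝ, (∃ C : ℝ≥0, HolderWith C θ f) ∧
      (∀ x ∈ (Metric.ball c (r c / 2))ᶜ, f x = 0) ∧
      ∀ x ∈ Metric.closedBall c (r c / 3), f x = 1 := fun c => by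
    have hd : Disjoint (Metric.ball c (r c / 2))ᶜ (Metric.closedBall c (r c / 3)) :=
      disjoint_left.2 fun x hx hx' => hx
        (Metric.closedBall_subset_ball (by linarith [hr c]) hx')
    obtain ⟨f, hf, -, h0, h1⟩ := h _ _ Metric.isOpen_ball.isClosed_compl.isCompact
      Metric.isClosed_closedBall.isCompact hd
    exact ⟨f, hf, h0, h1⟩
  choose f hf h0 h1 using hf
  obtain ⟨t, ht⟩ := CompactSpace.elim_nhds_subcover (fun c => Metric.closedBall c (r c / 3))
    fun c => Metric.closedBall_mem_nhds c (by linarith [hr c])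
  refine ⟨⟨t, f, hf, fun c x hx => ?_, fun x => ?_⟩⟩
  -- A point outside the base set is at distance at least r from c, so its ball of radius r/2 misses
  -- the support. Vanishing on a neighborhood makes the cut-off coordinates Hölder there too.
  · filter_upwards [Metric.ball_mem_nhds x (by linarith [hr c] : 0 < r c / 2)] with y hy
    refine h0 c y fun hy' => hx (hrb c ?_)
    rw [Metric.mem_ball] at *
    linarith [dist_triangle x y c, dist_comm x y]
  · have : x ∈ ⋃ c ∈ t, Metric.closedBall c (r c / 3) := by rw [ht]; trivial
    simp only [mem_iUnion] at this
    obtain ⟨c, hc, hx⟩ := this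
    exact ⟨⟨c, hc⟩, by rw [h1 c x hx]; exact one_ne_zero⟩

variable {F E} {θ : ℝ≥0}

theorem continuous_linearMap_of_fiber [FiniteDimensional ℝ F] {W : Type*} [NormedAddCommGroup W]
    [NormedSpace ℝ W] (x : X) (L : E x →ₗ[ℝ] W) : Continuous L := by
  let e := (trivializationAt F E x).continuousLinearEquivAt ℝ x
    (FiberBundle.mem_baseSet_trivializationAt F E x)
  have h : Continuous (L ∘ₗ (e.symm : F →L[ℝ] E x).toLinearMap) :=
    LinearMap.continuous_of_finiteDimensional _
  have : (L : E x → W) = (L ∘ₗ (e.symm : F →L[ℝ] E x).toLinearMap) ∘ e := by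
    ext u; simp
  rw [this]
  exact h.comp e.continuous

variable (F) in
include F in
theorem continuous_linearMap_to_fiber {W : Type*} [NormedAddCommGroup W]
    [NormedSpace ℝ W] [FiniteDimensional ℝ W] (x : X) (L : W →ₗ[ℝ] E x) : Continuous L := by
  let e := (trivializationAt F E x).continuousLinearEquivAt ℝ x
    (FiberBundle.mem_baseSet_trivializationAt F E x)
  have h : Continuous ((e : E x →L[ℝ] F).toLinearMap ∘ₗ L) :=
    LinearMap.continuous_of_finiteDimensional _
  have : (L : W → E x) = e.symm ∘ ((e : E x →L[ℝ] F).toLinearMap ∘ₗ L) := by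
    ext u; simp
  rw [this]
  exact e.symm.continuous.comp h

variable (F) in
include F in
theorem t2Space_fiber (x : X) : T2Space (E x) := by
  let e := (trivializationAt F E x).continuousLinearEquivAt ℝ x
    (FiberBundle.mem_baseSet_trivializationAt F E x)
  exact e.toHomeomorph.symm.t2Space

/-- The change of coordinates between two trivializations, as a continuous linear map. -/
def coordCLM [FiniteDimensional ℝ F] (e e' : Trivialization F (π F E)) [e.IsLinear ℝ]
    [e'.IsLinear ℝ] (x : X) : F →L[ℝ] F :=
  LinearMap.toContinuousLinearMap (e'.linearMapAt ℝ x ∘ₗ e.symmₗ ℝ x)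

theorem IsHolderBundle.holderAt_coordCLM [FiniteDimensional ℝ F] (hE : IsHolderBundle F E θ)
    (e e' : Trivialization F (π F E)) [MemTrivializationAtlas e] [MemTrivializationAtlas e'] {x : X}
    (hx : x ∈ e.baseSet) (hx' : x ∈ e'.baseSet) : HolderAt θ (coordCLM e e') x := by
  have hn : e.baseSet ∩ e'.baseSet ∈ 𝓝 x :=
    inter_mem (e.open_baseSet.mem_nhds hx) (e'.open_baseSet.mem_nhds hx')
  refine ((hE e e').holderAt hn).congr ?_
  filter_upwards [hn] with y hy
  ext1 v
  simp [coordCLM, Trivialization.coordChangeL_apply e e' hy, hy.1, hy.2]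

namespace BumpCover

variable (𝒰 : BumpCover F E θ)

/-- The sum of the squares of the bump functions. -/
def weight (x : X) : ℝ := ∑ c : 𝒰.centers, 𝒰.bump c x * 𝒰.bump c x

theorem weight_ne_zero (x : X) : 𝒰.weight x ≠ 0 := by
  obtain ⟨c, hc⟩ := 𝒰.cover x
  have : 0 < ∑ c : 𝒰.centers, 𝒰.bump c x * 𝒰.bump c x :=
    Finset.sum_pos' (fun c _ => mul_self_nonneg _) ⟨c, Finset.mem_univ c, mul_self_pos.2 hc⟩
  exact this.ne'

theorem holderAt_bump (c x : X) : HolderAt θ (𝒰.bump c) x := by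
  obtain ⟨C, hC⟩ := 𝒰.holder c
  exact HolderWith.holderAt hC x

theorem holderAt_weight (hθ : 0 < θ) (x : X) : HolderAt θ 𝒰.weight x :=
  HolderAt.sum fun c _ => (𝒰.holderAt_bump c x).smul hθ (𝒰.holderAt_bump c x)

/-- The embedding of the fibers into a fixed vector space. -/
def emb (x : X) : E x →ₗ[ℝ] (𝒰.centers → F) :=
  LinearMap.pi fun c => 𝒰.bump c x • (trivializationAt F E (c : X)).linearMapAt ℝ x

/-- The left inverse of the embedding. -/
def ret (x : X) : (𝒰.centers → F) →ₗ[ℝ] E x :=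
  (𝒰.weight x)⁻¹ • ∑ c : 𝒰.centers,
    𝒰.bump c x • ((trivializationAt F E (c : X)).symmₗ ℝ x ∘ₗ LinearMap.proj c)

/-- Where a trivialization is defined, its two coordinate maps cancel and leave the square of the
bump; elsewhere the bump is zero, so the default values of the coordinates do not matter. The weight
normalizes the sum. -/
theorem ret_emb (x : X) (u : E x) : 𝒰.ret x (𝒰.emb x u) = u := by
  have : ∀ c : 𝒰.centers, 𝒰.bump c x • ((trivializationAt F E (c : X)).symmₗ ℝ x)
      (𝒰.bump c x • (trivializationAt F E (c : X)).linearMapAt ℝ x u) =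
      (𝒰.bump c x * 𝒰.bump c x) • u := by
    intro c
    by_cases hx : x ∈ (trivializationAt F E (c : X)).baseSet
    · rw [map_smul, Trivialization.symmₗ_linearMapAt _ hx, smul_smul]
    · rw [(𝒰.vanish c x hx).self_of_nhds]
      simp
  simp only [ret, emb, LinearMap.smul_apply, LinearMap.sum_apply, LinearMap.comp_apply,
    LinearMap.proj_apply, LinearMap.pi_apply, this]
  rw [← Finset.sum_smul, smul_smul, ← weight, inv_mul_cancel₀ (𝒰.weight_ne_zero x), one_smul]

variable [FiniteDimensional ℝ F]

/-- The embedding, read in a trivialization. -/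
def embCoord (e : Trivialization F (π F E)) [e.IsLinear ℝ] (x : X) : F →L[ℝ] (𝒰.centers → F) :=
  LinearMap.toContinuousLinearMap (𝒰.emb x ∘ₗ e.symmₗ ℝ x)

/-- The left inverse of the embedding, read in a trivialization. -/
def retCoord (e : Trivialization F (π F E)) [e.IsLinear ℝ] (x : X) : (𝒰.centers → F) →L[ℝ] F :=
  LinearMap.toContinuousLinearMap (e.linearMapAt ℝ x ∘ₗ 𝒰.ret x)

theorem holderAt_embCoord (hθ : 0 < θ) (hE : IsHolderBundle F E θ) (e : Trivialization F (π F E))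
    [MemTrivializationAtlas e] {x : X} (hx : x ∈ e.baseSet) : HolderAt θ (𝒰.embCoord e) x := by
  classical
  have h : 𝒰.embCoord e = fun y => ∑ c : 𝒰.centers,
      ContinuousLinearMap.single ℝ (fun _ : 𝒰.centers => F) c ∘L
        (𝒰.bump c y • coordCLM e (trivializationAt F E (c : X)) y) := by
    ext y v c
    simp [embCoord, emb, coordCLM, Pi.single_apply]
  rw [h]
  refine HolderAt.sum fun c _ => (HolderAt.const _).clm_comp hθ ?_
  by_cases hc : x ∈ (trivializationAt F E (c : X)).baseSet
  · exact (𝒰.holderAt_bump c x).smul hθ (hE.holderAt_coordCLM _ _ hx hc)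
  · refine (HolderAt.const 0).congr ?_
    filter_upwards [𝒰.vanish c x hc] with y hy
    rw [hy, zero_smul]

theorem holderAt_retCoord (hθ : 0 < θ) (hE : IsHolderBundle F E θ) (e : Trivialization F (π F E))
    [MemTrivializationAtlas e] {x : X} (hx : x ∈ e.baseSet) : HolderAt θ (𝒰.retCoord e) x := by
  have h : 𝒰.retCoord e = fun y => (𝒰.weight y)⁻¹ • ∑ c : 𝒰.centers,
      (𝒰.bump c y • coordCLM (trivializationAt F E (c : X)) e y) ∘L
        ContinuousLinearMap.proj (R := ℝ) (φ := fun _ : 𝒰.centers => F) c := by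
    ext1 y
    ext1 v
    simp [retCoord, ret, coordCLM, map_sum]
  rw [h]
  refine ((𝒰.holderAt_weight hθ x).inv hθ (𝒰.weight_ne_zero x)).smul hθ
    (HolderAt.sum fun c _ => HolderAt.clm_comp hθ ?_ (HolderAt.const _))
  by_cases hc : x ∈ (trivializationAt F E (c : X)).baseSet
  · exact (𝒰.holderAt_bump c x).smul hθ (hE.holderAt_coordCLM _ _ hc hx)
  · refine (HolderAt.const 0).congr ?_
    filter_upwards [𝒰.vanish c x hc] with y hy
    rw [hy, zero_smul]

/-- A linear map between two fibers, as an endomorphism of the ambient space. -/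
def conj {x y : X} (L : E x →ₗ[ℝ] E y) : (𝒰.centers → F) →L[ℝ] (𝒰.centers → F) :=
  LinearMap.toContinuousLinearMap (𝒰.emb y ∘ₗ L ∘ₗ 𝒰.ret x)

theorem conj_apply {x y : X} (L : E x →ₗ[ℝ] E y) (w : 𝒰.centers → F) :
    𝒰.conj L w = 𝒰.emb y (L (𝒰.ret x w)) := rfl

theorem conj_emb {x y : X} (L : E x →ₗ[ℝ] E y) (u : E x) :
    𝒰.conj L (𝒰.emb x u) = 𝒰.emb y (L u) := by
  rw [conj_apply, ret_emb]

theorem conj_mul {x y z : X} (L : E y →ₗ[ℝ] E z) (L' : E x →ₗ[ℝ] E y) :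
    𝒰.conj L * 𝒰.conj L' = 𝒰.conj (L ∘ₗ L') := by
  ext1 w
  rw [mul_apply_eq_comp, conj_apply _ L', conj_emb]
  rfl

theorem conj_eq_coord (e e' : Trivialization F (π F E)) [e.IsLinear ℝ] [e'.IsLinear ℝ] {x y : X}
    (hx : x ∈ e.baseSet) (hy : y ∈ e'.baseSet) (L : E x →L[ℝ] E y) :
    𝒰.conj (L : E x →ₗ[ℝ] E y) = 𝒰.embCoord e' y ∘L
      ((e'.continuousLinearMapAt ℝ y) ∘L L ∘L (e.symmL ℝ x)) ∘L 𝒰.retCoord e x := by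
  ext1 w
  simp only [conj, embCoord, retCoord, ContinuousLinearMap.comp_apply,
    LinearMap.coe_toContinuousLinearMap', LinearMap.comp_apply, ContinuousLinearMap.coe_coe,
    Trivialization.continuousLinearMapAt_apply]
  have h1 : ∀ v, e.symmL ℝ x v = e.symmₗ ℝ x v := fun v => rfl
  rw [h1, Trivialization.symmₗ_linearMapAt _ hx, Trivialization.symmₗ_linearMapAt _ hy]

-- Embedding over x followed by retraction over y is a transport map. This existence gives meaning
-- to the choice made in `transport`.
include 𝒰 in
theorem exists_isTransport (hθ : 0 < θ) (hE : IsHolderBundle F E θ) :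
    ∃ I : ∀ x y : X, E x →L[ℝ] E y, IsTransport F θ I := by
  refine ⟨fun x y => ⟨𝒰.ret y ∘ₗ 𝒰.emb x,
    (continuous_linearMap_to_fiber F y (𝒰.ret y)).comp
      (continuous_linearMap_of_fiber (F := F) x (𝒰.emb x))⟩, fun x => ?_, fun e e' _ _ => ?_⟩
  · ext1 u
    exact 𝒰.ret_emb x u
  · refine locallyHolderOn_of_holderAt ?_
    rintro ⟨x, y⟩ ⟨hx, hy⟩
    have h1 : HolderAt θ (fun p : X × X => 𝒰.embCoord e p.1) (x, y) :=
      (𝒰.holderAt_embCoord hθ hE e hx).comp_lipschitz LipschitzWith.prod_fst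
    have h2 : HolderAt θ (fun p : X × X => 𝒰.retCoord e' p.2) (x, y) :=
      (𝒰.holderAt_retCoord hθ hE e' hy).comp_lipschitz LipschitzWith.prod_snd
    refine (h2.clm_comp hθ h1).congr (Eventually.of_forall fun p => ?_)
    ext1 v
    rfl

theorem holderAt_conj_transport (hθ : 0 < θ) (hE : IsHolderBundle F E θ)
    {I : ∀ x y : X, E x →L[ℝ] E y} (hI : IsTransport F θ I) (p : X × X) :
    HolderAt θ (fun p : X × X => 𝒰.conj (I p.1 p.2 : E p.1 →ₗ[ℝ] E p.2)) p := by
  obtain ⟨x, y⟩ := p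
  set e := trivializationAt F E x
  set e' := trivializationAt F E y
  have hx : x ∈ e.baseSet := FiberBundle.mem_baseSet_trivializationAt F E x
  have hy : y ∈ e'.baseSet := FiberBundle.mem_baseSet_trivializationAt F E y
  have hn : e.baseSet ×ˢ e'.baseSet ∈ 𝓝 (x, y) :=
    prod_mem_nhds (e.open_baseSet.mem_nhds hx) (e'.open_baseSet.mem_nhds hy)
  have h1 : HolderAt θ (fun p : X × X => 𝒰.embCoord e' p.2) (x, y) :=
    (𝒰.holderAt_embCoord hθ hE e' hy).comp_lipschitz LipschitzWith.prod_snd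
  have h2 : HolderAt θ (fun p : X × X => 𝒰.retCoord e p.1) (x, y) :=
    (𝒰.holderAt_retCoord hθ hE e hx).comp_lipschitz LipschitzWith.prod_fst
  refine (h1.clm_comp hθ (((hI.2 e e').holderAt hn).clm_comp hθ h2)).congr ?_
  filter_upwards [hn] with p hp
  exact (𝒰.conj_eq_coord e e' hp.1 hp.2 _).symm

theorem holderAt_conj_aut (hθ : 0 < θ) (hE : IsHolderBundle F E θ) {T : X ≃ₜ X} {Φ : Aut E T}
    (hΦ : Φ.IsHolder F θ) (x : X) :
    HolderAt θ (fun x => 𝒰.conj ((Φ x : E x →L[ℝ] E (T x)) : E x →ₗ[ℝ] E (T x))) x := by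
  obtain ⟨K, hK⟩ := hΦ.1
  set e := trivializationAt F E x
  set e' := trivializationAt F E (T x)
  have hx : x ∈ e.baseSet := FiberBundle.mem_baseSet_trivializationAt F E x
  have hy : T x ∈ e'.baseSet := FiberBundle.mem_baseSet_trivializationAt F E (T x)
  have hn : e.baseSet ∩ T ⁻¹' e'.baseSet ∈ 𝓝 x :=
    inter_mem (e.open_baseSet.mem_nhds hx) ((e'.open_baseSet.preimage T.continuous).mem_nhds hy)
  have h1 : HolderAt θ (fun y => 𝒰.embCoord e' (T y)) x :=
    (𝒰.holderAt_embCoord hθ hE e' hy).comp_lipschitz hK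
  refine (h1.clm_comp hθ (((hΦ.2 e e').holderAt hn).clm_comp hθ
    (𝒰.holderAt_retCoord hθ hE e hx))).congr ?_
  filter_upwards [hn] with p hp
  exact (𝒰.conj_eq_coord e e' hp.1 hp.2 _).symm

end BumpCover

end Embedding

/-! ### Growth rate of a sequence that is both subadditive and almost superadditive. -/

section Growth

theorem limsup_eq_of_tendsto_sub {u v : ℕ → ℝ} {C : ℝ} (hv : ∀ n, |v n| ≤ C)
    (huv : Tendsto (fun n => u n - v n) atTop (𝓝 0)) : limsup u atTop = limsup v atTop := by
  have bdd : ∀ (w : ℕ → ℝ) (D : ℝ), (∀ᶠ n in atTop, |w n| ≤ D) →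
      IsBoundedUnder (· ≤ ·) atTop w ∧ IsBoundedUnder (· ≥ ·) atTop w := fun w D hw =>
    ⟨⟨D, eventually_map.2 (hw.mono fun n hn => (abs_le.1 hn).2)⟩,
      ⟨-D, eventually_map.2 (hw.mono fun n hn => (abs_le.1 hn).1)⟩⟩
  have key : ∀ (u v : ℕ → ℝ) (D : ℝ), (∀ᶠ n in atTop, |u n| ≤ D) → (∀ᶠ n in atTop, |v n| ≤ D) →
      Tendsto (fun n => u n - v n) atTop (𝓝 0) → limsup u atTop ≤ limsup v atTop := by
    intro u v D hu hv huv
    refine le_of_forall_pos_le_add fun ε hε => ?_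
    have h1 : ∀ᶠ n in atTop, u n ≤ v n + ε := by
      filter_upwards [huv.eventually_lt_const hε] with n hn
      linarith
    rw [← limsup_add_const atTop v ε (bdd v D hv).1 (bdd v D hv).2.isCoboundedUnder_flip]
    refine limsup_le_limsup h1 (bdd u D hu).2.isCoboundedUnder_flip ?_
    refine (bdd _ (D + |ε|) (hv.mono fun n hn => (abs_add_le _ _).trans ?_)).1
    linarith
  have hu : ∀ᶠ n in atTop, |u n| ≤ C + 1 := by
    have := (huv.abs).eventually_lt_const (show |(0 : ℝ)| < 1 by simp)
    filter_upwards [this] with n hn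
    have := abs_add_le (u n - v n) (v n)
    rw [sub_add_cancel] at this
    linarith [hv n]
  have hv' : ∀ᶠ n in atTop, |v n| ≤ C + 1 := Eventually.of_forall fun n => by linarith [hv n]
  refine le_antisymm (key u v _ hu hv' huv) (key v u _ hv' hu ?_)
  simpa using huv.neg

variable {X : Type*} [MetricSpace X] [CompactSpace X]

theorem exists_abs_le_add_mul {T : X ≃ₜ X} {φ : ℕ → X → ℝ}
    (hφ : ∀ n, Continuous (φ n)) (hsub : ∀ m n x, φ (m + n) x ≤ φ m (T^[n] x) + φ n x) {K : ℝ}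
    (hK : ∀ n x, φ n x ≤ φ (n + 1) x + K) :
    ∃ C, 0 ≤ C ∧ ∀ n x, |φ n x| ≤ C + n * C := by
  obtain ⟨C₀, h0⟩ := isCompact_univ.exists_bound_of_continuousOn (hφ 0).continuousOn
  obtain ⟨C₁, h1⟩ := isCompact_univ.exists_bound_of_continuousOn (hφ 1).continuousOn
  set C := |C₀| + |C₁| + |K| with hC
  have b0 := abs_nonneg C₀
  have b1 := abs_nonneg C₁
  have b2 := abs_nonneg K
  refine ⟨C, by positivity, fun n => ?_⟩
  induction n with
  | zero =>
    intro x
    have := h0 x (mem_univ x)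
    rw [Real.norm_eq_abs] at this
    simp only [Nat.cast_zero, zero_mul, add_zero]
    linarith [le_abs_self C₀]
  | succ n ih =>
    intro x
    have h2 := abs_le.1 (ih x)
    have h3 := h1 (T^[n] x) (mem_univ _)
    rw [Real.norm_eq_abs] at h3
    have h4 := abs_le.1 h3
    have h5 := hsub 1 n x
    rw [add_comm 1 n] at h5
    have h6 := hK n x
    have := le_abs_self C₁
    have := le_abs_self K
    rw [abs_le]
    push_cast
    constructor <;> linarith

/-- Fekete's lemma for the maxima s_n gives n b ≤ s_n; for D - s_n, whose rate is -b, it gives s_n ≤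
n b + D. The lower bound feeds the construction of the measure. -/
theorem exists_growth_rate [Nonempty X] [MeasurableSpace X] [BorelSpace X] {T : X ≃ₜ X}
    {φ : ℕ → X → ℝ} (hφ : ∀ n, Continuous (φ n))
    (hsub : ∀ m n x, φ (m + n) x ≤ φ m (T^[n] x) + φ n x) {K : ℝ}
    (hK : ∀ n x, φ n x ≤ φ (n + 1) x + K) {D : ℝ}
    (hD : ∀ m n x y S, (∀ z, φ (m + n) z ≤ S) → φ m y + φ n x ≤ D + S) :
    ∃ b : ℝ, (∀ n x, φ n x ≤ n * b + D) ∧ ∃ μ : Measure X, IsProbabilityMeasure μ ∧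
      MeasurePreserving T μ μ ∧ b ≤ ∫ x, limsup (fun n : ℕ => (1 / (n : ℝ)) * φ n x) atTop ∂μ := by
  have hmax : ∀ n, ∃ x, ∀ y, φ n y ≤ φ n x := fun n => by
    obtain ⟨x, -, hx⟩ := isCompact_univ.exists_isMaxOn univ_nonempty (hφ n).continuousOn
    exact ⟨x, fun y => hx (mem_univ y)⟩
  choose xm hxm using hmax
  set s : ℕ → ℝ := fun n => φ n (xm n) with hs
  have hs1 : Subadditive s := fun m n =>
    (hsub m n _).trans (add_le_add (hxm m _) (hxm n _))
  have hs2 : Subadditive fun n => D - s n := fun m n => by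
    have := hD m n (xm n) (xm m) (s (m + n)) (hxm (m + n))
    simp only [hs] at this ⊢
    linarith
  obtain ⟨C, hC, hbd⟩ := exists_abs_le_add_mul hφ hsub hK
  have hbd1 : ∀ n : ℕ, |(1 / (n : ℝ)) * C| ≤ C := fun n => by
    rcases Nat.eq_zero_or_pos n with rfl | hn
    · simpa using hC
    · have h1 : (1 : ℝ) ≤ n := by exact_mod_cast hn
      rw [abs_of_nonneg (by positivity)]
      exact mul_le_of_le_one_left hC ((div_le_one (by linarith)).2 h1)
  have hbd2 : ∀ (n : ℕ) x, |(1 / (n : ℝ)) * φ n x| ≤ 2 * C := fun n x => by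
    rcases Nat.eq_zero_or_pos n with rfl | hn
    · simpa using hC
    · have h1 : (0 : ℝ) < n := by exact_mod_cast hn
      rw [abs_mul, abs_of_pos (by positivity : 0 < 1 / (n : ℝ))]
      calc 1 / (n : ℝ) * |φ n x| ≤ 1 / (n : ℝ) * (C + n * C) := by gcongr; exact hbd n x
        _ = 1 / (n : ℝ) * C + C := by field_simp
        _ ≤ _ := by linarith [le_abs_self (1 / (n : ℝ) * C), hbd1 n]
  have hb1 : BddBelow (range fun n => s n / n) := by
    refine ⟨-(2 * C), ?_⟩
    rintro _ ⟨n, rfl⟩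
    have := (abs_le.1 (hbd2 n (xm n))).1
    simp only [hs]
    rwa [div_eq_inv_mul, ← one_div]
  have hb2 : BddBelow (range fun n => (D - s n) / n) := by
    refine ⟨-(|D| + 2 * C), ?_⟩
    rintro _ ⟨n, rfl⟩
    rcases Nat.eq_zero_or_pos n with rfl | hn
    · simp only [CharP.cast_eq_zero, div_zero]
      linarith [abs_nonneg D]
    have h1 : (1 : ℝ) ≤ n := by exact_mod_cast hn
    have h2 := (abs_le.1 (hbd2 n (xm n))).2
    have h3 : |D / n| ≤ |D| := by
      rw [abs_div, abs_of_pos (by linarith : (0 : ℝ) < n)]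
      exact div_le_self (abs_nonneg D) h1
    have h4 := (abs_le.1 h3).1
    simp only [hs]
    rw [sub_div, div_eq_inv_mul (φ n (xm n)), ← one_div (n : ℝ)]
    linarith
  set b := hs1.lim with hb
  have hsb : ∀ n : ℕ, n * b ≤ s n := fun n => by
    rcases Nat.eq_zero_or_pos n with rfl | hn
    · have := hs1 0 0
      simp only [add_zero] at this
      simp only [Nat.cast_zero, zero_mul]
      linarith
    · have := hs1.lim_le_div hb1 hn.ne'
      rwa [le_div_iff₀ (by exact_mod_cast hn), mul_comm] at this
  have hlim : hs2.lim = -b := by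
    refine tendsto_nhds_unique (hs2.tendsto_lim hb2) ?_
    have h1 := (hs1.tendsto_lim hb1).neg
    have h2 := tendsto_const_div_atTop_nhds_zero_nat D
    have h3 := h2.add h1
    rw [zero_add] at h3
    exact h3.congr fun n => by ring
  refine ⟨b, fun n x => ?_, ?_⟩
  · refine (hxm n x).trans ?_
    change s n ≤ _
    rcases Nat.eq_zero_or_pos n with rfl | hn
    -- Fekete's lemma is silent at n = 0; subadditivity at (0, 0) alone gives s_0 ≤ D.
    · have := hs2 0 0
      simp only [add_zero] at this
      simp only [Nat.cast_zero, zero_mul]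
      linarith
    · have := hs2.lim_le_div hb2 hn.ne'
      rw [hlim, le_div_iff₀ (by exact_mod_cast hn)] at this
      linarith
  · obtain ⟨μ, hμ, hinv, hint⟩ :=
      exists_invariant_measure_integral_ge hφ hsub hK (b := b) fun n => ⟨xm n, hsb n⟩
    refine ⟨μ, hμ, hinv, le_integral_limsup (fun n => ((hφ n).const_mul _).measurable)
      hbd2 ?_⟩
    filter_upwards [eventually_gt_atTop 0] with n hn
    have h0 : (0 : ℝ) < n := by exact_mod_cast hn
    have h1 := hint n
    rw [integral_const_mul, one_div, le_inv_mul_iff₀ h0]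
    exact h1

end Growth

/-! ### Homogeneous functions on the embedded bundle, and continuity of the inverse. -/

section Compactness

variable {X V : Type*} [MetricSpace X] [CompactSpace X] [NormedAddCommGroup V] [NormedSpace ℝ V]
  [FiniteDimensional ℝ V] {P : X → V →L[ℝ] V}

theorem isCompact_unit_range (hP : Continuous P) :
    IsCompact {q : X × V | ‖q.2‖ = 1 ∧ P q.1 q.2 = q.2} := by
  refine (isCompact_univ.prod (isCompact_sphere (0 : V) 1)).of_isClosed_subset ?_ ?_
  · have h1 : Continuous fun q : X × V => P q.1 q.2 :=
      (hP.comp continuous_fst).clm_apply continuous_snd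
    exact (isClosed_eq continuous_snd.norm continuous_const).inter (isClosed_eq h1 continuous_snd)
  · exact fun q hq => ⟨mem_univ _, by simpa using hq.1⟩

variable {f g : X → V → ℝ}

theorem exists_norm_le_mul (hP : Continuous P) (hf : Continuous fun q : X × V => f q.1 q.2)
    (hom : ∀ x (t : ℝ) w, f x (t • w) = |t| * f x w)
    (pos : ∀ x w, P x w = w → w ≠ 0 → 0 < f x w) :
    ∃ C, 0 < C ∧ ∀ x w, P x w = w → ‖w‖ ≤ C * f x w := by
  obtain ⟨C, hC⟩ := (isCompact_unit_range hP).exists_bound_of_continuousOn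
    (f := fun q : X × V => (f q.1 q.2)⁻¹) (hf.continuousOn.inv₀ fun q hq =>
      (pos q.1 q.2 hq.2 (by rintro h; simp [h] at hq)).ne')
  refine ⟨max C 1, by positivity, fun x w hw => ?_⟩
  rcases eq_or_ne w 0 with rfl | hw0
  · have := hom x 0 0
    rw [zero_smul, abs_zero, zero_mul] at this
    rw [this, norm_zero, mul_zero]
  have hn : 0 < ‖w‖ := norm_pos_iff.2 hw0
  have h1 := hC (x, ‖w‖⁻¹ • w) ⟨by simp [norm_smul, hn.ne'], by simp [hw]⟩
  have h2 := pos x w hw hw0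
  simp only [hom, norm_inv, norm_mul, Real.norm_eq_abs, abs_inv, abs_norm,
    abs_of_pos h2] at h1
  rw [mul_inv, inv_inv, ← div_eq_mul_inv, div_le_iff₀ h2] at h1
  exact h1.trans (mul_le_mul_of_nonneg_right (le_max_left _ _) h2.le)

theorem exists_le_mul_norm (hf : Continuous fun q : X × V => f q.1 q.2)
    (hom : ∀ x (t : ℝ) w, f x (t • w) = |t| * f x w) :
    ∃ C, 0 < C ∧ ∀ x w, f x w ≤ C * ‖w‖ := by
  obtain ⟨C, hC⟩ := (isCompact_univ.prod (isCompact_sphere (0 : V) 1)).exists_bound_of_continuousOn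
    (f := fun q : X × V => f q.1 q.2) hf.continuousOn
  refine ⟨max C 1, by positivity, fun x w => ?_⟩
  rcases eq_or_ne w 0 with rfl | hw0
  · have := hom x 0 0
    rw [zero_smul, abs_zero, zero_mul] at this
    rw [this, norm_zero, mul_zero]
  have hn : 0 < ‖w‖ := norm_pos_iff.2 hw0
  have h1 := hC (x, ‖w‖⁻¹ • w) ⟨mem_univ _, by simp [norm_smul, hn.ne']⟩
  simp only [hom, abs_inv, abs_norm] at h1
  have h2 := (le_abs_self _).trans h1
  rw [inv_mul_le_iff₀ hn, mul_comm] at h2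
  exact h2.trans (mul_le_mul_of_nonneg_right (le_max_left _ _) hn.le)

/-- The unit vectors that violate the strict inequality form a compact set. Its projection to `X` is
closed and misses x₀. -/
theorem eventually_forall_le (hP : Continuous P) (hf : Continuous fun q : X × V => f q.1 q.2)
    (hg : Continuous fun q : X × V => g q.1 q.2)
    (homf : ∀ x (t : ℝ) w, f x (t • w) = |t| * f x w)
    (homg : ∀ x (t : ℝ) w, g x (t • w) = |t| * g x w) {x₀ : X}
    (h : ∀ w, P x₀ w = w → w ≠ 0 → f x₀ w < g x₀ w) :
    ∀ᶠ x in 𝓝 x₀, ∀ w, P x w = w → f x w ≤ g x w := by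
  set K := {q : X × V | ‖q.2‖ = 1 ∧ P q.1 q.2 = q.2} ∩ {q | g q.1 q.2 ≤ f q.1 q.2} with hK
  have hKc : IsCompact K := (isCompact_unit_range hP).inter_right (isClosed_le hg hf)
  have hcl : IsClosed (Prod.fst '' K) := (hKc.image continuous_fst).isClosed
  have hx : x₀ ∉ Prod.fst '' K := by
    rintro ⟨⟨x, w⟩, hq, rfl⟩
    exact not_lt.2 hq.2 (h w hq.1.2 (by rintro rfl; simpa using hq.1.1))
  filter_upwards [hcl.isOpen_compl.mem_nhds hx] with x hx w hw
  rcases eq_or_ne w 0 with rfl | hw0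
  · have h1 := homf x 0 0
    have h2 := homg x 0 0
    rw [zero_smul, abs_zero, zero_mul] at h1 h2
    rw [h1, h2]
  have hn : 0 < ‖w‖ := norm_pos_iff.2 hw0
  by_contra hlt
  refine hx ⟨(x, ‖w‖⁻¹ • w), ⟨⟨by simp [norm_smul, hn.ne'], by simp [hw]⟩, ?_⟩, rfl⟩
  simp only [mem_ofPred_eq, homf, homg]
  exact mul_le_mul_of_nonneg_left (not_le.1 hlt).le (abs_nonneg _)

/-- By compactness A is bounded below on the ranges, so B is bounded. Continuity follows from the
identity B' - B = B'(A - A')B, with corrections because the projections vary with the point. -/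
theorem continuous_bwd {T : X ≃ₜ X} {A B : X → V →L[ℝ] V} (hP : Continuous P)
    (hA : Continuous A) (hBP : ∀ x, B x * P x = B x) (hPB : ∀ x, P (T.symm x) * B x = B x)
    (hBA : ∀ x, B (T x) * A x = P x) (hAB : ∀ x, A (T.symm x) * B x = P x) :
    Continuous B := by
  have hAB' : ∀ x, A x * B (T x) = P (T x) := fun x => by simpa using hAB (T x)
  have hPB' : ∀ x, P x * B (T x) = B (T x) := fun x => by simpa using hPB (T x)
  obtain ⟨C, hC, h1⟩ := exists_norm_le_mul (f := fun x w => ‖A x w‖) hP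
    ((hA.comp continuous_fst).clm_apply continuous_snd).norm
    (fun x t w => by simp [norm_smul]) (fun x w hw hw0 => norm_pos_iff.2 fun h0 => hw0 (by
      rw [← hw, ← hBA, mul_apply_eq_comp, h0, map_zero]))
  obtain ⟨K, hK⟩ := isCompact_univ.exists_bound_of_continuousOn hP.continuousOn
  have hK0 : ∀ x : X, 0 ≤ K := fun x => (norm_nonneg _).trans (hK x (mem_univ x))
  have hbd : ∀ x, ‖B (T x)‖ ≤ C * K := fun x => by
    refine ContinuousLinearMap.opNorm_le_bound _ (mul_nonneg hC.le (hK0 x)) fun w => ?_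
    have h2 := h1 x (B (T x) w) (by rw [← mul_apply_eq_comp, hPB'])
    simp only [← mul_apply_eq_comp, hAB'] at h2
    refine h2.trans ?_
    rw [mul_assoc]
    gcongr
    exact ContinuousLinearMap.le_of_opNorm_le _ (hK (T x) (mem_univ _)) w
  have hB' : Continuous fun x => B (T x) := by
    rw [continuous_iff_continuousAt]
    intro x
    set M := C * K
    have e : ∀ y, B (T y) - B (T x) = B (T y) * (P (T y) - P (T x)) +
        B (T y) * (A x - A y) * B (T x) - (P x - P y) * B (T x) := fun y => by
      simp only [mul_sub, sub_mul, hBP, mul_assoc, hAB', hPB']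
      simp only [← mul_assoc, hBA]
      abel
    have hbound : ∀ y, ‖B (T y) - B (T x)‖ ≤ M * ‖P (T y) - P (T x)‖ +
        M * ‖A x - A y‖ * M + ‖P x - P y‖ * M := fun y => by
      rw [e]
      have hM : 0 ≤ M := mul_nonneg hC.le (hK0 x)
      refine (norm_sub_le _ _).trans (add_le_add ((norm_add_le _ _).trans (add_le_add ?_ ?_)) ?_)
      · exact (norm_mul_le _ _).trans (mul_le_mul_of_nonneg_right (hbd y) (norm_nonneg _))
      · exact (norm_mul_le _ _).trans (mul_le_mul ((norm_mul_le _ _).trans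
          (mul_le_mul_of_nonneg_right (hbd y) (norm_nonneg _))) (hbd x) (norm_nonneg _)
          (by positivity))
      · exact (norm_mul_le _ _).trans (mul_le_mul_of_nonneg_left (hbd x) (norm_nonneg _))
    rw [ContinuousAt, tendsto_iff_norm_sub_tendsto_zero]
    refine squeeze_zero (fun y => norm_nonneg _) hbound ?_
    have c : Continuous fun y => M * ‖P (T y) - P (T x)‖ + M * ‖A x - A y‖ * M +
        ‖P x - P y‖ * M := by
      have := hP.comp T.continuous
      simp only [Function.comp_def] at this
      fun_prop
    simpa using c.tendsto x
  simpa [Function.comp_def] using hB'.comp T.symm.continuous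

end Compactness

/-! ### Fiber-bunching and geometric convergence of the holonomies. -/

section Bunching

set_option linter.unusedSectionVars false

variable {X V : Type*} [MetricSpace X] [CompactSpace X] [NormedAddCommGroup V] [NormedSpace ℝ V]
  {T : X ≃ₜ X} {P A B : X → V →L[ℝ] V} {J : X → X → V →L[ℝ] V} {δ : ℝ} {θ : ℝ≥0}

theorem LinearSystem.exists_norm_bwd_le (h : LinearSystem T P A B) :
    ∃ K, 0 < K ∧ ∀ x, ‖B x‖ ≤ K := by
  obtain ⟨K, hK, hB⟩ := h.symm.exists_norm_cocycle_le 1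
  exact ⟨K, hK, fun x => by simpa only [h.symm.cocycle_one] using hB x⟩

/-- Consecutive stages differ by the failure of `J` to commute with `A` at time n, which is
O(dist^θ), placed between n steps along x and n inverse steps along y. The bunching hypothesis `hb`
is exactly the decay of this product. -/
theorem LinearSystem.holonomySystem (h : LinearSystem T P A B)
    (hJ : Continuous fun p : X × X => J p.1 p.2) (hJd : ∀ x, J x x = P x)
    (hPJ : ∀ x y, P y * J x y = J x y) (hδ : 0 < δ) {C : ℝ} (hC : 0 ≤ C)
    (hG : ∀ x y, ‖J (T x) (T y) * A x - A y * J x y‖ ≤ C * dist x y ^ (θ : ℝ))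
    (hb : ∃ K r : ℝ, 0 ≤ r ∧ r < 1 ∧ ∀ x y, (x, y) ∈ shadowing T δ → ∀ n,
      ‖cocycle T P A n x‖ * ‖cocycle T.symm P B n (T^[n] y)‖ *
        dist (T^[n] x) (T^[n] y) ^ (θ : ℝ) ≤ K * r ^ n) :
    HolonomySystem T P A B J δ := by
  obtain ⟨K, r, hr0, hr1, hb⟩ := hb
  obtain ⟨M, hM, hMB⟩ := h.exists_norm_bwd_le
  refine ⟨h, hJ, hJd, hPJ, hδ, M * C * K, r, hr0, hr1, fun x y hxy n => ?_⟩
  have e1 : ∀ x y, holStage T P A B J 1 x y - J x y = B (T y) * (J (T x) (T y) * A x -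
      A y * J x y) := fun x y => by
    rw [mul_sub, ← mul_assoc (B (T y)) (A y), h.bwd_fwd, hPJ, holStage, h.cocycle_one,
      h.symm.cocycle_one]
    simp only [Function.iterate_one, mul_assoc]
  have e2 : holStage T P A B J (n + 1) x y - holStage T P A B J n x y =
      cocycle T.symm P B n (T^[n] y) * (holStage T P A B J 1 (T^[n] x) (T^[n] y) -
        J (T^[n] x) (T^[n] y)) * cocycle T P A n x := by
    rw [add_comm n 1, HolonomySystem.holStage_add h, mul_sub, sub_mul]
    rfl
  rw [e2, e1]
  calc _ ≤ ‖cocycle T.symm P B n (T^[n] y)‖ *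
        (M * (C * dist (T^[n] x) (T^[n] y) ^ (θ : ℝ))) * ‖cocycle T P A n x‖ := by
        refine (norm_mul_le _ _).trans (mul_le_mul_of_nonneg_right ?_ (norm_nonneg _))
        refine (norm_mul_le _ _).trans (mul_le_mul_of_nonneg_left ?_ (norm_nonneg _))
        exact (norm_mul_le _ _).trans (mul_le_mul (hMB _) (hG _ _) (norm_nonneg _) hM.le)
    _ = M * C * (‖cocycle T P A n x‖ * ‖cocycle T.symm P B n (T^[n] y)‖ *
        dist (T^[n] x) (T^[n] y) ^ (θ : ℝ)) := by ring
    _ ≤ M * C * (K * r ^ n) := mul_le_mul_of_nonneg_left (hb x y hxy n) (by positivity)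
    _ = _ := by ring

theorem LinearSystem.exists_intertwining_symm (h : LinearSystem T P A B)
    (hPJ : ∀ x y, P y * J x y = J x y) (hJP : ∀ x y, J x y * P x = J x y) {L : ℝ≥0}
    (hL : LipschitzWith L T.symm) {C : ℝ} (hC : 0 ≤ C)
    (hG : ∀ x y, ‖J (T x) (T y) * A x - A y * J x y‖ ≤ C * dist x y ^ (θ : ℝ)) :
    ∃ C', 0 ≤ C' ∧ ∀ x y, ‖J (T.symm x) (T.symm y) * B x - B y * J x y‖ ≤
      C' * dist x y ^ (θ : ℝ) := by
  obtain ⟨M, hM, hMB⟩ := h.exists_norm_bwd_le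
  refine ⟨M * (C * (L : ℝ) ^ (θ : ℝ)) * M, by positivity, fun x y => ?_⟩
  have hG' := hG (T.symm x) (T.symm y)
  simp only [T.apply_symm_apply] at hG'
  have hBA : B y * A (T.symm y) = P (T.symm y) := by simpa using h.bwd_fwd (T.symm y)
  have e : J (T.symm x) (T.symm y) * B x - B y * J x y =
      -(B y * (J x y * A (T.symm x) - A (T.symm y) * J (T.symm x) (T.symm y)) * B x) := by
    rw [mul_sub, sub_mul, ← mul_assoc (B y) (A _), hBA, hPJ, mul_assoc, mul_assoc, h.fwd_bwd, hJP]
    abel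
  rw [e, norm_neg]
  calc _ ≤ M * (C * (L * dist x y) ^ (θ : ℝ)) * M := by
        refine (norm_mul_le _ _).trans (mul_le_mul ?_ (hMB x) (norm_nonneg _) (by positivity))
        refine (norm_mul_le _ _).trans (mul_le_mul (hMB y) (hG'.trans ?_) (norm_nonneg _) hM.le)
        gcongr
        exact hL.dist_le_mul x y
    _ = _ := by
        rw [Real.mul_rpow (NNReal.coe_nonneg L) dist_nonneg]
        ring

/-- A family of norms `ν x` on the ranges of the projections `P x`, with bounds `m` and `m'` for
the norms of the linear maps and of their inverses. -/
structure Gauge (T : X ≃ₜ X) (P A : X → V →L[ℝ] V) (ν : X → V → ℝ) (m m' : X → ℝ) : Prop where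
  nonneg : ∀ x, 0 ≤ m x
  nonneg' : ∀ x, 0 ≤ m' x
  proj : ∀ x w, ν x (P x w) = ν x w
  fwd_le : ∀ x w, ν (T x) (A x w) ≤ m x * ν x w
  le_fwd : ∀ x w, ν x w ≤ m' x * ν (T x) (A x w)
  lower : ∃ c, 0 < c ∧ ∀ x w, P x w = w → ‖w‖ ≤ c * ν x w
  upper : ∃ c, 0 < c ∧ ∀ x w, ν x w ≤ c * ‖w‖

namespace Gauge

variable {ν : X → V → ℝ} {m m' : X → ℝ}

protected theorem symm (hν : Gauge T P A ν m m') (h : LinearSystem T P A B) :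
    Gauge T.symm P B ν (fun x => m' (T.symm x)) (fun x => m (T.symm x)) where
  nonneg x := hν.nonneg' _
  nonneg' x := hν.nonneg _
  proj := hν.proj
  fwd_le x w := by
    have := hν.le_fwd (T.symm x) (B x w)
    rwa [T.apply_symm_apply, show A (T.symm x) (B x w) = P x w by rw [← h.fwd_bwd]; rfl,
      hν.proj] at this
  le_fwd x w := by
    have := hν.fwd_le (T.symm x) (B x w)
    rwa [T.apply_symm_apply, show A (T.symm x) (B x w) = P x w by rw [← h.fwd_bwd]; rfl,
      hν.proj] at this
  lower := hν.lower
  upper := hν.upper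

theorem cocycle_le (hν : Gauge T P A ν m m') (h : LinearSystem T P A B) (n : ℕ) (x : X) (w : V) :
    ν (T^[n] x) (cocycle T P A n x w) ≤ (∏ j ∈ Finset.range n, m (T^[j] x)) * ν x w := by
  induction n with
  | zero => simp [cocycle, hν.proj]
  | succ n ih =>
    rw [h.cocycle_succ', mul_apply_eq_comp, Function.iterate_succ_apply', Finset.prod_range_succ]
    refine (hν.fwd_le _ _).trans ((mul_le_mul_of_nonneg_left ih (hν.nonneg _)).trans_eq ?_)
    ring

theorem cocycle_symm_le (hν : Gauge T P A ν m m') (h : LinearSystem T P A B) (n : ℕ) (x : X)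
    (w : V) : ν x (cocycle T.symm P B n (T^[n] x) w) ≤
      (∏ j ∈ Finset.range n, m' (T^[j] x)) * ν (T^[n] x) w := by
  induction n generalizing w with
  | zero => simp [cocycle, hν.proj]
  | succ n ih =>
    rw [cocycle, mul_apply_eq_comp, Function.iterate_succ_apply', T.symm_apply_apply,
      Finset.prod_range_succ]
    refine (ih _).trans ?_
    have := (hν.symm h).fwd_le (T (T^[n] x)) w
    rw [T.symm_apply_apply] at this
    rw [mul_assoc]
    exact mul_le_mul_of_nonneg_left this (Finset.prod_nonneg fun j _ => hν.nonneg' _)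

theorem exists_norm_le (hν : Gauge T P A ν m m') :
    ∃ c, 0 < c ∧ ∀ (x y : X) (L : V →L[ℝ] V) (t : ℝ), 0 ≤ t → P y * L = L →
      (∀ w, ν y (L w) ≤ t * ν x w) → ‖L‖ ≤ c * t := by
  obtain ⟨c, hc, hl⟩ := hν.lower
  obtain ⟨c', hc', hu⟩ := hν.upper
  refine ⟨c * c', by positivity, fun x y L t ht hPL hLt => ?_⟩
  refine ContinuousLinearMap.opNorm_le_bound _ (by positivity) fun w => ?_
  calc ‖L w‖ ≤ c * ν y (L w) := hl y _ (by rw [← mul_apply_eq_comp, hPL])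
    _ ≤ c * (t * (c' * ‖w‖)) := by
        gcongr
        exact (hLt w).trans (mul_le_mul_of_nonneg_left (hu x w) ht)
    _ = _ := by ring

/-- At each step the contraction factor exp(-θ lam) cancels θ lam in the bound for m m', leaving
e^{-η} and a coboundary of g, which telescopes to a bounded factor. The coboundary is there for the
inverse system, whose expansion bounds and contraction rates are evaluated at points one step apart.
-/
theorem exists_bunching (hν : Gauge T P A ν m m') (h : LinearSystem T P A B)
    {lam g : X → ℝ} (hg : Continuous g) {η : ℝ} (hη : 0 < η)
    (hstep : ∀ x y, dist x y ≤ δ → dist (T x) (T y) ≤ δ →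
      m x * m' y ≤ Real.exp (θ * lam y + g (T y) - g y - η))
    (hcontr : ∀ x y, (x, y) ∈ shadowing T δ → dist (T x) (T y) ≤ Real.exp (-lam y) * dist x y) :
    ∃ K r : ℝ, 0 ≤ r ∧ r < 1 ∧ ∀ x y, (x, y) ∈ shadowing T δ → ∀ n,
      ‖cocycle T P A n x‖ * ‖cocycle T.symm P B n (T^[n] y)‖ *
        dist (T^[n] x) (T^[n] y) ^ (θ : ℝ) ≤ K * r ^ n := by
  obtain ⟨c, hc, hnorm⟩ := hν.exists_norm_le
  obtain ⟨H, hH⟩ := isCompact_univ.exists_bound_of_continuousOn hg.continuousOn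
  refine ⟨c * c * (Real.exp (2 * H) * δ ^ (θ : ℝ)), Real.exp (-η), (Real.exp_pos _).le,
    Real.exp_lt_one_iff.2 (by linarith), fun x y hxy n => ?_⟩
  have key : ∀ n : ℕ, (∏ j ∈ Finset.range n, m (T^[j] x)) *
      (∏ j ∈ Finset.range n, m' (T^[j] y)) * dist (T^[n] x) (T^[n] y) ^ (θ : ℝ) ≤
      Real.exp (g (T^[n] y) - g y - n * η) * dist x y ^ (θ : ℝ) := by
    intro n
    induction n with
    | zero => simp
    | succ n ih =>
      have hs := hstep _ _ (hxy n) (by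
        have := hxy (n + 1)
        simpa only [Function.iterate_succ_apply'] using this)
      have hd := hcontr _ _ (shadowing_iterate hxy n)
      have hd' : dist (T (T^[n] x)) (T (T^[n] y)) ^ (θ : ℝ) ≤
          Real.exp (-(θ * lam (T^[n] y))) * dist (T^[n] x) (T^[n] y) ^ (θ : ℝ) := by
        refine (Real.rpow_le_rpow dist_nonneg hd (NNReal.coe_nonneg θ)).trans_eq ?_
        rw [Real.mul_rpow (Real.exp_pos _).le dist_nonneg, ← Real.exp_mul]
        ring_nf
      rw [Finset.prod_range_succ, Finset.prod_range_succ, Function.iterate_succ_apply',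
        Function.iterate_succ_apply']
      have p1 : 0 ≤ ∏ j ∈ Finset.range n, m (T^[j] x) := Finset.prod_nonneg fun j _ => hν.nonneg _
      have p2 : 0 ≤ ∏ j ∈ Finset.range n, m' (T^[j] y) :=
        Finset.prod_nonneg fun j _ => hν.nonneg' _
      have p3 : 0 ≤ dist (T^[n] x) (T^[n] y) ^ (θ : ℝ) := by positivity
      set a := ∏ j ∈ Finset.range n, m (T^[j] x)
      set a' := ∏ j ∈ Finset.range n, m' (T^[j] y)
      have p4 := hν.nonneg (T^[n] x)
      have p5 := hν.nonneg' (T^[n] y)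
      calc a * m (T^[n] x) * (a' * m' (T^[n] y)) * dist (T (T^[n] x)) (T (T^[n] y)) ^ (θ : ℝ)
          = (m (T^[n] x) * m' (T^[n] y)) * ((a * a') *
              dist (T (T^[n] x)) (T (T^[n] y)) ^ (θ : ℝ)) := by ring
        _ ≤ Real.exp (θ * lam (T^[n] y) + g (T (T^[n] y)) - g (T^[n] y) - η) * ((a * a') *
              (Real.exp (-(θ * lam (T^[n] y))) * dist (T^[n] x) (T^[n] y) ^ (θ : ℝ))) := by
            gcongr
        _ = Real.exp (θ * lam (T^[n] y) + g (T (T^[n] y)) - g (T^[n] y) - η) *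
              Real.exp (-(θ * lam (T^[n] y))) *
              (a * a' * dist (T^[n] x) (T^[n] y) ^ (θ : ℝ)) := by ring
        _ ≤ Real.exp (θ * lam (T^[n] y) + g (T (T^[n] y)) - g (T^[n] y) - η) *
              Real.exp (-(θ * lam (T^[n] y))) *
              (Real.exp (g (T^[n] y) - g y - n * η) * dist x y ^ (θ : ℝ)) := by gcongr
        _ = _ := by
            rw [← mul_assoc, ← Real.exp_add, ← Real.exp_add]
            push_cast
            ring_nf
  have q1 : 0 ≤ ∏ j ∈ Finset.range n, m (T^[j] x) := Finset.prod_nonneg fun j _ => hν.nonneg _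
  have q2 : 0 ≤ ∏ j ∈ Finset.range n, m' (T^[j] y) := Finset.prod_nonneg fun j _ => hν.nonneg' _
  have n1 := hnorm x (T^[n] x) _ _ q1 (h.proj_cocycle n x) (hν.cocycle_le h n x)
  have e := h.symm.proj_cocycle n (T^[n] y)
  rw [iterate_symm_apply_iterate] at e
  have n2 := hnorm (T^[n] y) y _ _ q2 e (hν.cocycle_symm_le h n y)
  have hH1 := abs_le.1 (hH y (mem_univ y))
  have hH2 := abs_le.1 (hH (T^[n] y) (mem_univ _))
  calc _ ≤ (c * ∏ j ∈ Finset.range n, m (T^[j] x)) * (c * ∏ j ∈ Finset.range n, m' (T^[j] y)) *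
        dist (T^[n] x) (T^[n] y) ^ (θ : ℝ) := by gcongr
    _ = c * c * ((∏ j ∈ Finset.range n, m (T^[j] x)) *
      (∏ j ∈ Finset.range n, m' (T^[j] y)) * dist (T^[n] x) (T^[n] y) ^ (θ : ℝ)) := by ring
    _ ≤ c * c * (Real.exp (g (T^[n] y) - g y - n * η) * dist x y ^ (θ : ℝ)) :=
        mul_le_mul_of_nonneg_left (key n) (by positivity)
    _ ≤ c * c * (Real.exp (2 * H + -η * n) * δ ^ (θ : ℝ)) := by
        gcongr
        · linarith
        · exact hxy 0
    _ = _ := by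
        rw [Real.exp_add, mul_comm (-η), Real.exp_nat_mul]
        ring

end Gauge

/-- The norm is measured along x and the inverse norm along y. Upper semicontinuity spreads the
strict pointwise inequality to nearby pairs, and compactness makes the gap uniform. -/
theorem exists_uniform_bunching {m m' g : X → ℝ} (hg : Continuous g)
    (hm0 : ∀ x, 0 ≤ m x) (hm0' : ∀ x, 0 ≤ m' x)
    (hm : ∀ x a, m x < a → ∀ᶠ y in 𝓝 x, m y ≤ a) (hm' : ∀ x a, m' x < a → ∀ᶠ y in 𝓝 x, m' y ≤ a)
    (hlt : ∀ x, m x * m' x < Real.exp (g x)) :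
    ∃ η δ : ℝ, 0 < η ∧ 0 < δ ∧ ∀ x y, dist x y ≤ δ → m x * m' y ≤ Real.exp (g y - η) := by
  suffices ∃ η δ : ℝ, 0 < η ∧ 0 < δ ∧ ∀ x ∈ (univ : Set X), ∀ y, dist x y ≤ δ →
      m x * m' y ≤ Real.exp (g y - η) by
    obtain ⟨η, δ, hη, hδ, h⟩ := this
    exact ⟨η, δ, hη, hδ, fun x => h x (mem_univ x)⟩
  refine isCompact_univ.induction_on (p := fun s => ∃ η δ : ℝ, 0 < η ∧ 0 < δ ∧ ∀ x ∈ s, ∀ y,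
    dist x y ≤ δ → m x * m' y ≤ Real.exp (g y - η)) ⟨1, 1, one_pos, one_pos, by simp⟩ ?_ ?_ ?_
  · rintro s t hst ⟨η, δ, hη, hδ, h⟩
    exact ⟨η, δ, hη, hδ, fun x hx => h x (hst hx)⟩
  · rintro s t ⟨η, δ, hη, hδ, h⟩ ⟨η', δ', hη', hδ', h'⟩
    refine ⟨min η η', min δ δ', lt_min hη hη', lt_min hδ hδ', fun x hx y hxy => ?_⟩
    rcases hx with hx | hx
    · refine (h x hx y (hxy.trans (min_le_left _ _))).trans (Real.exp_le_exp.2 ?_)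
      linarith [min_le_left η η']
    · refine (h' x hx y (hxy.trans (min_le_right _ _))).trans (Real.exp_le_exp.2 ?_)
      linarith [min_le_right η η']
  · intro x _
    have hc : Tendsto (fun ε : ℝ => (m x + ε) * (m' x + ε)) (𝓝[>] 0) (𝓝 (m x * m' x)) := by
      have : Continuous fun ε : ℝ => (m x + ε) * (m' x + ε) := by fun_prop
      simpa using (this.tendsto 0).mono_left nhdsWithin_le_nhds
    obtain ⟨ε, hε, hε0⟩ := ((hc.eventually_lt_const (hlt x)).and self_mem_nhdsWithin).exists
    have hε0 : 0 < ε := hε0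
    set a := m x + ε with ha
    set a' := m' x + ε with ha'
    have ha0 : 0 < a := by linarith [hm0 x]
    have ha0' : 0 < a' := by linarith [hm0' x]
    have hη0 : 0 < g x - Real.log (a * a') := by
      have := (Real.log_lt_iff_lt_exp (mul_pos ha0 ha0')).2 hε
      linarith
    set η := (g x - Real.log (a * a')) / 2 with hη
    have e3 : ∀ᶠ y in 𝓝 x, Real.log (a * a') + η < g y :=
      continuousAt_const.eventually_lt hg.continuousAt (by linarith)
    obtain ⟨r, hr, hball⟩ := Metric.eventually_nhds_iff_ball.1
      ((hm x a (by linarith)).and ((hm' x a' (by linarith)).and e3))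
    refine ⟨Metric.ball x (r / 2), mem_nhdsWithin_of_mem_nhds
      (Metric.ball_mem_nhds x (by linarith)), η, r / 4, by linarith, by linarith,
      fun y hy z hyz => ?_⟩
    rw [Metric.mem_ball] at hy
    have h1 := (hball y (by rw [Metric.mem_ball]; linarith)).1
    have h2 := (hball z (by
      rw [Metric.mem_ball]
      linarith [dist_triangle z y x, dist_comm z y])).2
    calc m y * m' z ≤ a * a' := mul_le_mul h1 h2.1 (hm0' z) ha0.le
      _ = Real.exp (Real.log (a * a')) := (Real.exp_log (mul_pos ha0 ha0')).symm
      _ ≤ _ := Real.exp_le_exp.2 (by linarith [h2.2])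

end Bunching

/-! ### The linear system of an automorphism, and its holonomies. -/

section BundleSystem

set_option linter.unusedSectionVars false

variable {X : Type*} [MetricSpace X] {F : Type*} [NormedAddCommGroup F] [NormedSpace ℝ F]
  [FiniteDimensional ℝ F]
  {E : X → Type*} [∀ x, AddCommGroup (E x)] [∀ x, Module ℝ (E x)]
  [∀ x, TopologicalSpace (E x)] [TopologicalSpace (TotalSpace F E)]
  [FiberBundle F E] [VectorBundle ℝ F E] {θ : ℝ≥0} {T : X ≃ₜ X} {δ : ℝ}

namespace BumpCover

variable (𝒰 : BumpCover F E θ)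

/-- The projection onto the embedded fiber. -/
def proj (x : X) : (𝒰.centers → F) →L[ℝ] (𝒰.centers → F) :=
  𝒰.conj (LinearMap.id : E x →ₗ[ℝ] E x)

/-- An automorphism, as a family of endomorphisms of the ambient space. -/
def fwd (Φ : Aut E T) (x : X) : (𝒰.centers → F) →L[ℝ] (𝒰.centers → F) :=
  𝒰.conj ((Φ x : E x →L[ℝ] E (T x)) : E x →ₗ[ℝ] E (T x))

/-- The transport maps, as a family of endomorphisms of the ambient space. -/
def transp (I : ∀ x y : X, E x →L[ℝ] E y) (x y : X) : (𝒰.centers → F) →L[ℝ] (𝒰.centers → F) :=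
  𝒰.conj (I x y : E x →ₗ[ℝ] E y)

theorem proj_apply (x : X) (w : 𝒰.centers → F) : 𝒰.proj x w = 𝒰.emb x (𝒰.ret x w) := rfl

theorem proj_emb (x : X) (u : E x) : 𝒰.proj x (𝒰.emb x u) = 𝒰.emb x u := 𝒰.conj_emb _ u

theorem fwd_apply (Φ : Aut E T) (x : X) (w : 𝒰.centers → F) :
    𝒰.fwd Φ x w = 𝒰.emb (T x) (Φ x (𝒰.ret x w)) := rfl

theorem fwd_emb (Φ : Aut E T) (x : X) (u : E x) :
    𝒰.fwd Φ x (𝒰.emb x u) = 𝒰.emb (T x) (Φ x u) := 𝒰.conj_emb _ u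

theorem ret_proj (x : X) (w : 𝒰.centers → F) : 𝒰.ret x (𝒰.proj x w) = 𝒰.ret x w :=
  𝒰.ret_emb x _

theorem ret_fwd (Φ : Aut E T) (x : X) (w : 𝒰.centers → F) :
    𝒰.ret (T x) (𝒰.fwd Φ x w) = Φ x (𝒰.ret x w) := 𝒰.ret_emb _ _

theorem emb_castFiber {x y : X} (h : x = y) (u : E x) :
    𝒰.emb y (castFiber h u) = 𝒰.emb x u := by
  subst h; rfl

theorem emb_symm_castFiber (Φ : Aut E T) {x z : X} (hz : z = x) (h : T x = T z) (u : E x) :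
    𝒰.emb z ((Φ z).symm (castFiber h (Φ x u))) = 𝒰.emb x u := by
  subst hz
  have : castFiber h (Φ z u) = Φ z u := rfl
  rw [this, ContinuousLinearEquiv.symm_apply_apply]

theorem fwd_inv_mul_fwd (Φ : Aut E T) (x : X) : 𝒰.fwd Φ.inv (T x) * 𝒰.fwd Φ x = 𝒰.proj x := by
  ext1 w
  rw [mul_apply_eq_comp, fwd_apply, ret_fwd]
  exact 𝒰.emb_symm_castFiber Φ (T.symm_apply_apply x) _ _

theorem fwd_mul_fwd_inv (Φ : Aut E T) (x : X) : 𝒰.fwd Φ (T.symm x) * 𝒰.fwd Φ.inv x = 𝒰.proj x := by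
  ext1 w
  rw [mul_apply_eq_comp, fwd_apply, ret_fwd]
  simp only [Aut.inv, ContinuousLinearEquiv.trans_apply, ContinuousLinearEquiv.apply_symm_apply]
  exact 𝒰.emb_castFiber _ _

theorem proj_mul_transp (I : ∀ x y : X, E x →L[ℝ] E y) (x y : X) :
    𝒰.proj y * 𝒰.transp I x y = 𝒰.transp I x y := 𝒰.conj_mul _ _

theorem transp_mul_proj (I : ∀ x y : X, E x →L[ℝ] E y) (x y : X) :
    𝒰.transp I x y * 𝒰.proj x = 𝒰.transp I x y := 𝒰.conj_mul _ _

theorem transp_self {I : ∀ x y : X, E x →L[ℝ] E y} (hI : IsTransport F θ I) (x : X) :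
    𝒰.transp I x x = 𝒰.proj x := by
  rw [transp, hI.1]
  rfl

theorem holderAt_transp (hθ : 0 < θ) (hE : IsHolderBundle F E θ)
    {I : ∀ x y : X, E x →L[ℝ] E y} (hI : IsTransport F θ I) (p : X × X) :
    HolderAt θ (fun p : X × X => 𝒰.transp I p.1 p.2) p :=
  𝒰.holderAt_conj_transport hθ hE hI p

theorem holderAt_fwd (hθ : 0 < θ) (hE : IsHolderBundle F E θ) {Φ : Aut E T}
    (hΦ : Φ.IsHolder F θ) (x : X) : HolderAt θ (𝒰.fwd Φ) x :=
  𝒰.holderAt_conj_aut hθ hE hΦ x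

theorem continuous_transp (hθ : 0 < θ) (hE : IsHolderBundle F E θ)
    {I : ∀ x y : X, E x →L[ℝ] E y} (hI : IsTransport F θ I) :
    Continuous fun p : X × X => 𝒰.transp I p.1 p.2 :=
  continuous_iff_continuousAt.2 fun p => (𝒰.holderAt_transp hθ hE hI p).continuousAt hθ

theorem continuous_proj (hθ : 0 < θ) (hE : IsHolderBundle F E θ) : Continuous 𝒰.proj := by
  obtain ⟨I, hI⟩ := 𝒰.exists_isTransport hθ hE
  have : 𝒰.proj = (fun p : X × X => 𝒰.transp I p.1 p.2) ∘ fun x => (x, x) :=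
    funext fun x => (𝒰.transp_self hI x).symm
  rw [this]
  exact (𝒰.continuous_transp hθ hE hI).comp (continuous_id.prodMk continuous_id)

theorem linearSystem [CompactSpace X] (hθ : 0 < θ) (hE : IsHolderBundle F E θ) {Φ : Aut E T}
    (hΦ : Φ.IsHolder F θ) : LinearSystem T 𝒰.proj (𝒰.fwd Φ) (𝒰.fwd Φ.inv) := by
  have hP := 𝒰.continuous_proj hθ hE
  have hA : Continuous (𝒰.fwd Φ) :=
    continuous_iff_continuousAt.2 fun x => (𝒰.holderAt_fwd hθ hE hΦ x).continuousAt hθ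
  have hBP : ∀ x, 𝒰.fwd Φ.inv x * 𝒰.proj x = 𝒰.fwd Φ.inv x := fun x => 𝒰.conj_mul _ _
  have hPB : ∀ x, 𝒰.proj (T.symm x) * 𝒰.fwd Φ.inv x = 𝒰.fwd Φ.inv x := fun x => 𝒰.conj_mul _ _
  exact ⟨hP, hA, continuous_bwd hP hA hBP hPB (𝒰.fwd_inv_mul_fwd Φ) (𝒰.fwd_mul_fwd_inv Φ),
    fun x => 𝒰.conj_mul _ _, fun x => 𝒰.conj_mul _ _, fun x => 𝒰.conj_mul _ _, hBP, hPB,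
    𝒰.fwd_inv_mul_fwd Φ, 𝒰.fwd_mul_fwd_inv Φ⟩

theorem exists_intertwining [CompactSpace X] (hθ : 0 < θ) (hE : IsHolderBundle F E θ) {Φ : Aut E T}
    (hΦ : Φ.IsHolder F θ) {I : ∀ x y : X, E x →L[ℝ] E y} (hI : IsTransport F θ I) :
    ∃ C, 0 ≤ C ∧ ∀ x y, ‖𝒰.transp I (T x) (T y) * 𝒰.fwd Φ x - 𝒰.fwd Φ y * 𝒰.transp I x y‖ ≤
      C * dist x y ^ (θ : ℝ) := by
  obtain ⟨K, hK⟩ := hΦ.1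
  refine exists_norm_le_dist_rpow hθ (G := fun p : X × X =>
    𝒰.transp I (T p.1) (T p.2) * 𝒰.fwd Φ p.1 - 𝒰.fwd Φ p.2 * 𝒰.transp I p.1 p.2)
    (fun p => ?_) fun x => ?_
  · have hTT : LipschitzWith (max (K * 1) (K * 1)) fun p : X × X => (T p.1, T p.2) :=
      (hK.comp LipschitzWith.prod_fst).prodMk (hK.comp LipschitzWith.prod_snd)
    have h1 : HolderAt θ (fun p : X × X => 𝒰.transp I (T p.1) (T p.2)) p :=
      HolderAt.comp_lipschitz (f := fun q : X × X => 𝒰.transp I q.1 q.2)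
        (g := fun p : X × X => (T p.1, T p.2)) (b := p)
        (𝒰.holderAt_transp hθ hE hI (T p.1, T p.2)) hTT
    have h2 : HolderAt θ (fun p : X × X => 𝒰.fwd Φ p.1) p :=
      HolderAt.comp_lipschitz (f := 𝒰.fwd Φ) (g := fun p : X × X => p.1) (b := p)
        (𝒰.holderAt_fwd hθ hE hΦ p.1) LipschitzWith.prod_fst
    have h3 : HolderAt θ (fun p : X × X => 𝒰.fwd Φ p.2) p :=
      HolderAt.comp_lipschitz (f := 𝒰.fwd Φ) (g := fun p : X × X => p.2) (b := p)
        (𝒰.holderAt_fwd hθ hE hΦ p.2) LipschitzWith.prod_snd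
    have h4 := h1.clm_comp hθ h2
    have h5 := h3.clm_comp hθ (𝒰.holderAt_transp hθ hE hI p)
    exact h4.sub h5
  · simp only [𝒰.transp_self hI]
    have e1 : 𝒰.proj (T x) * 𝒰.fwd Φ x = 𝒰.fwd Φ x := 𝒰.conj_mul _ _
    have e2 : 𝒰.fwd Φ x * 𝒰.proj x = 𝒰.fwd Φ x := 𝒰.conj_mul _ _
    rw [e1, e2, sub_self]

theorem cocycle_emb (Φ : Aut E T) (n : ℕ) (x : X) (u : E x) :
    cocycle T 𝒰.proj (𝒰.fwd Φ) n x (𝒰.emb x u) = 𝒰.emb (T^[n] x) (Φ.iter n x u) := by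
  induction n generalizing x with
  | zero => exact 𝒰.proj_emb x u
  | succ n ih =>
    rw [cocycle, mul_apply_eq_comp, fwd_emb, ih]
    rfl

/-- The stages applied to an embedded vector are the embedded terms of the sequence defining the
holonomy. Their convergence in V passes to the fiber through the continuous left inverse `ret`, so
the `limUnder` in the fiber is a true limit. -/
theorem emb_stableHolonomy {Φ : Aut E T}
    {B : X → (𝒰.centers → F) →L[ℝ] (𝒰.centers → F)}
    (h : HolonomySystem T 𝒰.proj (𝒰.fwd Φ) B (𝒰.transp (transport F E θ)) δ) {x y : X}
    (hxy : x ∈ stableSet T y) (u : E x) :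
    𝒰.emb y (Φ.stableHolonomy F θ x y u) =
      hol T 𝒰.proj (𝒰.fwd Φ) B (𝒰.transp (transport F E θ)) x y (𝒰.emb x u) := by
  set I := transport F E θ
  set s : ℕ → E y := fun n => (Φ.iter n y).symm (I (T^[n] x) (T^[n] y) (Φ.iter n x u)) with hs
  have hst : ∀ n, holStage T 𝒰.proj (𝒰.fwd Φ) B (𝒰.transp I) n x y (𝒰.emb x u) =
      𝒰.emb y (s n) := by
    intro n
    have e1 := 𝒰.cocycle_emb Φ n y (s n)
    simp only [hs, ContinuousLinearEquiv.apply_symm_apply] at e1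
    rw [holStage, mul_apply_eq_comp, mul_apply_eq_comp, cocycle_emb]
    have e2 : 𝒰.transp I (T^[n] x) (T^[n] y) (𝒰.emb _ (Φ.iter n x u)) =
        𝒰.emb _ (I (T^[n] x) (T^[n] y) (Φ.iter n x u)) := 𝒰.conj_emb _ _
    rw [e2, ← e1, ← mul_apply_eq_comp, h.cocycle_symm_mul_cocycle, proj_emb]
  set L := hol T 𝒰.proj (𝒰.fwd Φ) B (𝒰.transp I) x y (𝒰.emb x u) with hL
  have hlim : Tendsto (fun n => 𝒰.emb y (s n)) atTop (𝓝 L) := by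
    have : Tendsto (fun n => holStage T 𝒰.proj (𝒰.fwd Φ) B (𝒰.transp I) n x y (𝒰.emb x u)) atTop
        (𝓝 L) := ((ContinuousLinearMap.apply ℝ _ (𝒰.emb x u)).continuous.tendsto _).comp
          (h.tendsto hxy)
    simpa only [hst] using this
  have hret : Continuous (𝒰.ret y) := continuous_linearMap_to_fiber F y (𝒰.ret y)
  have hlim' : Tendsto s atTop (𝓝 (𝒰.ret y L)) := by
    have := (hret.tendsto L).comp hlim
    simpa only [Function.comp_def, ret_emb] using this
  have : T2Space (E y) := t2Space_fiber F y
  have e3 : Φ.stableHolonomy F θ x y u = 𝒰.ret y L := hlim'.limUnder_eq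
  rw [e3, ← proj_apply]
  have hlim'' := ((𝒰.proj y).continuous.tendsto L).comp hlim
  simp only [Function.comp_def, proj_emb] at hlim''
  exact tendsto_nhds_unique hlim'' hlim

theorem spanning {Φ : Aut E T} {d : ℕ} {lamU lamS : X → ℝ}
    (hΦ : Φ.IsSpannable F d θ lamU lamS)
    (hs : HolonomySystem T 𝒰.proj (𝒰.fwd Φ) (𝒰.fwd Φ.inv) (𝒰.transp (transport F E θ)) δ)
    (hu : HolonomySystem T.symm 𝒰.proj (𝒰.fwd Φ.inv) (𝒰.fwd Φ) (𝒰.transp (transport F E θ)) δ) :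
    Spanning T 𝒰.proj (𝒰.fwd Φ) (𝒰.fwd Φ.inv) (𝒰.transp (transport F E θ)) d := by
  intro x y w hw hw0
  have hwe : 𝒰.emb x (𝒰.ret x w) = w := hw
  obtain ⟨p, n, hp, hq, v, hv, hli, hsp⟩ := hΦ.spanning x y (𝒰.ret x w) (by
    intro h0
    rw [h0, map_zero] at hwe
    exact hw0 hwe.symm)
  refine ⟨p, n, hp, hq, ?_⟩
  let b := Module.Basis.mk hli hsp.ge
  -- The functionals are the coordinates in the basis v, so the identity to prove is the expansion
  -- of a vector in that basis.
  refine ⟨fun i => LinearMap.toContinuousLinearMap (b.coord i ∘ₗ 𝒰.ret y), ?_⟩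
  ext1 z
  have hvi : ∀ i, (hol T 𝒰.proj (𝒰.fwd Φ) (𝒰.fwd Φ.inv) (𝒰.transp (transport F E θ))
      (T^[n i] (p i)) y * cocycle T 𝒰.proj (𝒰.fwd Φ) (n i) (p i) *
      hol T.symm 𝒰.proj (𝒰.fwd Φ.inv) (𝒰.fwd Φ) (𝒰.transp (transport F E θ)) x (p i)) w =
      𝒰.emb y (v i) := by
    intro i
    have hx : x ∈ stableSet T.symm (p i) := by
      have : Tendsto _ _ _ := hp i
      simpa only [stableSet, mem_ofPred_eq, dist_comm] using this
    have e := 𝒰.emb_stableHolonomy hu hx (𝒰.ret x w)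
    rw [hwe] at e
    rw [mul_apply_eq_comp, mul_apply_eq_comp, ← e, cocycle_emb, ← 𝒰.emb_stableHolonomy hs (hq i),
      hv i]
    rfl
  rw [_root_.sum_apply]
  simp only [ContinuousLinearMap.smulRight_apply, hvi]
  rw [proj_apply]
  conv_lhs => rw [← b.sum_repr (𝒰.ret y z)]
  rw [map_sum]
  refine Finset.sum_congr rfl fun i _ => ?_
  rw [map_smul, Module.Basis.mk_apply]
  rfl

end BumpCover

end BundleSystem

/-! ### Finsler norms as gauges, and the holonomy systems of Φ and its inverse. -/

section Finsler

set_option linter.unusedSectionVars false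

variable {X : Type*} [MetricSpace X] {F : Type*} [NormedAddCommGroup F] [NormedSpace ℝ F]
  {E : X → Type*} [∀ x, AddCommGroup (E x)] [∀ x, Module ℝ (E x)]
  [∀ x, TopologicalSpace (E x)] [TopologicalSpace (TotalSpace F E)]
  [FiberBundle F E] [VectorBundle ℝ F E] {θ : ℝ≥0} {T : X ≃ₜ X}

namespace FinslerNorm

variable (N : FinslerNorm F E)

theorem map_zero (x : X) : N.toFun x 0 = 0 := by
  simpa using N.smul' x 0 0

theorem nonneg (x : X) (u : E x) : 0 ≤ N.toFun x u := by
  have h1 := N.add_le' x u ((-1 : ℝ) • u)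
  rw [N.smul', neg_one_smul, add_neg_cancel, map_zero] at h1
  norm_num at h1
  linarith

theorem pos {x : X} {u : E x} (hu : u ≠ 0) : 0 < N.toFun x u :=
  (N.nonneg x u).lt_of_ne fun h => hu (N.eq_zero' x u h.symm)

theorem opNorm_nonneg {x y : X} (L : E x →L[ℝ] E y) : 0 ≤ N.opNorm L :=
  Real.iSup_nonneg fun _ => div_nonneg (N.nonneg _ _) (N.nonneg _ _)

theorem opNorm_le {x y : X} {L : E x →L[ℝ] E y} {a : ℝ} (ha : 0 ≤ a)
    (h : ∀ u, N.toFun y (L u) ≤ a * N.toFun x u) : N.opNorm L ≤ a :=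
  Real.iSup_le (fun u => (div_le_iff₀ (N.pos u.2)).2 (h u)) ha

/-- A real supremum over an unbounded family is 0, so some bound must be known first. `le_opNorm`
supplies it by comparison with the ambient norm. -/
theorem le_opNorm_of_bound {x y : X} {L : E x →L[ℝ] E y} {a : ℝ}
    (h : ∀ u, N.toFun y (L u) ≤ a * N.toFun x u) (u : E x) :
    N.toFun y (L u) ≤ N.opNorm L * N.toFun x u := by
  rcases eq_or_ne u 0 with rfl | hu
  · rw [_root_.map_zero, N.map_zero, N.map_zero, mul_zero]
  · rw [← div_le_iff₀ (N.pos hu)]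
    refine le_ciSup (f := fun u : {u : E x // u ≠ 0} => N.toFun y (L u) / N.toFun x u) ?_ ⟨u, hu⟩
    refine ⟨a, ?_⟩
    rintro _ ⟨v, rfl⟩
    exact (div_le_iff₀ (N.pos v.2)).2 (h v)

variable [FiniteDimensional ℝ F] (𝒰 : BumpCover F E θ)

/-- The Finsler norm, read in the ambient space. -/
def gaugeFun (x : X) (w : 𝒰.centers → F) : ℝ := N.toFun x (𝒰.ret x w)

theorem gaugeFun_emb (x : X) (u : E x) : N.gaugeFun 𝒰 x (𝒰.emb x u) = N.toFun x u := by
  rw [gaugeFun, 𝒰.ret_emb]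

theorem gaugeFun_smul (x : X) (t : ℝ) (w : 𝒰.centers → F) :
    N.gaugeFun 𝒰 x (t • w) = |t| * N.gaugeFun 𝒰 x w := by
  rw [gaugeFun, map_smul, N.smul', gaugeFun]

theorem gaugeFun_proj (x : X) (w : 𝒰.centers → F) :
    N.gaugeFun 𝒰 x (𝒰.proj x w) = N.gaugeFun 𝒰 x w := by
  rw [gaugeFun, 𝒰.ret_proj, gaugeFun]

theorem gaugeFun_fwd (Φ : Aut E T) (x : X) (w : 𝒰.centers → F) :
    N.gaugeFun 𝒰 (T x) (𝒰.fwd Φ x w) = N.toFun (T x) (Φ x (𝒰.ret x w)) := by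
  rw [gaugeFun, 𝒰.ret_fwd]

theorem continuous_gaugeFun (hθ : 0 < θ) (hE : IsHolderBundle F E θ) :
    Continuous fun q : X × (𝒰.centers → F) => N.gaugeFun 𝒰 q.1 q.2 := by
  have h : Continuous fun q : X × (𝒰.centers → F) =>
      (⟨q.1, 𝒰.ret q.1 q.2⟩ : TotalSpace F E) := by
    rw [continuous_iff_continuousAt]
    rintro ⟨x, w⟩
    rw [FiberBundle.continuousAt_totalSpace]
    refine ⟨continuousAt_fst, ?_⟩
    set e := trivializationAt F E x with he
    have hx : x ∈ e.baseSet := FiberBundle.mem_baseSet_trivializationAt F E x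
    have h1 : ContinuousAt (fun q : X × (𝒰.centers → F) => 𝒰.retCoord e q.1 q.2) (x, w) :=
      ContinuousAt.clm_apply (ContinuousAt.comp (f := fun q : X × (𝒰.centers → F) => q.1)
        (g := 𝒰.retCoord e) ((𝒰.holderAt_retCoord hθ hE e hx).continuousAt hθ) continuousAt_fst)
        continuousAt_snd
    refine h1.congr ?_
    filter_upwards [continuous_fst.continuousAt (e.open_baseSet.mem_nhds hx)] with q hq
    have hq' : q.1 ∈ e.baseSet := hq
    simp only [BumpCover.retCoord, he] at *
    simp [Trivialization.coe_linearMapAt_of_mem _ hq']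
  exact N.continuous'.comp h

variable [CompactSpace X] (hθ : 0 < θ) (hE : IsHolderBundle F E θ)
include hθ hE

theorem exists_norm_le_gaugeFun :
    ∃ c, 0 < c ∧ ∀ x w, 𝒰.proj x w = w → ‖w‖ ≤ c * N.gaugeFun 𝒰 x w :=
  exists_norm_le_mul (𝒰.continuous_proj hθ hE) (N.continuous_gaugeFun 𝒰 hθ hE) (N.gaugeFun_smul 𝒰)
    fun x w hw hw0 => N.pos fun h => hw0 (by rw [← hw, 𝒰.proj_apply, h, _root_.map_zero])

theorem exists_gaugeFun_le : ∃ c, 0 < c ∧ ∀ x w, N.gaugeFun 𝒰 x w ≤ c * ‖w‖ :=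
  exists_le_mul_norm (N.continuous_gaugeFun 𝒰 hθ hE) (N.gaugeFun_smul 𝒰)

include 𝒰 in
theorem le_opNorm {x y : X} (L : E x →L[ℝ] E y) (u : E x) :
    N.toFun y (L u) ≤ N.opNorm L * N.toFun x u := by
  obtain ⟨c, hc, hl⟩ := N.exists_norm_le_gaugeFun 𝒰 hθ hE
  obtain ⟨c', hc', hu⟩ := N.exists_gaugeFun_le 𝒰 hθ hE
  refine N.le_opNorm_of_bound (a := c' * ‖𝒰.conj (L : E x →ₗ[ℝ] E y)‖ * c) (fun u => ?_) u
  rw [← N.gaugeFun_emb 𝒰 x, ← N.gaugeFun_emb 𝒰 y]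
  have e : 𝒰.emb y (L u) = 𝒰.conj (L : E x →ₗ[ℝ] E y) (𝒰.emb x u) := (𝒰.conj_emb _ u).symm
  calc _ ≤ c' * ‖𝒰.emb y (L u)‖ := hu _ _
    _ ≤ c' * (‖𝒰.conj (L : E x →ₗ[ℝ] E y)‖ * (c * N.gaugeFun 𝒰 x (𝒰.emb x u))) := by
        gcongr
        rw [e]
        refine (ContinuousLinearMap.le_opNorm _ _).trans ?_
        gcongr
        exact hl x _ (𝒰.proj_emb x u)
    _ = _ := by ring

theorem gauge (Φ : Aut E T) : Gauge T 𝒰.proj (𝒰.fwd Φ) (N.gaugeFun 𝒰)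
    (fun x => N.opNorm (Φ x : E x →L[ℝ] E (T x)))
    (fun x => N.opNorm ((Φ x).symm : E (T x) →L[ℝ] E x)) where
  nonneg x := N.opNorm_nonneg _
  nonneg' x := N.opNorm_nonneg _
  proj := N.gaugeFun_proj 𝒰
  fwd_le x w := by
    rw [N.gaugeFun_fwd, gaugeFun]
    exact N.le_opNorm 𝒰 hθ hE (Φ x : E x →L[ℝ] E (T x)) (𝒰.ret x w)
  le_fwd x w := by
    rw [N.gaugeFun_fwd, gaugeFun]
    have := N.le_opNorm 𝒰 hθ hE ((Φ x).symm : E (T x) →L[ℝ] E x) (Φ x (𝒰.ret x w))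
    simpa using this
  lower := N.exists_norm_le_gaugeFun 𝒰 hθ hE
  upper := N.exists_gaugeFun_le 𝒰 hθ hE

theorem continuous_gaugeFun_fwd {Φ : Aut E T} (hΦ : Φ.IsHolder F θ) :
    Continuous fun q : X × (𝒰.centers → F) => N.gaugeFun 𝒰 (T q.1) (𝒰.fwd Φ q.1 q.2) := by
  have hA := (𝒰.linearSystem hθ hE hΦ).continuous_fwd
  exact (N.continuous_gaugeFun 𝒰 hθ hE).comp ((T.continuous.comp continuous_fst).prodMk
    ((hA.comp continuous_fst).clm_apply continuous_snd))

include 𝒰 in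
theorem eventually_opNorm_le {Φ : Aut E T} (hΦ : Φ.IsHolder F θ) (x : X) (a : ℝ)
    (h : N.opNorm (Φ x : E x →L[ℝ] E (T x)) < a) :
    ∀ᶠ y in 𝓝 x, N.opNorm (Φ y : E y →L[ℝ] E (T y)) ≤ a := by
  have ha : 0 ≤ a := (N.opNorm_nonneg _).trans h.le
  have key := eventually_forall_le (f := fun x w => N.gaugeFun 𝒰 (T x) (𝒰.fwd Φ x w))
    (g := fun x w => a * N.gaugeFun 𝒰 x w) (x₀ := x) (𝒰.continuous_proj hθ hE)
    (N.continuous_gaugeFun_fwd 𝒰 hθ hE hΦ) ((N.continuous_gaugeFun 𝒰 hθ hE).const_mul a)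
    (fun x t w => by rw [map_smul, N.gaugeFun_smul])
    (fun x t w => by rw [N.gaugeFun_smul]; ring) fun w hw hw0 => ?_
  · filter_upwards [key] with y hy
    refine N.opNorm_le ha fun u => ?_
    have := hy _ (𝒰.proj_emb y u)
    rwa [N.gaugeFun_fwd, N.gaugeFun_emb, 𝒰.ret_emb] at this
  · refine ((N.gauge 𝒰 hθ hE Φ).fwd_le x w).trans_lt (mul_lt_mul_of_pos_right h ?_)
    exact N.pos fun h0 => hw0 (by rw [← hw, 𝒰.proj_apply, h0, _root_.map_zero])

include 𝒰 in
theorem eventually_opNorm_symm_le {Φ : Aut E T} (hΦ : Φ.IsHolder F θ) (x : X) (a : ℝ)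
    (h : N.opNorm ((Φ x).symm : E (T x) →L[ℝ] E x) < a) :
    ∀ᶠ y in 𝓝 x, N.opNorm ((Φ y).symm : E (T y) →L[ℝ] E y) ≤ a := by
  have ha : 0 ≤ a := (N.opNorm_nonneg _).trans h.le
  have key := eventually_forall_le (g := fun x w => a * N.gaugeFun 𝒰 (T x) (𝒰.fwd Φ x w))
    (f := fun x w => N.gaugeFun 𝒰 x w) (x₀ := x) (𝒰.continuous_proj hθ hE)
    (N.continuous_gaugeFun 𝒰 hθ hE) ((N.continuous_gaugeFun_fwd 𝒰 hθ hE hΦ).const_mul a)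
    (fun x t w => by rw [N.gaugeFun_smul])
    (fun x t w => by rw [map_smul, N.gaugeFun_smul]; ring) fun w hw hw0 => ?_
  · filter_upwards [key] with y hy
    refine N.opNorm_le ha fun u => ?_
    have := hy _ (𝒰.proj_emb y ((Φ y).symm u))
    rwa [N.gaugeFun_fwd, N.gaugeFun_emb, 𝒰.ret_emb, ContinuousLinearEquiv.apply_symm_apply] at this
  · refine ((N.gauge 𝒰 hθ hE Φ).le_fwd x w).trans_lt (mul_lt_mul_of_pos_right h ?_)
    rw [N.gaugeFun_fwd]
    refine N.pos fun h0 => hw0 ?_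
    rw [← hw, 𝒰.proj_apply, (Φ x).map_eq_zero_iff.1 h0, _root_.map_zero]

end FinslerNorm

theorem IsHyperbolic.exists_holonomySystem [FiniteDimensional ℝ F] [CompactSpace X]
    (𝒰 : BumpCover F E θ) (hθ : 0 < θ) (hE : IsHolderBundle F E θ) {ε₀ : ℝ} {lamU lamS : X → ℝ}
    (hT : IsHyperbolic T ε₀ lamU lamS) {Φ : Aut E T} (hΦ : Φ.IsHolder F θ)
    (hfb : Φ.IsFiberBunched F θ lamU lamS) {I : ∀ x y : X, E x →L[ℝ] E y}
    (hI : IsTransport F θ I) : ∃ δ,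
      HolonomySystem T 𝒰.proj (𝒰.fwd Φ) (𝒰.fwd Φ.inv) (𝒰.transp I) δ ∧
      HolonomySystem T.symm 𝒰.proj (𝒰.fwd Φ.inv) (𝒰.fwd Φ) (𝒰.transp I) δ := by
  obtain ⟨N, -, hN⟩ := hfb
  have hL := 𝒰.linearSystem hθ hE hΦ
  have hν := N.gauge 𝒰 hθ hE Φ
  set m : X → ℝ := fun x => N.opNorm (Φ x : E x →L[ℝ] E (T x)) with hm
  set m' : X → ℝ := fun x => N.opNorm ((Φ x).symm : E (T x) →L[ℝ] E x) with hm'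
  -- The product may vanish, where `Real.log 0 = 0` gives no information; the exponential bound is
  -- then trivial.
  have hlt : ∀ x, m x * m' x < Real.exp (min (θ * lamU x) (θ * lamS x)) := fun x => by
    rcases (mul_nonneg (hν.nonneg x) (hν.nonneg' x)).eq_or_lt with h0 | h0
    · rw [← h0]; exact Real.exp_pos _
    · exact (Real.log_lt_iff_lt_exp h0).1 (hN x)
  have hgS : Continuous fun x => θ * lamS x := continuous_const.mul hT.continuous_lamS
  have hgU : Continuous fun x => θ * lamU x := continuous_const.mul hT.continuous_lamU
  obtain ⟨η₁, δ₁, hη₁, hδ₁, h₁⟩ := exists_uniform_bunching hgS hν.nonneg hν.nonneg'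
    (N.eventually_opNorm_le 𝒰 hθ hE hΦ) (N.eventually_opNorm_symm_le 𝒰 hθ hE hΦ) fun x =>
      (hlt x).trans_le (Real.exp_le_exp.2 (min_le_right _ _))
  obtain ⟨η₂, δ₂, hη₂, hδ₂, h₂⟩ := exists_uniform_bunching hgU hν.nonneg' hν.nonneg
    (N.eventually_opNorm_symm_le 𝒰 hθ hE hΦ) (N.eventually_opNorm_le 𝒰 hθ hE hΦ) fun x => by
      rw [mul_comm]
      exact (hlt x).trans_le (Real.exp_le_exp.2 (min_le_left _ _))
  set δ := min (min δ₁ δ₂) ε₀ with hδ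
  have hδ0 : 0 < δ := lt_min (lt_min hδ₁ hδ₂) hT.eps_pos
  have hd1 : δ ≤ δ₁ := (min_le_left _ _).trans (min_le_left _ _)
  have hd2 : δ ≤ δ₂ := (min_le_left _ _).trans (min_le_right _ _)
  have hd3 : δ ≤ ε₀ := min_le_right _ _
  have hε : 0 ≤ ε₀ := hT.eps_pos.le
  have hJ := 𝒰.continuous_transp hθ hE hI
  obtain ⟨C, hC, hG⟩ := 𝒰.exists_intertwining hθ hE hΦ hI
  obtain ⟨L, hLip⟩ := hT.lipschitz_symm
  obtain ⟨C', hC', hG'⟩ := hL.exists_intertwining_symm (𝒰.proj_mul_transp I) (𝒰.transp_mul_proj I)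
    hLip hC hG
  refine ⟨δ, ?_, ?_⟩
  · refine hL.holonomySystem hJ (𝒰.transp_self hI) (𝒰.proj_mul_transp I) hδ0 hC hG
      (hν.exists_bunching hL (lam := lamS) (g := fun _ => 0) continuous_const hη₁
        (fun x y hxy _ => ?_) fun x y hxy => ?_)
    · simpa using h₁ x y (hxy.trans hd1)
    · exact hT.contract_stable y x (fun n => (hxy n).trans hd3) y (fun n => by simpa using hε)
  · refine hL.symm.holonomySystem hJ (𝒰.transp_self hI) (𝒰.proj_mul_transp I) hδ0 hC' hG'
      -- Bunching holds at T⁻¹y while T⁻¹ contracts at rate lamU y; the choice g = θ lamU turns one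
      -- exponent into the other.
      ((hν.symm hL).exists_bunching hL.symm (lam := lamU) (g := fun x => θ * lamU x) hgU hη₂
        (fun x y _ hxy => ?_) fun x y hxy => ?_)
    · simpa using h₂ (T.symm x) (T.symm y) (hxy.trans hd2)
    · exact hT.contract_unstable y x (fun n => (hxy n).trans hd3) y (fun n => by simpa using hε)

end Finsler

/-! ### Comparison of norms and the final estimate. -/

section Boundedness

set_option linter.unusedSectionVars false

variable {X : Type*} [MetricSpace X] [CompactSpace X] {F : Type*} [NormedAddCommGroup F]
  [NormedSpace ℝ F] [FiniteDimensional ℝ F]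
  {E : X → Type*} [∀ x, AddCommGroup (E x)] [∀ x, Module ℝ (E x)]
  [∀ x, TopologicalSpace (E x)] [TopologicalSpace (TotalSpace F E)]
  [FiberBundle F E] [VectorBundle ℝ F E] {θ : ℝ≥0} {T : X ≃ₜ X}

theorem FinslerNorm.exists_opNorm_iter_comparison (N : FinslerNorm F E) (𝒰 : BumpCover F E θ)
    (hθ : 0 < θ) (hE : IsHolderBundle F E θ) {Φ : Aut E T} (hΦ : Φ.IsHolder F θ) :
    ∃ D, 0 < D ∧ ∀ n x,
      N.opNorm (Φ.iter n x : E x →L[ℝ] E (T^[n] x)) ≤ D * ‖cocycle T 𝒰.proj (𝒰.fwd Φ) n x‖ ∧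
      ‖cocycle T 𝒰.proj (𝒰.fwd Φ) n x‖ ≤ D * N.opNorm (Φ.iter n x : E x →L[ℝ] E (T^[n] x)) := by
  have hL := 𝒰.linearSystem hθ hE hΦ
  obtain ⟨c, hc, hl⟩ := N.exists_norm_le_gaugeFun 𝒰 hθ hE
  obtain ⟨c', hc', hu⟩ := N.exists_gaugeFun_le 𝒰 hθ hE
  obtain ⟨k, hk, hn⟩ := (N.gauge 𝒰 hθ hE Φ).exists_norm_le
  refine ⟨max (c' * c) k, lt_max_of_lt_right hk, fun n x => ⟨?_, ?_⟩⟩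
  · refine le_trans ?_ (mul_le_mul_of_nonneg_right (le_max_left _ k) (norm_nonneg _))
    refine N.opNorm_le (by positivity) fun u => ?_
    have h1 := hu (T^[n] x) (𝒰.emb (T^[n] x) (Φ.iter n x u))
    have h2 := hl x (𝒰.emb x u) (𝒰.proj_emb x u)
    rw [N.gaugeFun_emb] at h1 h2
    rw [← 𝒰.cocycle_emb] at h1
    calc N.toFun _ (Φ.iter n x u) ≤ c' * ‖cocycle T 𝒰.proj (𝒰.fwd Φ) n x (𝒰.emb x u)‖ := h1
      _ ≤ c' * (‖cocycle T 𝒰.proj (𝒰.fwd Φ) n x‖ * (c * N.toFun x u)) := by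
          gcongr
          refine (ContinuousLinearMap.le_opNorm _ _).trans ?_
          gcongr
      _ = _ := by ring
  · refine le_trans ?_ (mul_le_mul_of_nonneg_right (le_max_right (c' * c) k) (N.opNorm_nonneg _))
    refine hn x _ _ _ (N.opNorm_nonneg _) (hL.proj_cocycle n x) fun w => ?_
    have h1 : cocycle T 𝒰.proj (𝒰.fwd Φ) n x w = 𝒰.emb (T^[n] x) (Φ.iter n x (𝒰.ret x w)) := by
      rw [← 𝒰.cocycle_emb, ← 𝒰.proj_apply, ← mul_apply_eq_comp, hL.cocycle_proj]
    rw [h1, N.gaugeFun_emb]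
    exact N.le_opNorm 𝒰 hθ hE (Φ.iter n x : E x →L[ℝ] E (T^[n] x)) (𝒰.ret x w)

/-- The cocycle has a left inverse modulo the projection, which is nonzero because it fixes embedded
vectors. -/
theorem BumpCover.norm_cocycle_pos [Nontrivial F] (𝒰 : BumpCover F E θ)
    (hθ : 0 < θ) (hE : IsHolderBundle F E θ) {Φ : Aut E T} (hΦ : Φ.IsHolder F θ) (n : ℕ) (x : X) :
    0 < ‖cocycle T 𝒰.proj (𝒰.fwd Φ) n x‖ := by
  have hL := 𝒰.linearSystem hθ hE hΦ
  refine norm_pos_iff.2 fun h0 => ?_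
  have h1 := hL.cocycle_symm_mul_cocycle n x
  rw [h0, mul_zero] at h1
  obtain ⟨f, hf⟩ := exists_ne (0 : F)
  let e := (trivializationAt F E x).continuousLinearEquivAt ℝ x
    (FiberBundle.mem_baseSet_trivializationAt F E x)
  have h2 := 𝒰.proj_emb x (e.symm f)
  rw [← h1, zero_apply] at h2
  have h3 := 𝒰.ret_emb x (e.symm f)
  rw [← h2, _root_.map_zero] at h3
  exact hf (by simpa using congrArg e h3.symm)

theorem abs_log_sub_log_le {D s t : ℝ} (hD : 0 < D) (ht : 0 < t) (hst : s ≤ D * t)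
    (hts : t ≤ D * s) : |Real.log s - Real.log t| ≤ Real.log D := by
  have hs : 0 < s := pos_of_mul_pos_right (ht.trans_le hts) hD.le
  have h1 := Real.log_le_log hs hst
  have h2 := Real.log_le_log ht hts
  rw [Real.log_mul hD.ne' ht.ne'] at h1
  rw [Real.log_mul hD.ne' hs.ne'] at h2
  exact abs_le.2 ⟨by linarith, by linarith⟩

theorem tendsto_one_div_mul_of_bounded {u : ℕ → ℝ} {D : ℝ} (hu : ∀ n, |u n| ≤ D) :
    Tendsto (fun n : ℕ => (1 / (n : ℝ)) * u n) atTop (𝓝 0) :=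
  tendsto_one_div_atTop_nhds_zero_nat.zero_mul_isBoundedUnder_le
    ⟨D, eventually_map.2 (Eventually.of_forall hu)⟩

theorem Aut.IsSpannable.isRelativelyProductBounded [MeasurableSpace X] [BorelSpace X] {d : ℕ}
    (hθ : 0 < θ) (hnormal : NormalHolderAlgebra X θ) (hE : IsHolderBundle F E θ)
    {ε₀ : ℝ} {lamU lamS : X → ℝ} (hT : IsHyperbolic T ε₀ lamU lamS) {Φ : Aut E T}
    (hΦ : Φ.IsSpannable F d θ lamU lamS) (N : FinslerNorm F E) :
    Φ.IsRelativelyProductBounded N := by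
  rcases isEmpty_or_nonempty X with hX | hX
  · exact ⟨0, fun _ x => isEmptyElim x⟩
  -- In rank zero the logarithms below are meaningless, but every operator norm is a supremum over
  -- the empty set, that is 0.
  rcases subsingleton_or_nontrivial F with hF | hF
  · refine ⟨0, fun n x => ?_⟩
    have hx : IsEmpty {u : E x // u ≠ 0} := ⟨fun u => u.2 <|
      ((trivializationAt F E x).continuousLinearEquivAt ℝ x
        (FiberBundle.mem_baseSet_trivializationAt F E x)).injective (Subsingleton.elim _ _)⟩
    rw [FinslerNorm.opNorm, Real.iSup_of_isEmpty, mul_zero]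
  obtain ⟨𝒰⟩ := hnormal.nonempty_bumpCover (F := F) (E := E)
  have hI : IsTransport F θ (transport F E θ) := Classical.epsilon_spec (𝒰.exists_isTransport hθ hE)
  obtain ⟨δ, hs, hu⟩ := hT.exists_holonomySystem 𝒰 hθ hE hΦ.isHolder hΦ.isFiberBunched hI
  obtain ⟨C, hC, hqm⟩ := hT.exists_quasimultiplicative hs hu (𝒰.spanning hΦ hs hu)
  obtain ⟨D, hD, hcmp⟩ := N.exists_opNorm_iter_comparison 𝒰 hθ hE hΦ.isHolder
  have hL := hs.toLinearSystem
  have hpos := 𝒰.norm_cocycle_pos hθ hE hΦ.isHolder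
  obtain ⟨K, hK, hbwd⟩ := hL.exists_norm_bwd_le
  set φ : ℕ → X → ℝ := fun n x => Real.log ‖cocycle T 𝒰.proj (𝒰.fwd Φ) n x‖ with hφ
  have hφc : ∀ n, Continuous (φ n) := fun n =>
    (hL.continuous_cocycle n).norm.log fun x => (hpos n x).ne'
  have hsub : ∀ m n x, φ (m + n) x ≤ φ m (T^[n] x) + φ n x := fun m n x => by
    simp only [hφ]
    rw [← Real.log_mul (hpos _ _).ne' (hpos _ _).ne']
    refine Real.log_le_log (hpos _ _) ?_
    rw [hL.cocycle_add]
    exact norm_mul_le _ _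
  have hstep : ∀ n x, φ n x ≤ φ (n + 1) x + Real.log K := fun n x => by
    simp only [hφ]
    rw [← Real.log_mul (hpos _ _).ne' hK.ne']
    refine Real.log_le_log (hpos _ _) ?_
    have e : cocycle T 𝒰.proj (𝒰.fwd Φ) n x =
        𝒰.fwd Φ.inv (T (T^[n] x)) * cocycle T 𝒰.proj (𝒰.fwd Φ) (n + 1) x := by
      rw [hL.cocycle_succ', ← mul_assoc, hL.bwd_fwd, hL.proj_cocycle]
    calc _ = ‖𝒰.fwd Φ.inv (T (T^[n] x)) * cocycle T 𝒰.proj (𝒰.fwd Φ) (n + 1) x‖ := by rw [← e]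
      _ ≤ _ := norm_mul_le _ _
      _ ≤ _ := by
        rw [mul_comm]
        exact mul_le_mul_of_nonneg_left (hbwd _) (norm_nonneg _)
  have hsup : ∀ m n x y S, (∀ z, φ (m + n) z ≤ S) → φ m y + φ n x ≤ Real.log C + S := by
    intro m n x y S hS
    have h1 := hqm m n x y (Real.exp S) fun z => (Real.log_le_iff_le_exp (hpos _ _)).1 (hS z)
    have h2 := Real.log_le_log (mul_pos (hpos _ _) (hpos _ _)) h1
    rwa [Real.log_mul (hpos _ _).ne' (hpos _ _).ne', Real.log_mul hC.ne' (Real.exp_pos S).ne',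
      Real.log_exp] at h2
  obtain ⟨b, hb, μ, hμ, hμT, hbμ⟩ := exists_growth_rate hφc hsub hstep hsup
  obtain ⟨M, hM0, hM⟩ := exists_abs_le_add_mul hφc hsub hstep
  have hbd : ∀ x (n : ℕ), |(1 / (n : ℝ)) * φ n x| ≤ 2 * M := fun x n => by
    rcases n.eq_zero_or_pos with rfl | hn
    · simpa using hM0
    · have hn1 : (1 : ℝ) ≤ n := by exact_mod_cast hn
      rw [abs_mul, abs_of_nonneg (by positivity), one_div, inv_mul_le_iff₀ (by positivity)]
      nlinarith [hM n x]
  -- Finsler and ambient norms of the iterates are comparable by the factor D, so their logarithms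
  -- differ by at most log D, which disappears after division by n.
  have hlyap : ∀ x, Φ.lyapunov N x = limsup (fun n : ℕ => (1 / (n : ℝ)) * φ n x) atTop := fun x => by
    refine limsup_eq_of_tendsto_sub (hbd x) ?_
    simp only [← mul_sub]
    exact tendsto_one_div_mul_of_bounded fun n =>
      abs_log_sub_log_le hD (hpos n x) (hcmp n x).1 (hcmp n x).2
  have hlyap_le : ∀ x, ‖Φ.lyapunov N x‖ ≤ 2 * M := fun x => by
    rw [hlyap, Real.norm_eq_abs, abs_le]
    have hbelow : IsBoundedUnder (· ≥ ·) atTop fun n : ℕ => (1 / (n : ℝ)) * φ n x :=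
      ⟨-(2 * M), eventually_map.2 (Eventually.of_forall fun n => (abs_le.1 (hbd x n)).1)⟩
    have habove : IsBoundedUnder (· ≤ ·) atTop fun n : ℕ => (1 / (n : ℝ)) * φ n x :=
      ⟨2 * M, eventually_map.2 (Eventually.of_forall fun n => (abs_le.1 (hbd x n)).2)⟩
    exact ⟨le_limsup_of_le habove fun a ha => by
        obtain ⟨n, hn⟩ := ha.exists
        exact (abs_le.1 (hbd x n)).1.trans hn,
      limsup_le_of_le hbelow.isCoboundedUnder_le
        (Eventually.of_forall fun n => (abs_le.1 (hbd x n)).2)⟩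
  -- The bound 2M on the exponents makes the set of integrals bounded above, without which `sSup`
  -- would not dominate its elements.
  have hβ : b ≤ Φ.beta N := by
    refine le_csSup_of_le ?_ ⟨μ, hμ, hμT, rfl⟩ (hbμ.trans_eq (by simp only [hlyap]))
    refine ⟨2 * M, ?_⟩
    rintro _ ⟨ν, hν, -, rfl⟩
    have := norm_integral_le_of_norm_le_const (μ := ν) (Eventually.of_forall hlyap_le)
    rw [probReal_univ, mul_one] at this
    exact (le_abs_self _).trans this
  refine ⟨D * C, fun n x => ?_⟩
  have h1 : ‖cocycle T 𝒰.proj (𝒰.fwd Φ) n x‖ ≤ Real.exp (Φ.beta N * n) * C := by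
    rw [← Real.exp_log hC, ← Real.exp_add, ← Real.log_le_iff_le_exp (hpos n x)]
    have := hb n x
    have h2 : n * b ≤ Φ.beta N * n := by
      rw [mul_comm]
      exact mul_le_mul_of_nonneg_right hβ n.cast_nonneg
    simp only [hφ] at this
    linarith
  calc _ ≤ Real.exp (-(Φ.beta N) * n) * (D * (Real.exp (Φ.beta N * n) * C)) := by
        gcongr
        exact (hcmp n x).1.trans (mul_le_mul_of_nonneg_left h1 hD.le)
    _ = (Real.exp (-(Φ.beta N) * n) * Real.exp (Φ.beta N * n)) * (D * C) := by ring
    _ = D * C := by rw [← Real.exp_add, neg_mul, neg_add_cancel, Real.exp_zero, one_mul]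

end Boundedness

end SpannableCocycle

end

theorem proposition4p1 {X : Type*} [MetricSpace X] [CompactSpace X] [MeasurableSpace X]
    [BorelSpace X] (d : ℕ) (E : X → Type*) [∀ x, AddCommGroup (E x)] [∀ x, Module ℝ (E x)]
    [∀ x, TopologicalSpace (E x)] [TopologicalSpace (TotalSpace (EuclideanSpace ℝ (Fin d)) E)]
    [FiberBundle (EuclideanSpace ℝ (Fin d)) E] [VectorBundle ℝ (EuclideanSpace ℝ (Fin d)) E]
    (θ : ℝ≥0) (hθ : 0 < θ) (hnormal : SpannableCocycle.NormalHolderAlgebra X θ)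
    (hE : SpannableCocycle.IsHolderBundle (EuclideanSpace ℝ (Fin d)) E θ)
    (T : X ≃ₜ X) (ε₀ : ℝ) (lamU lamS : X → ℝ)
    (hT : SpannableCocycle.IsHyperbolic T ε₀ lamU lamS)
    (Φ : SpannableCocycle.Aut E T)
    (hΦ : Φ.IsSpannable (EuclideanSpace ℝ (Fin d)) d θ lamU lamS)
    (N : SpannableCocycle.FinslerNorm (EuclideanSpace ℝ (Fin d)) E) :
    Φ.IsRelativelyProductBounded N :=
  hΦ.isRelativelyProductBounded hθ hnormal hE hT N
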